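/- Let $\Bbbk$ be a commutative ring, $\delta,\delta'\in\Bbbk$, and let $n\geq 1$ be such that $(n-1)!$ is invertible in $\Bbbk$ (for instance, a field whose characteristic is $0$ or larger than $n-1$). For $m\ge 0$ let $\mathfrak{R}_m=\mathfrak{R}_m(\delta,\delta')$ be the partial Brauer algebra. It is the free $\Bbbk$-module whose basis consists of the partial Brauer diagrams, i.e. the partitions of $\{1,\dots,m\}\cup\{1',\dots,m'\}$ (left-hand and right-hand vertices) into singletons and pairs. The product $dd'$ of two diagrams is obtained by juxtaposing $d$ (on the left) and $d'$ (on the right) and removing the connected components inside the juxtaposition, each removed loop giving a factor $\delta$ and each removed open string a factor $\delta'$. The propagating number of a diagram is the number of its parts that contain both a left-hand and a right-hand vertex (propagating lines). A left cell $\mathcal{L}$ is a class of diagrams that have the same parts contained in $\{1',\dots,m'\}$; all of its elements have the same propagating number. Let $\mathbf{C}_{\mathcal{L}}$ be the free $\Bbbk$-module with basis $\mathcal{L}$, on which $\mathfrak{R}_m$ acts by $d\cdot d'=dd'$ if $dd'\in\mathbf{C}_{\mathcal{L}}$ and $d\cdot d'=0$ otherwise. If $\mathcal{L}$ has propagating number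 $k$, the symmetric group $S_k$ acts on $\mathbf{C}_{\mathcal{L}}$ from the right by permuting the right-hand ends of the propagating lines (numbered in increasing order). For a partition $\lambda\vdash k$ with $k\le m$ the Specht module of $\mathfrak{R}_m$ is $$\Delta(m,\lambda):=\mathbf{C}_{\mathcal{L}}\otimes_{\Bbbk[S_k]}\mathcal{S}_{\Bbbk}(\lambda),$$ where $\mathcal{L}$ is some fixed left cell with propagating number $k$ and $\mathcal{S}_{\Bbbk}(\lambda)=\Bbbk\otimes_{\mathbb{Z}}\mathcal{S}_{\mathbb{Z}}(\lambda)$ is obtained from the integral Specht module $\mathcal{S}_{\mathbb{Z}}(\lambda)$ of $S_k$ (spanned by the polytabloids). For $k>m$ set $\Delta(m,\lambda):=0$. Write $\mu\to\lambda$ if the Young diagram of $\mu$ is obtained from that of $\lambda$ by removing one node. Let $\mathfrak{i}^*$ be the restriction from $\mathfrak{R}_n$-modules to $\mathfrak{R}_{n-1}$-modules along the algebra homomorphism $\mathfrak{R}_{n-1}\to\mathfrak{R}_n$ that adds to each diagram the part $\{n,n'\}$. Then, for every $k\le n$, every $\lambda\vdash k$ and every choice of the left cells used in the definition of the Specht modules,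 there is a short exact sequence of $\mathfrak{R}_{n-1}$-modules $$0\to \Delta(n-1,\lambda)\oplus\bigoplus_{\mu\to\lambda}\Delta(n-1,\mu)\to \mathfrak{i}^*(\Delta(n,\lambda))\to\bigoplus_{\lambda\to\mu}\Delta(n-1,\mu)\to 0 .$$ -/

import Mathlib

/-- A partition of `X` into singletons and pairs: `partner x` is the other element of the part
of `x` if that part is a pair, and `x` itself if `{x}` is a part. -/
@[ext]
structure Matching (X : Type*) where
  partner : X → X
  invol : Function.Involutive partner

namespace Matching

variable {X Y : Type*}

section Join

variable [DecidableEq X]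

/-- Glue the points `x` and `y` together and erase the glued point: a part `{p, x}` and a part
`{q, y}` become the part `{p, q}`, a part `{p, x}` and a singleton `{y}` (or `{p, y}` and `{x}`)
become the singleton `{p}`. If `{x, y}` is a part, or both `{x}` and `{y}` are, the component closes
up and is removed. The other parts do not change; the erased points `x` and `y` remain in the type
as singletons without meaning. -/
def joinFun (s : X → X) (x y p : X) : X :=
  if p = x ∨ p = y then p
  else if s p = x then (if s y = y then p else s y)
  else if s p = y then (if s x = x then p else s x)
  else s p

theorem joinFun_invol {s : X → X} (hs : Function.Involutive s) (x y : X) :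
    Function.Involutive (joinFun s x y) := by
  intro p
  have h1 := hs p
  have h2 := hs x
  have h3 := hs y
  unfold joinFun
  grind

/-- Gluing and erasing the two points of `q`, see `joinFun`. -/
def join (m : Matching X) (q : X × X) : Matching X :=
  ⟨joinFun m.partner q.1 q.2, joinFun_invol m.invol q.1 q.2⟩

/-- The number of loops that are removed when the two distinct points of `q` are glued. -/
def joinLoops (m : Matching X) (q : X × X) : ℕ := if m.partner q.1 = q.2 then 1 else 0

/-- The number of open strings that are removed when the two distinct points of `q` are glued. -/
def joinStrings (m : Matching X) (q : X × X) : ℕ :=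
  if m.partner q.1 = q.1 ∧ m.partner q.2 = q.2 then 1 else 0

theorem join_comm (m : Matching X) {x y z w : X} (hxy : x ≠ y) (hzw : z ≠ w) (hxz : x ≠ z)
    (hxw : x ≠ w) (hyz : y ≠ z) (hyw : y ≠ w) :
    (m.join (x, y)).join (z, w) = (m.join (z, w)).join (x, y) := by
  obtain ⟨s, hs⟩ := m
  ext p
  have h1 := hs p
  have h2 := hs x
  have h3 := hs y
  have h4 := hs z
  have h5 := hs w
  simp only [join, joinFun]
  grind

theorem joinLoops_comm (m : Matching X) {x y z w : X} (hxy : x ≠ y) (hzw : z ≠ w) (hxz : x ≠ z)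
    (hxw : x ≠ w) (hyz : y ≠ z) (hyw : y ≠ w) :
    m.joinLoops (x, y) + (m.join (x, y)).joinLoops (z, w) =
      m.joinLoops (z, w) + (m.join (z, w)).joinLoops (x, y) := by
  obtain ⟨s, hs⟩ := m
  have h2 := hs x
  have h3 := hs y
  have h4 := hs z
  have h5 := hs w
  simp only [join, joinFun, joinLoops]
  grind

theorem joinStrings_comm (m : Matching X) {x y z w : X} (hxy : x ≠ y) (hzw : z ≠ w) (hxz : x ≠ z)
    (hxw : x ≠ w) (hyz : y ≠ z) (hyw : y ≠ w) :
    m.joinStrings (x, y) + (m.join (x, y)).joinStrings (z, w) =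
      m.joinStrings (z, w) + (m.join (z, w)).joinStrings (x, y) := by
  obtain ⟨s, hs⟩ := m
  have h2 := hs x
  have h3 := hs y
  have h4 := hs z
  have h5 := hs w
  simp only [join, joinFun, joinStrings]
  grind (splits := 25)

/-- Perform `join` for all pairs in a list; the other components are the total numbers of removed
loops and of removed open strings. -/
def contract : Matching X → List (X × X) → Matching X × ℕ × ℕ
  | m, [] => (m, 0, 0)
  | m, q :: l =>
    ((contract (m.join q) l).1,
      m.joinLoops q + (contract (m.join q) l).2.1,
      m.joinStrings q + (contract (m.join q) l).2.2)

theorem contract_append (m : Matching X) (l l' : List (X × X)) :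
    m.contract (l ++ l') = (((m.contract l).1.contract l').1,
      (m.contract l).2.1 + ((m.contract l).1.contract l').2.1,
      (m.contract l).2.2 + ((m.contract l).1.contract l').2.2) := by
  induction l generalizing m with
  | nil => simp [contract]
  | cons q l ih => simp [contract, ih, add_assoc]

/-- A list of pairs of distinct points, different pairs being disjoint. -/
def Separated (l : List (X × X)) : Prop :=
  (∀ q ∈ l, q.1 ≠ q.2) ∧
    ∀ p ∈ l, ∀ q ∈ l, p ≠ q → p.1 ≠ q.1 ∧ p.1 ≠ q.2 ∧ p.2 ≠ q.1 ∧ p.2 ≠ q.2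

theorem contract_perm {l l' : List (X × X)} (h : l.Perm l') (hl : Separated l) (m : Matching X) :
    m.contract l = m.contract l' := by
  induction h generalizing m with
  | nil => rfl
  | cons q h ih =>
    have := ih ⟨fun p hp => hl.1 p (by simp [hp]),
      fun p hp r hr => hl.2 p (by simp [hp]) r (by simp [hr])⟩ (m.join q)
    simp [contract, this]
  | swap p q l =>
    by_cases hpq : q = p
    · rw [hpq]
    obtain ⟨x, y⟩ := q
    obtain ⟨z, w⟩ := p
    have h1 := hl.1 (x, y) (by simp)
    have h2 := hl.1 (z, w) (by simp)
    obtain ⟨h3, h4, h5, h6⟩ := hl.2 (x, y) (by simp) (z, w) (by simp) hpq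
    have e1 := join_comm m h1 h2 h3 h4 h5 h6
    have e2 := joinLoops_comm m h1 h2 h3 h4 h5 h6
    have e3 := joinStrings_comm m h1 h2 h3 h4 h5 h6
    simp only [contract, ← add_assoc, e2, e3, e1]
  | trans h1 h2 ih1 ih2 =>
    rw [ih1 hl m]
    exact ih2 ⟨fun p hp => hl.1 p (h1.mem_iff.2 hp),
      fun p hp r hr => hl.2 p (h1.mem_iff.2 hp) r (h1.mem_iff.2 hr)⟩ m

theorem join_of_ne (m : Matching X) {q : X × X} {p : X} (h1 : p ≠ q.1) (h2 : p ≠ q.2)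
    (h3 : m.partner p ≠ q.1) (h4 : m.partner p ≠ q.2) : (m.join q).partner p = m.partner p := by
  simp [join, joinFun, h1, h2, h3, h4]

theorem contract_of_ne (l : List (X × X)) (m : Matching X) {p : X}
    (h : ∀ q ∈ l, p ≠ q.1 ∧ p ≠ q.2 ∧ m.partner p ≠ q.1 ∧ m.partner p ≠ q.2) :
    (m.contract l).1.partner p = m.partner p := by
  induction l generalizing m with
  | nil => rfl
  | cons q l ih =>
    obtain ⟨h1, h2, h3, h4⟩ := h q (by simp)
    have e := join_of_ne m h1 h2 h3 h4
    simp only [contract]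
    rw [ih, e]
    rw [e]
    exact fun r hr => h r (by simp [hr])

theorem join_fixed (m : Matching X) {q : X × X} {p : X} (h : m.partner p = p) :
    (m.join q).partner p = p := by
  simp only [join, joinFun]
  grind

theorem contract_fixed (l : List (X × X)) (m : Matching X) {p : X} (h : m.partner p = p) :
    (m.contract l).1.partner p = p := by
  induction l generalizing m with
  | nil => exact h
  | cons q l ih => exact ih _ (join_fixed m h)

/-- Joined points become dead (singletons). -/
theorem contract_dead (l : List (X × X)) (m : Matching X) {q : X × X} (hq : q ∈ l) :
    (m.contract l).1.partner q.1 = q.1 ∧ (m.contract l).1.partner q.2 = q.2 := by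
  induction l generalizing m with
  | nil => simp at hq
  | cons r l ih =>
    rcases List.mem_cons.1 hq with rfl | hq
    · exact ⟨contract_fixed l (m.join q) (by simp [join, joinFun]),
        contract_fixed l (m.join q) (by simp [join, joinFun])⟩
    · exact ih _ hq

theorem join_map [DecidableEq Y] {e : Y → X} (he : Function.Injective e) {m : Matching Y} {m' : Matching X}
    (h : ∀ p, m'.partner (e p) = e (m.partner p)) (q : Y × Y) (p : Y) :
    (m'.join (e q.1, e q.2)).partner (e p) = e ((m.join q).partner p) := by
  simp only [join, joinFun, h, he.eq_iff]
  split_ifs <;> rfl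

theorem contract_map [DecidableEq Y] {e : Y → X} (he : Function.Injective e) (l : List (Y × Y))
    {m : Matching Y} {m' : Matching X} (h : ∀ p, m'.partner (e p) = e (m.partner p)) :
    (∀ p, (m'.contract (l.map (Prod.map e e))).1.partner (e p) = e ((m.contract l).1.partner p)) ∧
      (m'.contract (l.map (Prod.map e e))).2 = (m.contract l).2 := by
  induction l generalizing m m' with
  | nil => exact ⟨h, rfl⟩
  | cons q l ih =>
    obtain ⟨h1, h2⟩ := ih (join_map he h q)
    refine ⟨h1, ?_⟩
    have h3 := congrArg Prod.fst h2
    have h4 := congrArg Prod.snd h2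
    simp only [List.map_cons, contract, joinLoops, joinStrings, Prod.map, h, he.eq_iff] at *
    rw [h3, h4]

/-- Contracting a strand `{a, x}` at `x` against `y` just renames `y` to `a`. -/
theorem join_straight {e : Y → X} {m : Matching Y} {m' : Matching X}
    (h : ∀ p, m'.partner (e p) = e (m.partner p)) {a x y : X} (hx : m'.partner x = a)
    (hax : a ≠ x) (hex : ∀ p, e p ≠ x) (hea : ∀ p, e p ≠ a) (p : Y) :
    (m'.join (x, y)).partner (Equiv.swap y a (e p)) = Equiv.swap y a (e (m.partner p)) := by
  have h1 := h p
  have h2 := hex p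
  have h3 := hea p
  have h4 := hex (m.partner p)
  have h5 := hea (m.partner p)
  have h6 := m'.invol x
  have h7 := m'.invol (e p)
  have h8 := m'.invol y
  simp only [join, joinFun, Equiv.swap_apply_def]
  grind

theorem join_swap (m : Matching X) (q : X × X) : m.join q.swap = m.join q := by
  obtain ⟨s, hs⟩ := m
  ext p
  have h1 := hs p
  have h2 := hs q.1
  have h3 := hs q.2
  simp only [join, joinFun, Prod.fst_swap, Prod.snd_swap]
  grind

theorem contract_swap (l : List (X × X)) (m : Matching X) :
    m.contract (l.map Prod.swap) = m.contract l := by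
  induction l generalizing m with
  | nil => rfl
  | cons q l ih =>
    have h1 : m.joinLoops q.swap = m.joinLoops q := by
      have h2 := m.invol q.1
      have h3 := m.invol q.2
      simp only [joinLoops, Prod.fst_swap, Prod.snd_swap]
      grind
    have h2 : m.joinStrings q.swap = m.joinStrings q := by
      simp [joinStrings, and_comm]
    simp only [List.map_cons, contract, join_swap, ih, h1, h2]

/-- Contracting a list of strands `{a i, x i}` at `x i` against `y i` renames `y i` to `a i`. -/
theorem contract_straight {ι : Type*} {a x y : ι → X} (ha : Function.Injective a)
    (hx : Function.Injective x) (hy : Function.Injective y) (hxy : ∀ i j, x i ≠ y j)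
    (hay : ∀ i j, a i ≠ y j) (hax : ∀ i j, a i ≠ x j) (l : List ι) (hl : l.Nodup)
    {m : Matching Y} {m' : Matching X} (e f : Y → X)
    (h : ∀ p, m'.partner (e p) = e (m.partner p)) (hm : ∀ i ∈ l, m'.partner (x i) = a i)
    (hex : ∀ p, ∀ i ∈ l, e p ≠ x i) (hea : ∀ p, ∀ i ∈ l, e p ≠ a i)
    (hef : ∀ p, (∃ i ∈ l, e p = y i ∧ f p = a i) ∨ ((∀ i ∈ l, e p ≠ y i) ∧ f p = e p)) :
    (∀ p, (m'.contract (l.map fun i => (x i, y i))).1.partner (f p) = f (m.partner p)) ∧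
      (m'.contract (l.map fun i => (x i, y i))).2 = (0, 0) := by
  induction l generalizing m' e with
  | nil =>
    have : f = e := by
      funext p
      simpa using hef p
    subst this
    exact ⟨h, rfl⟩
  | cons i l ih =>
    have hil : i ∉ l := (List.nodup_cons.1 hl).1
    have hij : ∀ j ∈ l, j ≠ i := fun j hj hji => hil (hji ▸ hj)
    have hmi := hm i (by simp)
    have key := ih (List.nodup_cons.1 hl).2 (m' := m'.join (x i, y i))
      (fun p => Equiv.swap (y i) (a i) (e p))
      (join_straight h hmi (hax i i) (fun p => hex p i (by simp)) (fun p => hea p i (by simp)))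
      (fun j hj => by
        have hmj := hm j (by simp [hj])
        rw [join_of_ne, hmj]
        · exact fun hc => hij j hj (hx hc)
        · exact hxy j i
        · rw [hmj]; exact hax j i
        · rw [hmj]; exact hay j i)
      (fun p j hj => by
        have h1 := hex p j (by simp [hj])
        have h2 := hax i j
        have h3 := hxy j i
        have h4 := hea p i (by simp)
        simp only [Equiv.swap_apply_def]
        split_ifs with h5 <;> assumption)
      (fun p j hj => by
        have h1 := hea p j (by simp [hj])
        have h2 : a i ≠ a j := fun hc => hij j hj (ha hc).symm
        have h4 := hea p i (by simp)
        simp only [Equiv.swap_apply_def]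
        split_ifs with h5 <;> assumption)
      (fun p => by
        have h4 := hea p i (by simp)
        simp only [Equiv.swap_apply_def, if_neg h4]
        rcases hef p with ⟨j, hj, h5, h6⟩ | ⟨h5, h6⟩
        · rcases List.mem_cons.1 hj with rfl | hj
          · right
            simp only [h5, if_true]
            exact ⟨fun k hk => hay j k, h6⟩
          · left
            refine ⟨j, hj, ?_, h6⟩
            rw [if_neg, h5]
            rw [h5]
            exact fun hc => hij j hj (hy hc)
        · right
          rw [if_neg (h5 i (by simp))]
          exact ⟨fun k hk => h5 k (by simp [hk]), h6⟩)
    refine ⟨key.1, ?_⟩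
    have h1 : m'.joinLoops (x i, y i) = 0 := by simp [joinLoops, hmi, hay i i]
    have h2 : m'.joinStrings (x i, y i) = 0 := by simp [joinStrings, hmi, hax i i]
    have h3 := congrArg Prod.fst key.2
    have h4 := congrArg Prod.snd key.2
    simp only [List.map_cons, contract, h1, h2, h3, h4]

end Join

end Matching

/-- Partial Brauer diagrams: partitions of `{1, …, n} ∪ {1', …, n'}` into pairs and singletons.
`Sum.inl` gives the left-hand vertices `1, …, n`, `Sum.inr` the right-hand ones `1', …, n'`. -/
abbrev Diagram (n : ℕ) := Matching (Fin n ⊕ Fin n)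

namespace Diagram

open Matching

variable {n : ℕ}

/-- The unstraightened juxtaposition, with `d` on the left and `d'` on the right. -/
def juxtapose (d d' : Diagram n) : Matching ((Fin n ⊕ Fin n) ⊕ (Fin n ⊕ Fin n)) where
  partner := Sum.map d.partner d'.partner
  invol := by
    rintro (p | p)
    · simp [d.invol p]
    · simp [d'.invol p]

/-- The pairs of points that are identified in the juxtaposition: the vertex `i'` of the left diagram
and the vertex `i` of the right one. -/
def equator (n : ℕ) :
    List (((Fin n ⊕ Fin n) ⊕ (Fin n ⊕ Fin n)) × ((Fin n ⊕ Fin n) ⊕ (Fin n ⊕ Fin n))) :=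
  (List.finRange n).map fun i => (Sum.inl (Sum.inr i), Sum.inr (Sum.inl i))

/-- Straightening: glue along the equator, erase it, and count loops and open strings. -/
def straighten (d d' : Diagram n) :
    Matching ((Fin n ⊕ Fin n) ⊕ (Fin n ⊕ Fin n)) × ℕ × ℕ :=
  (juxtapose d d').contract (equator n)

/-- The exterior vertices of a juxtaposition. -/
def exterior : Fin n ⊕ Fin n → (Fin n ⊕ Fin n) ⊕ (Fin n ⊕ Fin n) :=
  Sum.map Sum.inl Sum.inr

theorem exterior_injective : Function.Injective (exterior (n := n)) :=
  Function.Injective.sumMap Sum.inl_injective Sum.inr_injective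

theorem straighten_exterior (d d' : Diagram n) (p : Fin n ⊕ Fin n) :
    ∃ q, exterior q = (straighten d d').1.partner (exterior p) := by
  have key : ∀ i, (straighten d d').1.partner (exterior p) ≠ Sum.inl (Sum.inr i) ∧
      (straighten d d').1.partner (exterior p) ≠ Sum.inr (Sum.inl i) := by
    intro i
    have hd := Matching.contract_dead (equator n) (juxtapose d d')
      (q := (Sum.inl (Sum.inr i), Sum.inr (Sum.inl i))) (by simp [equator])
    have hi := (straighten d d').1.invol (exterior p)
    constructor
    · intro h
      rw [h] at hi
      have := hd.1.symm.trans hi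
      rcases p with p | p <;> simp [exterior] at this
    · intro h
      rw [h] at hi
      have := hd.2.symm.trans hi
      rcases p with p | p <;> simp [exterior] at this
  rcases h : (straighten d d').1.partner (exterior p) with (i | i) | (i | i)
  · exact ⟨Sum.inl i, rfl⟩
  · exact absurd h (key i).1
  · exact absurd h (key i).2
  · exact ⟨Sum.inr i, rfl⟩

/-- The inverse of `exterior`; the value `p` on the equator does not matter. -/
def toExterior (p : Fin n ⊕ Fin n) : (Fin n ⊕ Fin n) ⊕ (Fin n ⊕ Fin n) → Fin n ⊕ Fin n
  | Sum.inl (Sum.inl i) => Sum.inl i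
  | Sum.inr (Sum.inr i) => Sum.inr i
  | _ => p

theorem exterior_toExterior (d d' : Diagram n) (p : Fin n ⊕ Fin n) :
    exterior (toExterior p ((straighten d d').1.partner (exterior p))) =
      (straighten d d').1.partner (exterior p) := by
  obtain ⟨q, hq⟩ := straighten_exterior d d' p
  rw [← hq]
  rcases q with q | q <;> rfl

/-- The diagram `d ∘ d'`. -/
def comp (d d' : Diagram n) : Diagram n where
  partner p := toExterior p ((straighten d d').1.partner (exterior p))
  invol p := exterior_injective (by
    rw [exterior_toExterior, exterior_toExterior, (straighten d d').1.invol])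

theorem exterior_comp (d d' : Diagram n) (p : Fin n ⊕ Fin n) :
    exterior ((comp d d').partner p) = (straighten d d').1.partner (exterior p) :=
  exterior_toExterior d d' p

/-- The number of loops removed in the product of `d` and `d'`. -/
def loops (d d' : Diagram n) : ℕ := (straighten d d').2.1

/-- The number of open strings removed in the product of `d` and `d'`. -/
def strings (d d' : Diagram n) : ℕ := (straighten d d').2.2


/-- The juxtaposition of three diagrams. -/
def triple (d d' d'' : Diagram n) :
    Matching ((Fin n ⊕ Fin n) ⊕ ((Fin n ⊕ Fin n) ⊕ (Fin n ⊕ Fin n))) where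
  partner := Sum.map d.partner (juxtapose d' d'').partner
  invol := by
    rintro (p | p)
    · simp [d.invol p]
    · simp [(juxtapose d' d'').invol p]

theorem triple_left (d d' d'' : Diagram n) :
    (∀ p, ((triple d d' d'').contract
      ((equator n).map (Prod.map (Sum.map id Sum.inl) (Sum.map id Sum.inl)) ++
        (equator n).map (Prod.map Sum.inr Sum.inr))).1.partner
        (Sum.map Sum.inl (Sum.inr ∘ Sum.inr) p) =
      Sum.map Sum.inl (Sum.inr ∘ Sum.inr) ((comp (comp d d') d'').partner p)) ∧
    ((triple d d' d'').contract
      ((equator n).map (Prod.map (Sum.map id Sum.inl) (Sum.map id Sum.inl)) ++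
        (equator n).map (Prod.map Sum.inr Sum.inr))).2 =
      (loops d d' + loops (comp d d') d'', strings d d' + strings (comp d d') d'') := by
  have h1 := contract_map (e := Sum.map id Sum.inl)
    (Function.Injective.sumMap Function.injective_id Sum.inl_injective) (equator n)
    (m := juxtapose d d') (m' := triple d d' d'')
    (by rintro (p | p) <;> simp [triple, juxtapose])
  set t1 := (triple d d' d'').contract
    ((equator n).map (Prod.map (Sum.map id Sum.inl) (Sum.map id Sum.inl))) with ht1
  let e : (Fin n ⊕ Fin n) ⊕ (Fin n ⊕ Fin n) →
      (Fin n ⊕ Fin n) ⊕ ((Fin n ⊕ Fin n) ⊕ (Fin n ⊕ Fin n)) :=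
    Sum.elim (fun p => Sum.map id Sum.inl (exterior p)) (fun p => Sum.inr (Sum.inr p))
  have he : Function.Injective e := by
    rintro ((p | p) | p) ((q | q) | q) h <;> simp_all [e, exterior]
  have h2 : ∀ p, t1.1.partner (e p) = e ((juxtapose (comp d d') d'').partner p) := by
    rintro (p | p)
    · have := h1.1 (exterior p)
      simp only [e, Sum.elim_inl, juxtapose, Sum.map_inl]
      rw [exterior_comp]
      exact this
    · simp only [e, Sum.elim_inr, juxtapose, Sum.map_inr]
      rw [ht1, contract_of_ne]
      · simp [triple, juxtapose]
      · intro q hq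
        simp only [equator, List.map_map, List.mem_map, List.mem_finRange, true_and] at hq
        obtain ⟨i, rfl⟩ := hq
        simp [triple, juxtapose]
  have h3 := contract_map he (equator n) h2
  have h4 : (equator n).map (Prod.map e e) = (equator n).map (Prod.map Sum.inr Sum.inr) := by
    simp only [equator, List.map_map]
    rfl
  rw [h4] at h3
  rw [contract_append]
  refine ⟨fun p => ?_, ?_⟩
  · have h5 := h3.1 (exterior p)
    have h6 := exterior_comp (comp d d') d'' p
    rw [straighten] at h6
    rw [← h6] at h5
    have h7 : ∀ p, e (exterior p) = Sum.map Sum.inl (Sum.inr ∘ Sum.inr) p := by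
      rintro (p | p) <;> rfl
    rw [h7, h7] at h5
    exact h5
  · have h5 := h1.2
    have h6 := h3.2
    simp only [loops, strings, straighten, ← h5, ← h6]
    rfl

theorem triple_right (d d' d'' : Diagram n) :
    (∀ p, ((triple d d' d'').contract
      ((equator n).map (Prod.map Sum.inr Sum.inr) ++
        (equator n).map (Prod.map (Sum.map id Sum.inl) (Sum.map id Sum.inl)))).1.partner
        (Sum.map Sum.inl (Sum.inr ∘ Sum.inr) p) =
      Sum.map Sum.inl (Sum.inr ∘ Sum.inr) ((comp d (comp d' d'')).partner p)) ∧
    ((triple d d' d'').contract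
      ((equator n).map (Prod.map Sum.inr Sum.inr) ++
        (equator n).map (Prod.map (Sum.map id Sum.inl) (Sum.map id Sum.inl)))).2 =
      (loops d' d'' + loops d (comp d' d''), strings d' d'' + strings d (comp d' d'')) := by
  have h1 := contract_map (e := Sum.inr) Sum.inr_injective (equator n)
    (m := juxtapose d' d'') (m' := triple d d' d'') (fun p => by simp [triple])
  set t1 := (triple d d' d'').contract ((equator n).map (Prod.map Sum.inr Sum.inr)) with ht1
  let e : (Fin n ⊕ Fin n) ⊕ (Fin n ⊕ Fin n) →
      (Fin n ⊕ Fin n) ⊕ ((Fin n ⊕ Fin n) ⊕ (Fin n ⊕ Fin n)) :=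
    Sum.elim Sum.inl (fun p => Sum.inr (exterior p))
  have he : Function.Injective e := by
    rintro (p | (p | p)) (q | (q | q)) h <;> simp_all [e, exterior]
  have h2 : ∀ p, t1.1.partner (e p) = e ((juxtapose d (comp d' d'')).partner p) := by
    rintro (p | p)
    · simp only [e, Sum.elim_inl, juxtapose, Sum.map_inl]
      rw [ht1, contract_of_ne]
      · simp [triple]
      · intro q hq
        simp only [equator, List.map_map, List.mem_map, List.mem_finRange, true_and] at hq
        obtain ⟨i, rfl⟩ := hq
        simp [triple]
    · have := h1.1 (exterior p)
      simp only [e, Sum.elim_inr, juxtapose, Sum.map_inr]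
      rw [exterior_comp]
      exact this
  have h3 := contract_map he (equator n) h2
  have h4 : (equator n).map (Prod.map e e) =
      (equator n).map (Prod.map (Sum.map id Sum.inl) (Sum.map id Sum.inl)) := by
    simp only [equator, List.map_map]
    rfl
  rw [h4] at h3
  rw [contract_append]
  refine ⟨fun p => ?_, ?_⟩
  · have h5 := h3.1 (exterior p)
    have h6 := exterior_comp d (comp d' d'') p
    rw [straighten] at h6
    rw [← h6] at h5
    have h7 : ∀ p, e (exterior p) = Sum.map Sum.inl (Sum.inr ∘ Sum.inr) p := by
      rintro (p | p) <;> rfl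
    rw [h7, h7] at h5
    exact h5
  · have h5 := h1.2
    have h6 := h3.2
    simp only [loops, strings, straighten, ← h5, ← h6]
    rfl

theorem triple_contract (d d' d'' : Diagram n) :
    (triple d d' d'').contract
      ((equator n).map (Prod.map (Sum.map id Sum.inl) (Sum.map id Sum.inl)) ++
        (equator n).map (Prod.map Sum.inr Sum.inr)) =
    (triple d d' d'').contract
      ((equator n).map (Prod.map Sum.inr Sum.inr) ++
        (equator n).map (Prod.map (Sum.map id Sum.inl) (Sum.map id Sum.inl))) := by
  apply contract_perm List.perm_append_comm
  constructor
  · intro q hq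
    simp only [equator, List.map_map, List.mem_append, List.mem_map, List.mem_finRange,
      true_and] at hq
    rcases hq with ⟨i, rfl⟩ | ⟨i, rfl⟩ <;> simp
  · intro p hp q hq
    simp only [equator, List.map_map, List.mem_append, List.mem_map, List.mem_finRange,
      true_and] at hp hq
    rcases hp with ⟨i, rfl⟩ | ⟨i, rfl⟩ <;> rcases hq with ⟨j, rfl⟩ | ⟨j, rfl⟩ <;> simp

theorem comp_assoc (d d' d'' : Diagram n) : comp (comp d d') d'' = comp d (comp d' d'') := by
  ext1
  funext p
  have h1 := (triple_left d d' d'').1 p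
  rw [triple_contract, (triple_right d d' d'').1 p] at h1
  exact (Function.Injective.sumMap Sum.inl_injective
    (Sum.inr_injective.comp Sum.inr_injective) h1).symm

theorem loops_assoc (d d' d'' : Diagram n) :
    loops d d' + loops (comp d d') d'' = loops d' d'' + loops d (comp d' d'') := by
  have h1 := (triple_left d d' d'').2
  rw [triple_contract, (triple_right d d' d'').2] at h1
  exact (congrArg Prod.fst h1).symm

theorem strings_assoc (d d' d'' : Diagram n) :
    strings d d' + strings (comp d d') d'' = strings d' d'' + strings d (comp d' d'') := by
  have h1 := (triple_left d d' d'').2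
  rw [triple_contract, (triple_right d d' d'').2] at h1
  exact (congrArg Prod.snd h1).symm

/-- The identity diagram, with parts `{i, i'}`. -/
def idDiagram (n : ℕ) : Diagram n where
  partner := Sum.swap
  invol := Sum.swap_swap

theorem straighten_id_left (d : Diagram n) :
    (∀ p, (straighten (idDiagram n) d).1.partner (exterior p) = exterior (d.partner p)) ∧
      (straighten (idDiagram n) d).2 = (0, 0) := by
  refine contract_straight (a := fun i : Fin n => Sum.inl (Sum.inl i))
    (x := fun i => Sum.inl (Sum.inr i)) (y := fun i => Sum.inr (Sum.inl i))
    ?_ ?_ ?_ ?_ ?_ ?_ _ ?_ Sum.inr exterior ?_ ?_ ?_ ?_ ?_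
  · exact Sum.inl_injective.comp Sum.inl_injective
  · exact Sum.inl_injective.comp Sum.inr_injective
  · exact Sum.inr_injective.comp Sum.inl_injective
  · simp
  · simp
  · simp
  · exact List.nodup_finRange n
  · simp [juxtapose]
  · simp [juxtapose, idDiagram]
  · simp
  · simp
  · rintro (p | p) <;> simp [exterior]

theorem straighten_id_right (d : Diagram n) :
    (∀ p, (straighten d (idDiagram n)).1.partner (exterior p) = exterior (d.partner p)) ∧
      (straighten d (idDiagram n)).2 = (0, 0) := by
  rw [straighten, ← contract_swap]
  simp only [equator, List.map_map]
  refine contract_straight (a := fun i : Fin n => Sum.inr (Sum.inr i))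
    (x := fun i => Sum.inr (Sum.inl i)) (y := fun i => Sum.inl (Sum.inr i))
    ?_ ?_ ?_ ?_ ?_ ?_ _ ?_ Sum.inl exterior ?_ ?_ ?_ ?_ ?_
  · exact Sum.inr_injective.comp Sum.inr_injective
  · exact Sum.inr_injective.comp Sum.inl_injective
  · exact Sum.inl_injective.comp Sum.inr_injective
  · simp
  · simp
  · simp
  · exact List.nodup_finRange n
  · simp [juxtapose]
  · simp [juxtapose, idDiagram]
  · simp
  · simp
  · rintro (p | p) <;> simp [exterior]

theorem id_comp (d : Diagram n) : comp (idDiagram n) d = d := by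
  ext1
  funext p
  apply exterior_injective
  rw [exterior_comp, (straighten_id_left d).1]

theorem comp_id (d : Diagram n) : comp d (idDiagram n) = d := by
  ext1
  funext p
  apply exterior_injective
  rw [exterior_comp, (straighten_id_right d).1]

/-- `d ⊗ 1`: the diagram `d` with the additional part `{n, n'}`. -/
def addStrand (d : Diagram n) : Diagram (n + 1) where
  partner := Sum.elim
    (Fin.lastCases (Sum.inr (Fin.last n))
      fun i => Sum.map Fin.castSucc Fin.castSucc (d.partner (Sum.inl i)))
    (Fin.lastCases (Sum.inl (Fin.last n))
      fun i => Sum.map Fin.castSucc Fin.castSucc (d.partner (Sum.inr i)))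
  invol := by
    rintro (p | p) <;> induction p using Fin.lastCases with
    | last => simp
    | cast i =>
      simp only [Sum.elim_inl, Sum.elim_inr, Fin.lastCases_castSucc]
      have key := d.invol
      first
      | specialize key (Sum.inl i)
        rcases h : d.partner (Sum.inl i) with j | j <;> rw [h] at key <;> simp [key]
      | specialize key (Sum.inr i)
        rcases h : d.partner (Sum.inr i) with j | j <;> rw [h] at key <;> simp [key]

theorem addStrand_castSucc (d : Diagram n) (p : Fin n ⊕ Fin n) :
    (addStrand d).partner (Sum.map Fin.castSucc Fin.castSucc p) =
      Sum.map Fin.castSucc Fin.castSucc (d.partner p) := by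
  rcases p with p | p <;> simp [addStrand]

theorem addStrand_inl_last (d : Diagram n) :
    (addStrand d).partner (Sum.inl (Fin.last n)) = Sum.inr (Fin.last n) := by
  simp [addStrand]

theorem addStrand_inr_last (d : Diagram n) :
    (addStrand d).partner (Sum.inr (Fin.last n)) = Sum.inl (Fin.last n) := by
  simp [addStrand]

theorem addStrand_straighten (d d' : Diagram n) :
    comp (addStrand d) (addStrand d') = addStrand (comp d d') ∧
      (straighten (addStrand d) (addStrand d')).2 = (straighten d d').2 := by
  let c : Fin n ⊕ Fin n → Fin (n + 1) ⊕ Fin (n + 1) := Sum.map Fin.castSucc Fin.castSucc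
  have hc : Function.Injective c :=
    Function.Injective.sumMap (Fin.castSucc_injective n) (Fin.castSucc_injective n)
  have he : Function.Injective (Sum.map c c) := Function.Injective.sumMap hc hc
  obtain ⟨h1, h2⟩ := contract_map he (equator n) (m := juxtapose d d')
    (m' := juxtapose (addStrand d) (addStrand d'))
    (by rintro (p | p) <;> simp [juxtapose, c, addStrand_castSucc])
  have hl : equator (n + 1) = (equator n).map (Prod.map (Sum.map c c) (Sum.map c c)) ++
      [(Sum.inl (Sum.inr (Fin.last n)), Sum.inr (Sum.inl (Fin.last n)))] := by
    simp [equator, List.finRange_succ_last, c, Function.comp_def]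
  have hlast : ∀ p, p = Sum.inl (Sum.inl (Fin.last n)) ∨ p = Sum.inl (Sum.inr (Fin.last n)) ∨
      p = Sum.inr (Sum.inl (Fin.last n)) ∨ p = Sum.inr (Sum.inr (Fin.last n)) →
      ((juxtapose (addStrand d) (addStrand d')).contract
        ((equator n).map (Prod.map (Sum.map c c) (Sum.map c c)))).1.partner p =
        Sum.map Sum.swap Sum.swap p := by
    intro p hp
    rw [contract_of_ne]
    · rcases hp with rfl | rfl | rfl | rfl <;>
        simp [juxtapose, addStrand_inl_last, addStrand_inr_last]
    · intro q hq
      simp only [equator, List.map_map, List.mem_map, List.mem_finRange, true_and] at hq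
      obtain ⟨i, rfl⟩ := hq
      have h3 := (Fin.castSucc_lt_last i).ne'
      rcases hp with rfl | rfl | rfl | rfl <;>
        simp [juxtapose, addStrand_inl_last, addStrand_inr_last, c, h3]
  rw [straighten, hl, contract_append]
  set t := (juxtapose (addStrand d) (addStrand d')).contract
        ((equator n).map (Prod.map (Sum.map c c) (Sum.map c c))) with ht
  have hst : (straighten (addStrand d) (addStrand d')).1 =
      t.1.join (Sum.inl (Sum.inr (Fin.last n)), Sum.inr (Sum.inl (Fin.last n))) := by
    rw [straighten, hl, contract_append]
    rfl
  have e1 := hlast (Sum.inl (Sum.inl (Fin.last n))) (by simp)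
  have e2 := hlast (Sum.inl (Sum.inr (Fin.last n))) (by simp)
  have e3 := hlast (Sum.inr (Sum.inl (Fin.last n))) (by simp)
  have e4 := hlast (Sum.inr (Sum.inr (Fin.last n))) (by simp)
  simp only [Sum.map_inl, Sum.map_inr, Sum.swap_inl, Sum.swap_inr] at e1 e2 e3 e4
  constructor
  · ext1
    have hcast : ∀ p, (comp (addStrand d) (addStrand d')).partner (c p) =
        (addStrand (comp d d')).partner (c p) := by
      intro p
      apply exterior_injective
      have hx : ∀ q, exterior (c q) = Sum.map c c (exterior q) := by
        rintro (q | q) <;> simp [exterior, c]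
      rw [exterior_comp, hst, addStrand_castSucc, hx]
      change _ = exterior (c _)
      have h4 := h1 (exterior p)
      have h5 := exterior_comp d d' p
      rw [straighten] at h5
      rw [← h5, ← hx, ← hx] at h4
      rw [← hx, join_of_ne, h4] <;> (try rw [h4])
      · rcases p with p | p <;> simp [exterior, c]
      · rcases p with p | p <;> simp [exterior, c]
      · rcases (comp d d').partner p with p | p <;> simp [exterior, c]
      · rcases (comp d d').partner p with p | p <;> simp [exterior, c]
    funext p
    rcases p with p | p <;> induction p using Fin.lastCases with
    | last =>
      apply exterior_injective
      rw [exterior_comp, hst]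
      simp [exterior, addStrand_inl_last, addStrand_inr_last, join, joinFun, e1, e2, e3, e4]
    | cast i =>
      first
      | exact hcast (Sum.inl i)
      | exact hcast (Sum.inr i)
  · rw [straighten, ← h2]
    simp [contract, joinLoops, joinStrings, e2, e3]

/-- Rename the right-hand vertices of a diagram along a permutation. -/
def relabel (w : Equiv.Perm (Fin n)) (d : Diagram n) : Diagram n where
  partner p := Sum.map id w (d.partner (Sum.map id w.symm p))
  invol p := by
    have h : ∀ q : Fin n ⊕ Fin n, Sum.map id w.symm (Sum.map id w q) = q := by
      rintro (q | q) <;> simp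
    have h' : ∀ q : Fin n ⊕ Fin n, Sum.map id w (Sum.map id w.symm q) = q := by
      rintro (q | q) <;> simp
    simp only [h, d.invol _, h']

theorem relabel_apply (w : Equiv.Perm (Fin n)) (d : Diagram n) (p : Fin n ⊕ Fin n) :
    (relabel w d).partner (Sum.map id w p) = Sum.map id w (d.partner p) := by
  rcases p with p | p <;> simp [relabel]

theorem relabel_one (d : Diagram n) : relabel 1 d = d := by
  ext1
  funext p
  have h := relabel_apply 1 d p
  simpa using h

theorem relabel_mul (w w' : Equiv.Perm (Fin n)) (d : Diagram n) :
    relabel (w * w') d = relabel w (relabel w' d) := by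
  ext1
  funext p
  rcases p with p | p
  · simp [relabel, Sum.map_map]
  · simp [relabel, Sum.map_map]
    rfl

theorem comp_relabel (w : Equiv.Perm (Fin n)) (d d' : Diagram n) :
    comp d (relabel w d') = relabel w (comp d d') ∧
      (straighten d (relabel w d')).2 = (straighten d d').2 := by
  have he : Function.Injective (Sum.map id (Sum.map id w) :
      (Fin n ⊕ Fin n) ⊕ (Fin n ⊕ Fin n) → (Fin n ⊕ Fin n) ⊕ (Fin n ⊕ Fin n)) :=
    Function.Injective.sumMap Function.injective_id
      (Function.Injective.sumMap Function.injective_id w.injective)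
  have h := contract_map he (equator n) (m := juxtapose d d') (m' := juxtapose d (relabel w d'))
    (by rintro (p | p) <;> simp [juxtapose, relabel_apply])
  have hl : (equator n).map (Prod.map (Sum.map id (Sum.map id w)) (Sum.map id (Sum.map id w))) =
      equator n := by
    simp [equator, Function.comp_def]
  rw [hl] at h
  refine ⟨?_, h.2⟩
  ext1
  funext p
  obtain ⟨q, rfl⟩ : ∃ q, Sum.map id w q = p :=
    ⟨Sum.map id w.symm p, by rcases p with p | p <;> simp⟩
  apply exterior_injective
  have hx : ∀ q : Fin n ⊕ Fin n, exterior (Sum.map id w q) =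
      Sum.map id (Sum.map id w) (exterior q) := by
    rintro (q | q) <;> simp [exterior]
  rw [exterior_comp, relabel_apply, hx, hx, exterior_comp]
  exact h.1 (exterior q)

end Diagram

namespace Diagram

open Matching

variable {n : ℕ}

/-- The left cell relation: `d` and `d'` have the same parts contained in the right-hand side. -/
def LeftRel (d d' : Diagram n) : Prop :=
  ∀ r s : Fin n, d.partner (Sum.inr r) = Sum.inr s ↔ d'.partner (Sum.inr r) = Sum.inr s

/-- The right-hand ends of the propagating lines. -/
def propEnds (d : Diagram n) : Finset (Fin n) :=
  Finset.univ.filter fun r => (d.partner (Sum.inr r)).isLeft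

/-- The propagating number. -/
def propNumber (d : Diagram n) : ℕ := d.propEnds.card

theorem mem_propEnds {d : Diagram n} {r : Fin n} :
    r ∈ d.propEnds ↔ ∀ s, d.partner (Sum.inr r) ≠ Sum.inr s := by
  rcases h : d.partner (Sum.inr r) with i | i <;> simp [propEnds, h]

theorem LeftRel.propEnds_eq {d d' : Diagram n} (h : LeftRel d d') : d.propEnds = d'.propEnds := by
  ext r
  rw [mem_propEnds, mem_propEnds]
  exact forall_congr' fun s => not_congr (h r s)

theorem comp_inr {d d' : Diagram n} {r s : Fin n} (h : d'.partner (Sum.inr r) = Sum.inr s) :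
    (comp d d').partner (Sum.inr r) = Sum.inr s := by
  apply exterior_injective
  rw [exterior_comp, straighten, contract_of_ne]
  · simp [exterior, juxtapose, h]
  · intro q hq
    simp only [equator, List.mem_map, List.mem_finRange, true_and] at hq
    obtain ⟨i, rfl⟩ := hq
    simp [exterior, juxtapose, h]

/-- Membership in the left cell of `c`, provided that this cell has propagating number `k`; no
diagram satisfies this if the propagating number of `c` is not `k`. -/
def InCell (c : Diagram n) (k : ℕ) (d : Diagram n) : Prop :=
  LeftRel d c ∧ d.propNumber = k

theorem InCell.of_comp {c : Diagram n} {k : ℕ} {d d' x : Diagram n} (hx : InCell c k x)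
    (h : InCell c k (comp d (comp d' x))) : InCell c k (comp d' x) := by
  have h1 : LeftRel (comp d' x) c := by
    intro r s
    refine ⟨fun hr => (h.1 r s).1 (comp_inr hr), fun hr => comp_inr ((hx.1 r s).2 hr)⟩
  exact ⟨h1, by rw [← hx.2, propNumber, propNumber, h1.propEnds_eq, hx.1.propEnds_eq]⟩

/-- `S_k` as the group of permutations of the `k` right-hand ends of propagating lines of `c`,
numbered in increasing order. -/
def endPerm (c : Diagram n) (k : ℕ) : Equiv.Perm (Fin k) →* Equiv.Perm (Fin n) :=
  if h : c.propEnds.card = k then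
    Equiv.Perm.extendDomainHom (c.propEnds.orderIsoOfFin h).toEquiv
  else 1

theorem endPerm_of_notMem (c : Diagram n) (k : ℕ) (w : Equiv.Perm (Fin k)) {r : Fin n}
    (hr : r ∉ c.propEnds) : endPerm c k w r = r := by
  unfold endPerm
  split_ifs with h
  · exact Equiv.Perm.extendDomain_apply_not_subtype _ _ hr
  · rfl

theorem InCell.relabel {c : Diagram n} {k : ℕ} {d : Diagram n} (hd : InCell c k d)
    (w : Equiv.Perm (Fin k)) : InCell c k (relabel (endPerm c k w) d) := by
  have key : ∀ (v : Equiv.Perm (Fin k)) (x : Diagram n), LeftRel x c → ∀ r s,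
      c.partner (Sum.inr r) = Sum.inr s →
        (Diagram.relabel (endPerm c k v) x).partner (Sum.inr r) = Sum.inr s := by
    intro v x hx r s hr
    have hr1 : r ∉ c.propEnds := by
      rw [mem_propEnds]
      exact fun h => h s hr
    have hs1 : s ∉ c.propEnds := by
      rw [mem_propEnds]
      have := c.invol (Sum.inr r)
      rw [hr] at this
      exact fun h => h r this
    have h1 := relabel_apply (endPerm c k v) x (Sum.inr r)
    rw [(hx r s).2 hr] at h1
    simpa [endPerm_of_notMem c k v hr1, endPerm_of_notMem c k v hs1] using h1
  have h1 : LeftRel (Diagram.relabel (endPerm c k w) d) c := by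
    intro r s
    refine ⟨fun hr => ?_, key w d hd.1 r s⟩
    by_contra hc
    have hrs : r ∈ c.propEnds := by
      rw [mem_propEnds]
      intro s' hs'
      have := key w d hd.1 r s' hs'
      rw [hr] at this
      exact hc (this ▸ hs')
    have h2 : (endPerm c k w).symm r ∈ c.propEnds := by
      by_contra h3
      have h4 := endPerm_of_notMem c k w h3
      rw [Equiv.apply_symm_apply] at h4
      exact h3 (h4 ▸ hrs)
    rw [← hd.1.propEnds_eq, mem_propEnds] at h2
    have h3 := relabel_apply (endPerm c k w) d (Sum.inr ((endPerm c k w).symm r))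
    simp only [Sum.map_inr, Equiv.apply_symm_apply, hr] at h3
    rcases h4 : d.partner (Sum.inr ((endPerm c k w).symm r)) with i | i
    · rw [h4] at h3
      simp at h3
    · exact h2 i h4
  refine ⟨h1, Eq.trans ?_ hd.2⟩
  rw [propNumber, propNumber, h1.propEnds_eq, hd.1.propEnds_eq]

end Diagram

noncomputable section

open scoped TensorProduct DirectSum

section Algebra

variable {𝕜 : Type*} [CommRing 𝕜]

/-- The partial Brauer algebra: the free `𝕜`-module on the partial Brauer diagrams. -/
def PartialBrauer (_δ _δ' : 𝕜) (n : ℕ) : Type _ := Diagram n →₀ 𝕜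

namespace PartialBrauer

variable (δ δ' : 𝕜) (n : ℕ)

instance : AddCommGroup (PartialBrauer δ δ' n) := inferInstanceAs (AddCommGroup (Diagram n →₀ 𝕜))

instance : Module 𝕜 (PartialBrauer δ δ' n) := inferInstanceAs (Module 𝕜 (Diagram n →₀ 𝕜))

variable {n}

/-- The scalar `δ ^ (number of loops) * δ' ^ (number of open strings)`. -/
def coef (d d' : Diagram n) : 𝕜 := δ ^ Diagram.loops d d' * δ' ^ Diagram.strings d d'

/-- The basis element of a diagram. -/
def of (d : Diagram n) : PartialBrauer δ δ' n := Finsupp.single d 1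

theorem hom_ext {M : Type*} [AddCommGroup M] [Module 𝕜 M] {f g : PartialBrauer δ δ' n →ₗ[𝕜] M}
    (h : ∀ d, f (of δ δ' d) = g (of δ δ' d)) : f = g :=
  Finsupp.lhom_ext' fun d => LinearMap.ext_ring (h d)

/-- The linear extension of a map defined on diagrams. -/
def lift {M : Type*} [AddCommGroup M] [Module 𝕜 M] (f : Diagram n → M) :
    PartialBrauer δ δ' n →ₗ[𝕜] M :=
  Finsupp.linearCombination 𝕜 f

@[simp]
theorem lift_of {M : Type*} [AddCommGroup M] [Module 𝕜 M] (f : Diagram n → M) (d : Diagram n) :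
    lift δ δ' f (of δ δ' d) = f d :=
  (Finsupp.linearCombination_single 𝕜 1 d).trans (one_smul 𝕜 _)

/-- The bilinear multiplication with `d * d' = δ ^ loops * δ' ^ strings • (d ∘ d')`. -/
def mulHom : PartialBrauer δ δ' n →ₗ[𝕜] PartialBrauer δ δ' n →ₗ[𝕜] PartialBrauer δ δ' n :=
  lift δ δ' fun d => lift δ δ' fun d' => coef δ δ' d d' • of δ δ' (Diagram.comp d d')

instance : Mul (PartialBrauer δ δ' n) := ⟨fun x y => mulHom δ δ' x y⟩

instance : One (PartialBrauer δ δ' n) := ⟨of δ δ' (Diagram.idDiagram n)⟩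

theorem mul_def (x y : PartialBrauer δ δ' n) : x * y = mulHom δ δ' x y := rfl

theorem one_def : (1 : PartialBrauer δ δ' n) = of δ δ' (Diagram.idDiagram n) := rfl

theorem of_mul_of (d d' : Diagram n) :
    of δ δ' d * of δ δ' d' = coef δ δ' d d' • of δ δ' (Diagram.comp d d') := by
  simp [mul_def, mulHom]

theorem coef_assoc (d d' d'' : Diagram n) :
    coef δ δ' d d' * coef δ δ' (Diagram.comp d d') d'' =
      coef δ δ' d' d'' * coef δ δ' d (Diagram.comp d' d'') := by
  have h1 := Diagram.loops_assoc d d' d''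
  have h2 := Diagram.strings_assoc d d' d''
  simp only [coef]
  rw [mul_mul_mul_comm, ← pow_add, ← pow_add, h1, h2, pow_add, pow_add, mul_mul_mul_comm]

theorem coef_id_left (d : Diagram n) : coef δ δ' (Diagram.idDiagram n) d = 1 := by
  simp [coef, Diagram.loops, Diagram.strings, (Diagram.straighten_id_left d).2]

theorem coef_id_right (d : Diagram n) : coef δ δ' d (Diagram.idDiagram n) = 1 := by
  simp [coef, Diagram.loops, Diagram.strings, (Diagram.straighten_id_right d).2]

protected theorem induction {P : PartialBrauer δ δ' n → Prop} (x : PartialBrauer δ δ' n)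
    (h0 : P 0) (hadd : ∀ x y, P x → P y → P (x + y)) (hof : ∀ (a : 𝕜) d, P (a • of δ δ' d)) :
    P x := by
  refine Finsupp.induction_linear (motive := P) x h0 hadd fun d a => ?_
  have h : a • of δ δ' d = (Finsupp.single d a : Diagram n →₀ 𝕜) :=
    (Finsupp.smul_single a d 1).trans (by rw [smul_eq_mul, mul_one])
  exact h ▸ hof a d

protected theorem mul_assoc (x y z : PartialBrauer δ δ' n) : x * y * z = x * (y * z) := by
  have h : ∀ d d' d'' : Diagram n,
      of δ δ' d * of δ δ' d' * of δ δ' d'' = of δ δ' d * (of δ δ' d' * of δ δ' d'') := by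
    intro d d' d''
    simp only [of_mul_of]
    simp only [mul_def, map_smul, LinearMap.smul_apply]
    simp only [← mul_def, of_mul_of, smul_smul, coef_assoc, Diagram.comp_assoc]
  simp only [mul_def] at h ⊢
  induction x using PartialBrauer.induction with
  | h0 => simp only [map_zero, LinearMap.zero_apply]
  | hadd x x' hx hx' => simp only [map_add, LinearMap.add_apply, hx, hx']
  | hof a d =>
    induction y using PartialBrauer.induction with
    | h0 => simp only [map_zero, LinearMap.zero_apply]
    | hadd x x' hx hx' => simp only [map_add, LinearMap.add_apply, hx, hx']
    | hof b d' =>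
      induction z using PartialBrauer.induction with
      | h0 => simp only [map_zero]
      | hadd x x' hx hx' => simp only [map_add, hx, hx']
      | hof c d'' => simp only [map_smul, LinearMap.smul_apply, h]

protected theorem one_mul (x : PartialBrauer δ δ' n) : 1 * x = x := by
  have h : mulHom δ δ' (of δ δ' (Diagram.idDiagram n)) = LinearMap.id :=
    hom_ext δ δ' fun d => by
      rw [← mul_def, of_mul_of, coef_id_left, one_smul, Diagram.id_comp, LinearMap.id_apply]
  rw [mul_def, one_def, h, LinearMap.id_apply]

protected theorem mul_one (x : PartialBrauer δ δ' n) : x * 1 = x := by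
  have h : (mulHom δ δ').flip (of δ δ' (Diagram.idDiagram n)) = LinearMap.id :=
    hom_ext δ δ' fun d => by
      rw [LinearMap.flip_apply, ← mul_def, of_mul_of, coef_id_right, one_smul, Diagram.comp_id,
        LinearMap.id_apply]
  rw [mul_def, one_def, ← LinearMap.flip_apply, h, LinearMap.id_apply]

instance : Ring (PartialBrauer δ δ' n) :=
  { (inferInstance : AddCommGroup (PartialBrauer δ δ' n)),
    (inferInstance : Mul (PartialBrauer δ δ' n)),
    (inferInstance : One (PartialBrauer δ δ' n)) with
    mul_assoc := PartialBrauer.mul_assoc δ δ'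
    one_mul := PartialBrauer.one_mul δ δ'
    mul_one := PartialBrauer.mul_one δ δ'
    left_distrib := fun x y z => map_add (mulHom δ δ' x) y z
    right_distrib := fun x y z => by
      simp only [mul_def, map_add, LinearMap.add_apply]
    zero_mul := fun x => by
      simp only [mul_def, map_zero, LinearMap.zero_apply]
    mul_zero := fun x => map_zero (mulHom δ δ' x) }

instance : Algebra 𝕜 (PartialBrauer δ δ' n) :=
  Algebra.ofModule
    (fun r x y => by simp only [mul_def, map_smul, LinearMap.smul_apply])
    (fun r x y => by simp only [mul_def, map_smul])

/-- The algebra homomorphism `R_n → R_{n+1}` with `d ↦ d ⊗ 1`. -/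
def strandHom : PartialBrauer δ δ' n →ₐ[𝕜] PartialBrauer δ δ' (n + 1) :=
  AlgHom.ofLinearMap (lift δ δ' fun d => of δ δ' (Diagram.addStrand d))
    (by
      have h : Diagram.addStrand (Diagram.idDiagram n) = Diagram.idDiagram (n + 1) := by
        ext1
        funext p
        rcases p with p | p <;> induction p using Fin.lastCases <;>
          simp [Diagram.addStrand, Diagram.idDiagram]
      rw [one_def, lift_of, h, one_def])
    (fun x y => by
      induction x using PartialBrauer.induction with
      | h0 => simp only [zero_mul, map_zero]
      | hadd x x' hx hx' => simp only [map_add, add_mul, hx, hx']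
      | hof a d =>
        induction y using PartialBrauer.induction with
        | h0 => simp only [mul_zero, map_zero]
        | hadd x x' hx hx' => simp only [map_add, mul_add, hx, hx']
        | hof b d' =>
          have hc : coef δ δ' (Diagram.addStrand d) (Diagram.addStrand d') = coef δ δ' d d' := by
            simp only [coef, Diagram.loops, Diagram.strings,
              (Diagram.addStrand_straighten d d').2]
          simp only [smul_mul_assoc, mul_smul_comm, map_smul, lift_of, of_mul_of,
            (Diagram.addStrand_straighten d d').1, hc])

end PartialBrauer

/-- The cell module: the free `𝕜`-module on the left cell of `c`, if this cell has propagating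
number `k`; it is zero otherwise (in particular for `k > n`). -/
def CellModule (_δ _δ' : 𝕜) {n : ℕ} (c : Diagram n) (k : ℕ) : Type _ :=
  {d : Diagram n // c.InCell k d} →₀ 𝕜

namespace CellModule

open PartialBrauer

variable (δ δ' : 𝕜) {n : ℕ} (c : Diagram n) (k : ℕ)

instance : AddCommGroup (CellModule δ δ' c k) :=
  inferInstanceAs (AddCommGroup ({d : Diagram n // c.InCell k d} →₀ 𝕜))

instance : Module 𝕜 (CellModule δ δ' c k) :=
  inferInstanceAs (Module 𝕜 ({d : Diagram n // c.InCell k d} →₀ 𝕜))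

variable {c k}

/-- The basis element of a diagram in the cell. -/
def of (d : {d : Diagram n // c.InCell k d}) : CellModule δ δ' c k := Finsupp.single d 1

variable (c k)

open Classical in
/-- The basis element of `d` if `d` lies in the cell, and `0` otherwise. -/
def proj (d : Diagram n) : CellModule δ δ' c k :=
  if h : c.InCell k d then of δ δ' ⟨d, h⟩ else 0

variable {c k}

theorem proj_coe (d : {d : Diagram n // c.InCell k d}) : proj δ δ' c k d = of δ δ' d :=
  dif_pos d.2

theorem hom_ext {M : Type*} [AddCommGroup M] [Module 𝕜 M] {f g : CellModule δ δ' c k →ₗ[𝕜] M}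
    (h : ∀ d, f (of δ δ' d) = g (of δ δ' d)) : f = g :=
  Finsupp.lhom_ext' fun d => LinearMap.ext_ring (h d)

/-- The linear extension of a map defined on the diagrams in the cell. -/
def lift {M : Type*} [AddCommGroup M] [Module 𝕜 M] (f : {d : Diagram n // c.InCell k d} → M) :
    CellModule δ δ' c k →ₗ[𝕜] M :=
  Finsupp.linearCombination 𝕜 f

@[simp]
theorem lift_of {M : Type*} [AddCommGroup M] [Module 𝕜 M]
    (f : {d : Diagram n // c.InCell k d} → M) (d : {d : Diagram n // c.InCell k d}) :
    lift δ δ' f (of δ δ' d) = f d :=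
  (Finsupp.linearCombination_single 𝕜 1 d).trans (one_smul 𝕜 _)

/-- The action of diagrams on the cell module: `d • x` is the product `d x` if its diagram lies in
the cell, and `0` otherwise. -/
def actHom : PartialBrauer δ δ' n →ₗ[𝕜] CellModule δ δ' c k →ₗ[𝕜] CellModule δ δ' c k :=
  PartialBrauer.lift δ δ' fun d => lift δ δ' fun x =>
    coef δ δ' d x • proj δ δ' c k (Diagram.comp d x)

theorem actHom_of (d : Diagram n) (x : {d : Diagram n // c.InCell k d}) :
    actHom δ δ' (PartialBrauer.of δ δ' d) (of δ δ' x) =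
      coef δ δ' d x • proj δ δ' c k (Diagram.comp d x) := by
  rw [actHom, PartialBrauer.lift_of, lift_of]

theorem actHom_one : actHom δ δ' (c := c) (k := k) 1 = LinearMap.id :=
  hom_ext δ δ' fun x => by
    rw [one_def, actHom_of, coef_id_left, one_smul, Diagram.id_comp, proj_coe, LinearMap.id_apply]

theorem actHom_mul (a b : PartialBrauer δ δ' n) :
    actHom δ δ' (c := c) (k := k) (a * b) = actHom δ δ' a ∘ₗ actHom δ δ' b := by
  induction a using PartialBrauer.induction with
  | h0 => simp only [zero_mul, map_zero, LinearMap.zero_comp]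
  | hadd x x' hx hx' => simp only [map_add, add_mul, hx, hx', LinearMap.add_comp]
  | hof r d =>
    induction b using PartialBrauer.induction with
    | h0 => simp only [mul_zero, map_zero, LinearMap.comp_zero]
    | hadd x x' hx hx' => simp only [map_add, mul_add, hx, hx', LinearMap.comp_add]
    | hof s d' =>
      simp only [smul_mul_assoc, mul_smul_comm, map_smul, of_mul_of, LinearMap.smul_comp,
        LinearMap.comp_smul]
      congr 2
      refine hom_ext δ δ' fun x => ?_
      rw [LinearMap.smul_apply, LinearMap.comp_apply, actHom_of, actHom_of, map_smul, smul_smul,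
        coef_assoc, Diagram.comp_assoc]
      by_cases h : c.InCell k (Diagram.comp d' x)
      · have h1 := proj_coe δ δ' (⟨_, h⟩ : {d : Diagram n // c.InCell k d})
        rw [h1, actHom_of, smul_smul]
      · have h1 : proj δ δ' c k (Diagram.comp d' x) = 0 := dif_neg h
        have h2 : proj δ δ' c k (Diagram.comp d (Diagram.comp d' x)) = 0 :=
          dif_neg fun h3 => h (x.2.of_comp h3)
        rw [h1, h2, map_zero, smul_zero, smul_zero]

instance : Module (PartialBrauer δ δ' n) (CellModule δ δ' c k) where
  smul a x := actHom δ δ' a x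
  one_smul x := by
    change actHom δ δ' 1 x = x
    rw [actHom_one, LinearMap.id_apply]
  mul_smul a b x := by
    change actHom δ δ' (a * b) x = actHom δ δ' a (actHom δ δ' b x)
    rw [actHom_mul, LinearMap.comp_apply]
  smul_zero a := map_zero (actHom δ δ' a)
  smul_add a := map_add (actHom δ δ' a)
  add_smul a b x := by
    change actHom δ δ' (a + b) x = actHom δ δ' a x + actHom δ δ' b x
    rw [map_add, LinearMap.add_apply]
  zero_smul x := by
    change actHom δ δ' 0 x = 0
    rw [map_zero, LinearMap.zero_apply]

theorem smul_def (a : PartialBrauer δ δ' n) (x : CellModule δ δ' c k) :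
    a • x = actHom δ δ' a x := rfl

instance : IsScalarTower 𝕜 (PartialBrauer δ δ' n) (CellModule δ δ' c k) :=
  ⟨fun r a x => by simp only [smul_def, map_smul, LinearMap.smul_apply]⟩

instance : SMulCommClass 𝕜 (PartialBrauer δ δ' n) (CellModule δ δ' c k) :=
  ⟨fun r a x => by simp only [smul_def, map_smul]⟩

instance : SMulCommClass (PartialBrauer δ δ' n) 𝕜 (CellModule δ δ' c k) :=
  SMulCommClass.symm _ _ _

/-- Renaming the right-hand ends of propagating lines, as a linear map. -/
def relabelHom (w : Equiv.Perm (Fin k)) : CellModule δ δ' c k →ₗ[𝕜] CellModule δ δ' c k :=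
  lift δ δ' fun x => of δ δ' ⟨Diagram.relabel (Diagram.endPerm c k w) x, x.2.relabel w⟩

theorem relabelHom_proj (w : Equiv.Perm (Fin k)) (d : Diagram n) :
    relabelHom δ δ' w (proj δ δ' c k d) =
      proj δ δ' c k (Diagram.relabel (Diagram.endPerm c k w) d) := by
  by_cases h : c.InCell k d
  · have h1 := proj_coe δ δ' (⟨_, h⟩ : {d : Diagram n // c.InCell k d})
    have h2 := proj_coe δ δ' (⟨_, h.relabel w⟩ : {d : Diagram n // c.InCell k d})
    rw [h1, h2, relabelHom, lift_of]
  · have h1 : proj δ δ' c k d = 0 := dif_neg h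
    have h2 : proj δ δ' c k (Diagram.relabel (Diagram.endPerm c k w) d) = 0 := by
      refine dif_neg fun h3 => h ?_
      have h4 := h3.relabel w⁻¹
      rwa [← Diagram.relabel_mul, ← map_mul, inv_mul_cancel, map_one, Diagram.relabel_one] at h4
    rw [h1, h2, map_zero]

theorem relabelHom_smul (w : Equiv.Perm (Fin k)) (a : PartialBrauer δ δ' n)
    (x : CellModule δ δ' c k) : relabelHom δ δ' w (a • x) = a • relabelHom δ δ' w x := by
  have h : ∀ a : PartialBrauer δ δ' n,
      relabelHom δ δ' w ∘ₗ actHom δ δ' (c := c) (k := k) a =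
        actHom δ δ' a ∘ₗ relabelHom δ δ' w := by
    intro a
    induction a using PartialBrauer.induction with
    | h0 => simp only [map_zero, LinearMap.comp_zero, LinearMap.zero_comp]
    | hadd a a' ha ha' => simp only [map_add, LinearMap.comp_add, LinearMap.add_comp, ha, ha']
    | hof r d =>
      simp only [map_smul, LinearMap.comp_smul, LinearMap.smul_comp]
      congr 1
      refine hom_ext δ δ' fun x => ?_
      have hc : coef δ δ' d (Diagram.relabel (Diagram.endPerm c k w) x) = coef δ δ' d x := by
        simp only [coef, Diagram.loops, Diagram.strings, (Diagram.comp_relabel _ d x.1).2]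
      rw [LinearMap.comp_apply, LinearMap.comp_apply, actHom_of, map_smul, relabelHom_proj,
        relabelHom, lift_of, actHom_of, hc, (Diagram.comp_relabel _ d x.1).1]
  exact LinearMap.congr_fun (h a) x

/-- The right action of `S_k` on the cell module, by endomorphisms of `R_n`-modules: the element
`w` renames the `i`-th right-hand end of a propagating line to the `w⁻¹ i`-th one, as does
the composition of diagrams drawn from left to right. -/
def rightAct : (Equiv.Perm (Fin k))ᵐᵒᵖ →* Module.End (PartialBrauer δ δ' n) (CellModule δ δ' c k)
    where
  toFun w :=
    { toFun := relabelHom δ δ' w.unop⁻¹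
      map_add' := map_add _
      map_smul' := relabelHom_smul δ δ' _ }
  map_one' := by
    have h : relabelHom δ δ' (1 : Equiv.Perm (Fin k)) = (LinearMap.id : CellModule δ δ' c k →ₗ[𝕜] _) :=
      hom_ext δ δ' fun x => by
        rw [relabelHom, lift_of]
        simp only [map_one, Diagram.relabel_one, LinearMap.id_apply]
    refine LinearMap.ext fun x => ?_
    change relabelHom δ δ' (1 : Equiv.Perm (Fin k))⁻¹ x = x
    rw [inv_one, h, LinearMap.id_apply]
  map_mul' v w := by
    have h : ∀ v w : Equiv.Perm (Fin k), (relabelHom δ δ' (v * w) : CellModule δ δ' c k →ₗ[𝕜] _) =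
        relabelHom δ δ' v ∘ₗ relabelHom δ δ' w := fun v w =>
      hom_ext δ δ' fun x => by
        rw [LinearMap.comp_apply]
        simp only [relabelHom, lift_of, map_mul, Diagram.relabel_mul]
    refine LinearMap.ext fun x => ?_
    change relabelHom δ δ' (v * w).unop⁻¹ x =
      relabelHom δ δ' v.unop⁻¹ (relabelHom δ δ' w.unop⁻¹ x)
    rw [MulOpposite.unop_mul, mul_inv_rev, h, LinearMap.comp_apply]

end CellModule

end Algebra

namespace YoungDiagram

/-- `μ → lam`: the diagram `μ` is obtained from `lam` by removing one node. -/
def Arrow (μ lam : YoungDiagram) : Prop := ∃ x ∈ lam.cells, μ.cells = lam.cells.erase x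

variable (lam : YoungDiagram)

/-- Bijective tableaux of shape `lam`, with entries in `{0, …, |lam| - 1}`. -/
abbrev Tableau := {x // x ∈ lam.cells} ≃ Fin lam.card

variable {lam}

/-- The tabloid of `t`, as the function that sends an entry to the index of its row. -/
def Tableau.tabloid (t : lam.Tableau) : Fin lam.card → ℕ := fun i => (t.symm i).1.1

/-- The column stabilizer of `t`. -/
def Tableau.colStab (t : lam.Tableau) : Finset (Equiv.Perm (Fin lam.card)) :=
  Finset.univ.filter fun π => ∀ i, (t.symm (π i)).1.2 = (t.symm i).1.2

/-- The polytabloid `∑ sign π • {π t}`, the sum running over the column stabilizer of `t`. -/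
def Tableau.polytabloid (t : lam.Tableau) : (Fin lam.card → ℕ) →₀ ℤ :=
  ∑ π ∈ t.colStab, Finsupp.single (Tableau.tabloid (t.trans π)) (Equiv.Perm.sign π : ℤ)

variable (lam)

/-- The integral Specht module of the symmetric group: the span of the polytabloids. -/
def specht : Submodule ℤ ((Fin lam.card → ℕ) →₀ ℤ) :=
  Submodule.span ℤ (Set.range fun t : lam.Tableau => t.polytabloid)

/-- The permutation action on tabloids. -/
def tabloidRep : Representation ℤ (Equiv.Perm (Fin lam.card)) ((Fin lam.card → ℕ) →₀ ℤ) where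
  toFun w := Finsupp.lmapDomain ℤ ℤ fun f => f ∘ ⇑w⁻¹
  map_one' := by
    exact Finsupp.lmapDomain_id ℤ ℤ
  map_mul' v w := by
    rw [Module.End.mul_eq_comp, ← Finsupp.lmapDomain_comp]
    rfl

variable {lam}

theorem tabloidRep_polytabloid (w : Equiv.Perm (Fin lam.card)) (t : lam.Tableau) :
    lam.tabloidRep w t.polytabloid = Tableau.polytabloid (t.trans w) := by
  simp only [Tableau.polytabloid, map_sum]
  refine Finset.sum_nbij' (fun π => w * π * w⁻¹) (fun π => w⁻¹ * π * w) ?_ ?_ ?_ ?_ ?_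
  · intro π hπ
    simp only [Tableau.colStab, Finset.mem_filter, Finset.mem_univ, true_and] at hπ ⊢
    intro i
    simpa using hπ (w⁻¹ i)
  · intro π hπ
    simp only [Tableau.colStab, Finset.mem_filter, Finset.mem_univ, true_and] at hπ ⊢
    intro i
    simpa using hπ (w i)
  · intro π _
    group
  · intro π _
    group
  · intro π _
    have h1 : Equiv.Perm.sign (w * π * w⁻¹) = Equiv.Perm.sign π := by
      rw [map_mul, map_mul, mul_right_comm, ← map_mul, mul_inv_cancel, map_one, one_mul]
    have h2 : Tableau.tabloid ((t.trans w).trans (w * π * w⁻¹)) =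
        Tableau.tabloid (t.trans π) ∘ ⇑w⁻¹ := by
      funext i
      have h3 : (w * π * w⁻¹)⁻¹ = w * π⁻¹ * w⁻¹ := by group
      simp [Tableau.tabloid, ← Equiv.Perm.inv_def, h3]
      rw [Equiv.symm_apply_apply]
    rw [h1, h2]
    simp [tabloidRep]

theorem tabloidRep_mem (w : Equiv.Perm (Fin lam.card)) :
    ∀ x ∈ lam.specht, lam.tabloidRep w x ∈ lam.specht := by
  intro x hx
  induction hx using Submodule.span_induction with
  | mem x h =>
    obtain ⟨t, rfl⟩ := h
    rw [tabloidRep_polytabloid]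
    exact Submodule.subset_span ⟨_, rfl⟩
  | zero => rw [map_zero]; exact zero_mem _
  | add x y _ _ hx hy => rw [map_add]; exact add_mem hx hy
  | smul a x _ hx => rw [map_smul]; exact Submodule.smul_mem _ a hx

variable (lam)

/-- The action of the symmetric group on the integral Specht module. -/
def spechtRep : Representation ℤ (Equiv.Perm (Fin lam.card)) lam.specht where
  toFun w := (lam.tabloidRep w).restrict (tabloidRep_mem w)
  map_one' := by
    refine LinearMap.ext fun x => Subtype.ext ?_
    simp
  map_mul' v w := by
    refine LinearMap.ext fun x => Subtype.ext ?_
    simp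

end YoungDiagram

section Delta

variable {𝕜 : Type*} [CommRing 𝕜] (δ δ' : 𝕜) {n : ℕ} (c : Diagram n) (lam : YoungDiagram)

/-- The submodule generated by the elements `x w ⊗ b - x ⊗ w b` with `w` in the symmetric group.
As the right action is `R_n`-linear, it is already spanned over `𝕜` by these elements. -/
def balanced : Submodule (PartialBrauer δ δ' n)
    (CellModule δ δ' c lam.card ⊗[𝕜] (𝕜 ⊗[ℤ] lam.specht)) :=
  Submodule.span _ {z | ∃ (x : CellModule δ δ' c lam.card) (w : Equiv.Perm (Fin lam.card))
    (b : 𝕜 ⊗[ℤ] lam.specht), z = CellModule.rightAct δ δ' (MulOpposite.op w) x ⊗ₜ[𝕜] b -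
      x ⊗ₜ[𝕜] (lam.spechtRep w).baseChange 𝕜 b}

/-- The Specht module `Δ(n, lam)` of `R_n`: the tensor product, over the group algebra `𝕜[S_k]`, of
the cell module of the left cell of `c` and of the Specht module `𝕜 ⊗ S_ℤ(lam)`, where `k = |lam|`.
Here `c` is a representative of a left cell with propagating number `k`. For `k > n` there is no
such cell, and the module is zero whatever `c` is. -/
abbrev Delta : Type _ :=
  (CellModule δ δ' c lam.card ⊗[𝕜] (𝕜 ⊗[ℤ] lam.specht)) ⧸ balanced δ δ' c lam

/-- The restriction of an `R_{n+1}`-module to `R_n` along `d ↦ d ⊗ 1`. -/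
def Restrict (_δ _δ' : 𝕜) (_n : ℕ) (M : Type*) : Type _ := M

instance (M : Type*) [AddCommGroup M] : AddCommGroup (Restrict δ δ' n M) :=
  inferInstanceAs (AddCommGroup M)

instance (M : Type*) [AddCommGroup M] [Module (PartialBrauer δ δ' (n + 1)) M] :
    Module (PartialBrauer δ δ' n) (Restrict δ δ' n M) :=
  Module.compHom M (PartialBrauer.strandHom δ δ' (n := n)).toRingHom

end Delta

end

/-! ### Young's lattice: addable and removable nodes. -/

namespace YoungDiagram

/-! A left cell with propagating number k is indexed by the matchings of n + 1 left-hand and k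
right-hand vertices in which every right-hand vertex lies on a propagating line. Hence Δ(n+1, λ) is
generated by symbols x ⊗ v with v in the Specht module S(λ) of S_k, where permuting the right-hand
ends of x amounts to acting on v. Restriction to the smaller algebra means acting by diagrams d ⊗ 1,
so the generators are sorted by the fate of the last left-hand vertex.

If this vertex is isolated, it stays isolated under every d ⊗ 1, and deleting it leaves Δ(n, λ)
(`act_addPoint`). If it lies on a propagating line, it stays on that line (`act_addLine`); once the
right-hand end of the line is normalized, only S_{k-1} still acts, so the restriction of S(λ) to
S_{k-1} governs this part. If it is joined to another left-hand vertex, the action may turn it into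
one of the first two kinds, so arcs give only a quotient. In that quotient the last vertex can be
bent to the right-hand side, where the arc becomes a further propagating line (`act_bend`), and the
module S(λ) induced to S_{k+1} governs it. The three pieces fit together in
`DeltaModel.exact_of_split`, as each generator is of exactly one kind.

What remains is the branching rule for symmetric groups, with only a factorial assumed invertible:
`resBase_bijective` splits the restriction and `indBase_bijective` the induction. The tool is the
equivariant map `symmetrize`, which sends a tabloid to the sum of the polytabloids of all its
tableaux. It acts on S(λ) by an integer, and a trace argument (`isUnit_hookScalar`) makes this
integer invertible as soon as the factorial of the number of entries is. Dropping or appending an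
entry and then symmetrizing gives maps between Specht modules that are triangular with respect to
the row of the moved node, hence jointly surjective. Injectivity is a rank count: over ℚ the
surjections give inequalities between ranks, and the identity `sum_up_down` (Young's lattice is a
differential poset) forces equality by induction on the size (`sum_up_and_sum_down`). Ranks of
Specht modules do not depend on the ring, and a surjection between free modules of equal finite rank
is bijective.

In the induction step, (k + 1)! is invertible only for k + 1 ≤ n; beyond this bound the right-hand
term of the sequence is zero. -/

theorem arrow_iff {μ lam : YoungDiagram} : μ.Arrow lam ↔ μ ≤ lam ∧ lam.card = μ.card + 1 := by
  constructor
  · rintro ⟨x, hx, h⟩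
    refine ⟨?_, ?_⟩
    · rw [← cells_subset_iff, h]
      exact Finset.erase_subset _ _
    · rw [YoungDiagram.card, YoungDiagram.card, h, Finset.card_erase_add_one hx]
  · rintro ⟨h1, h2⟩
    rw [← cells_subset_iff] at h1
    have h3 : (lam.cells \ μ.cells).card = 1 := by
      rw [Finset.card_sdiff_of_subset h1]
      unfold YoungDiagram.card at h2
      omega
    obtain ⟨x, hx⟩ := Finset.card_eq_one.1 h3
    have hx1 : x ∈ lam.cells \ μ.cells := by rw [hx]; exact Finset.mem_singleton_self x
    refine ⟨x, (Finset.mem_sdiff.1 hx1).1, ?_⟩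
    rw [← Finset.sdiff_singleton_eq_erase, ← hx, Finset.sdiff_sdiff_eq_self h1]

theorem Arrow.le {μ lam : YoungDiagram} (h : μ.Arrow lam) : μ ≤ lam := (arrow_iff.1 h).1

theorem Arrow.card_eq {μ lam : YoungDiagram} (h : μ.Arrow lam) : lam.card = μ.card + 1 :=
  (arrow_iff.1 h).2

theorem card_le_card {μ lam : YoungDiagram} (h : μ ≤ lam) : μ.card ≤ lam.card :=
  Finset.card_le_card (cells_subset_iff.2 h)

theorem eq_of_le_of_card_le {μ lam : YoungDiagram} (h : μ ≤ lam) (h' : lam.card ≤ μ.card) :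
    μ = lam :=
  YoungDiagram.ext (Finset.eq_of_subset_of_card_le (cells_subset_iff.2 h) h')

theorem card_sup_add_card_inf (μ lam : YoungDiagram) :
    (μ ⊔ lam).card + (μ ⊓ lam).card = μ.card + lam.card := by
  simp only [YoungDiagram.card, cells_sup, cells_inf]
  exact Finset.card_union_add_card_inter _ _

/-- The row of the node by which the two diagrams of an arrow differ. -/
theorem Arrow.exists_row {μ lam : YoungDiagram} (h : μ.Arrow lam) :
    ∃ r, lam.cells = insert (r, μ.rowLen r) μ.cells ∧ lam.rowLen r = μ.rowLen r + 1 := by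
  have hle := h.le
  obtain ⟨⟨r, s⟩, hx, hc⟩ := h
  have h1 : ∀ y, y ∈ μ ↔ y ≠ (r, s) ∧ y ∈ lam := by
    intro y
    rw [← mem_cells, hc, Finset.mem_erase, mem_cells]
  have h2 : μ.rowLen r = s := by
    apply le_antisymm
    · by_contra h3
      have h4 : (r, s) ∈ μ := mem_iff_lt_rowLen.2 (not_le.1 h3)
      exact ((h1 _).1 h4).1 rfl
    · by_contra h3
      have h4 : (r, μ.rowLen r) ∈ μ := by
        rw [h1]
        refine ⟨fun hh => ?_, lam.up_left_mem le_rfl (not_le.1 h3).le (mem_cells _ |>.1 hx)⟩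
        have := congrArg Prod.snd hh
        simp only at this
        omega
      exact lt_irrefl _ (mem_iff_lt_rowLen.1 h4)
  refine ⟨r, ?_, ?_⟩
  · rw [h2, hc, Finset.insert_erase hx]
  · apply le_antisymm
    · by_contra h3
      have h4 : (r, s + 1) ∈ lam := mem_iff_lt_rowLen.2 (by omega)
      have h5 : (r, s + 1) ∈ μ := (h1 _).2 ⟨by simp, h4⟩
      have := mem_iff_lt_rowLen.1 h5
      omega
    · have := mem_iff_lt_rowLen.1 ((mem_cells _).1 hx)
      omega

/-- The row of the node by which the two diagrams of an arrow differ. -/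
noncomputable def Arrow.row {μ lam : YoungDiagram} (h : μ.Arrow lam) : ℕ := h.exists_row.choose

theorem Arrow.cells_eq {μ lam : YoungDiagram} (h : μ.Arrow lam) :
    lam.cells = insert (h.row, μ.rowLen h.row) μ.cells := h.exists_row.choose_spec.1

theorem Arrow.rowLen_eq {μ lam : YoungDiagram} (h : μ.Arrow lam) :
    lam.rowLen h.row = μ.rowLen h.row + 1 := h.exists_row.choose_spec.2

theorem Arrow.notMem {μ lam : YoungDiagram} (_h : μ.Arrow lam) (r : ℕ) :
    (r, μ.rowLen r) ∉ μ.cells := fun h1 =>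
  lt_irrefl _ (mem_iff_lt_rowLen.1 ((mem_cells _).1 h1))

theorem Arrow.cells_erase {μ lam : YoungDiagram} (h : μ.Arrow lam) :
    μ.cells = lam.cells.erase (h.row, μ.rowLen h.row) := by
  rw [h.cells_eq, Finset.erase_insert (h.notMem _)]

theorem Arrow.eq_of_row_eq_up {lam μ μ' : YoungDiagram} (h : lam.Arrow μ) (h' : lam.Arrow μ')
    (hr : h.row = h'.row) : μ = μ' :=
  YoungDiagram.ext (by rw [h.cells_eq, h'.cells_eq, hr])

theorem Arrow.eq_of_row_eq_down {lam μ μ' : YoungDiagram} (h : μ.Arrow lam) (h' : μ'.Arrow lam)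
    (hr : h.row = h'.row) : μ = μ' := by
  have h1 := h.rowLen_eq
  have h2 := h'.rowLen_eq
  rw [← hr] at h2
  refine YoungDiagram.ext ?_
  rw [h.cells_erase, h'.cells_erase, ← hr]
  congr 2
  omega

theorem finite_down (lam : YoungDiagram) : {μ : YoungDiagram | μ.Arrow lam}.Finite := by
  refine Set.Finite.of_finite_image (f := YoungDiagram.cells) ?_
    (fun _ _ _ _ h => YoungDiagram.ext h)
  refine (Finset.finite_toSet lam.cells.powerset).subset ?_
  rintro _ ⟨μ, hμ, rfl⟩
  simpa using hμ.le

/-- A node added further down would leave a gap in column 0. The bound makes the set of larger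
diagrams finite. -/
theorem Arrow.row_le {μ lam : YoungDiagram} (h : μ.Arrow lam) : h.row ≤ μ.colLen 0 := by
  by_contra h1
  have h2 : (h.row, μ.rowLen h.row) ∈ lam := by
    rw [← mem_cells, h.cells_eq]
    exact Finset.mem_insert_self _ _
  have h3 : (μ.colLen 0, 0) ∈ lam := lam.up_left_mem (not_le.1 h1).le (Nat.zero_le _) h2
  rw [← mem_cells, h.cells_eq, Finset.mem_insert] at h3
  rcases h3 with h3 | h3
  · have := congrArg Prod.fst h3
    simp only at this
    omega
  · rw [mem_cells, mem_iff_lt_colLen] at h3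
    exact lt_irrefl _ h3

theorem finite_up (lam : YoungDiagram) : {μ : YoungDiagram | lam.Arrow μ}.Finite := by
  have : Function.Injective fun μ : {μ : YoungDiagram | lam.Arrow μ} =>
      (⟨Arrow.row μ.2, Nat.lt_succ_of_le (Arrow.row_le μ.2)⟩ : Fin (lam.colLen 0 + 1)) := by
    intro μ μ' h
    exact Subtype.ext (Arrow.eq_of_row_eq_up μ.2 μ'.2 (congrArg Fin.val h))
  exact Set.finite_coe_iff.1 (Finite.of_injective _ this)

noncomputable instance (lam : YoungDiagram) : Fintype {μ : YoungDiagram // μ.Arrow lam} :=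
  (finite_down lam).fintype

noncomputable instance (lam : YoungDiagram) : Fintype {μ : YoungDiagram // lam.Arrow μ} :=
  (finite_up lam).fintype

/-- Adding a node at the end of the row `r`. -/
def addNode (lam : YoungDiagram) (r : ℕ) (hr : r = 0 ∨ lam.rowLen r < lam.rowLen (r - 1)) :
    YoungDiagram where
  cells := insert (r, lam.rowLen r) lam.cells
  isLowerSet := by
    rintro ⟨i, j⟩ ⟨i', j'⟩ hle hmem
    obtain ⟨h1, h2⟩ := Prod.mk_le_mk.1 hle
    simp only [Finset.coe_insert, Set.mem_insert_iff, Finset.mem_coe, mem_cells, Prod.mk.injEq]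
      at hmem ⊢
    rcases hmem with ⟨rfl, rfl⟩ | hmem
    · rcases h1.lt_or_eq with h3 | rfl
      · right
        rw [mem_iff_lt_rowLen]
        have := lam.rowLen_anti i' (i - 1) (by omega)
        omega
      · rcases h2.lt_or_eq with h3 | rfl
        · right
          rwa [mem_iff_lt_rowLen]
        · left; simp
    · right
      exact lam.up_left_mem h1 h2 hmem

theorem arrow_addNode (lam : YoungDiagram) (r : ℕ)
    (hr : r = 0 ∨ lam.rowLen r < lam.rowLen (r - 1)) : lam.Arrow (lam.addNode r hr) := by
  have h1 : (r, lam.rowLen r) ∉ lam.cells := fun h1 =>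
    lt_irrefl _ (mem_iff_lt_rowLen.1 ((mem_cells _).1 h1))
  exact ⟨(r, lam.rowLen r), Finset.mem_insert_self _ _, (Finset.erase_insert h1).symm⟩

theorem Arrow.row_unique {μ lam : YoungDiagram} (h : μ.Arrow lam) {r : ℕ}
    (hr : lam.cells = insert (r, μ.rowLen r) μ.cells) : h.row = r := by
  have h1 : (r, μ.rowLen r) ∈ lam.cells := hr ▸ Finset.mem_insert_self _ _
  rw [h.cells_eq, Finset.mem_insert] at h1
  rcases h1 with h1 | h1
  · exact (congrArg Prod.fst h1).symm
  · exact absurd h1 (h.notMem r)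

/-- Removing the last node of the row `r`. -/
def removeNode (lam : YoungDiagram) (r : ℕ) (hr : lam.rowLen (r + 1) < lam.rowLen r) :
    YoungDiagram where
  cells := lam.cells.erase (r, lam.rowLen r - 1)
  isLowerSet := by
    rintro ⟨i, j⟩ ⟨i', j'⟩ hle hmem
    obtain ⟨h1, h2⟩ := Prod.mk_le_mk.1 hle
    simp only [Finset.coe_erase, Set.mem_sdiff, Set.mem_singleton_iff, Finset.mem_coe, mem_cells,
      Prod.mk.injEq] at hmem ⊢
    refine ⟨lam.up_left_mem h1 h2 hmem.1, ?_⟩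
    rintro ⟨rfl, rfl⟩
    have h3 := mem_iff_lt_rowLen.1 hmem.1
    rcases h1.lt_or_eq with h4 | rfl
    · have := lam.rowLen_anti (i' + 1) i h4
      omega
    · omega

theorem removeNode_arrow (lam : YoungDiagram) (r : ℕ) (hr : lam.rowLen (r + 1) < lam.rowLen r) :
    (lam.removeNode r hr).Arrow lam :=
  ⟨(r, lam.rowLen r - 1), by rw [mem_cells, mem_iff_lt_rowLen]; omega, rfl⟩

theorem Arrow.rowLen_of_ne {μ lam : YoungDiagram} (h : μ.Arrow lam) {i : ℕ} (hi : i ≠ h.row) :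
    lam.rowLen i = μ.rowLen i := by
  apply le_antisymm
  · by_contra h1
    have h2 : (i, μ.rowLen i) ∈ lam.cells := (mem_cells _).2 (mem_iff_lt_rowLen.2 (not_le.1 h1))
    rw [h.cells_eq, Finset.mem_insert] at h2
    rcases h2 with h2 | h2
    · exact hi (congrArg Prod.fst h2)
    · exact h.notMem i h2
  · by_contra h1
    have h2 : (i, lam.rowLen i) ∈ μ := mem_iff_lt_rowLen.2 (not_le.1 h1)
    exact lt_irrefl _ (mem_iff_lt_rowLen.1 (h.le h2))

theorem Arrow.row_addable {μ lam : YoungDiagram} (h : μ.Arrow lam) :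
    h.row = 0 ∨ μ.rowLen h.row < μ.rowLen (h.row - 1) := by
  rcases Nat.eq_zero_or_pos h.row with h1 | h1
  · exact Or.inl h1
  · right
    rw [← h.rowLen_of_ne (i := h.row - 1) (by omega)]
    have := lam.rowLen_anti (h.row - 1) h.row (by omega)
    rw [h.rowLen_eq] at this
    omega

theorem Arrow.row_removable {μ lam : YoungDiagram} (h : μ.Arrow lam) :
    lam.rowLen (h.row + 1) < lam.rowLen h.row := by
  rw [h.rowLen_of_ne (i := h.row + 1) (by omega), h.rowLen_eq]
  have := μ.rowLen_anti h.row (h.row + 1) (by omega)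
  omega

/-- A node can be added in row r + 1 exactly if the last node of row r can be removed; the one
addable row not obtained in this way is row 0, which accounts for `none`. -/
theorem card_up (lam : YoungDiagram) : Fintype.card {μ : YoungDiagram // lam.Arrow μ} =
    Fintype.card {μ : YoungDiagram // μ.Arrow lam} + 1 := by
  rw [← Fintype.card_option]
  symm
  let f : Option {μ : YoungDiagram // μ.Arrow lam} → {μ : YoungDiagram // lam.Arrow μ} := fun o =>
    o.elim ⟨lam.addNode 0 (Or.inl rfl), arrow_addNode _ _ _⟩ fun μ =>
      ⟨lam.addNode (Arrow.row μ.2 + 1) (Or.inr (by simpa using Arrow.row_removable μ.2)),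
        arrow_addNode _ _ _⟩
  have hnone : Arrow.row (f none).2 = 0 := Arrow.row_unique _ rfl
  have hsome : ∀ μ, Arrow.row (f (some μ)).2 = Arrow.row μ.2 + 1 :=
    fun μ => Arrow.row_unique _ rfl
  refine Fintype.card_of_bijective (f := f) ⟨?_, ?_⟩
  · rintro (_ | μ) (_ | μ') h
    · rfl
    · have h1 := hnone.symm.trans ((congrArg (fun x => Arrow.row x.2) h).trans (hsome μ'))
      omega
    · have h1 := hnone.symm.trans ((congrArg (fun x => Arrow.row x.2) h.symm).trans (hsome μ))
      omega
    · have h1 := (hsome μ).symm.trans ((congrArg (fun x => Arrow.row x.2) h).trans (hsome μ'))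
      rw [Subtype.ext (Arrow.eq_of_row_eq_down μ.2 μ'.2 (Nat.succ_injective h1))]
  · intro μ
    have h2 := Arrow.row_addable μ.2
    rcases h : Arrow.row μ.2 with _ | r
    · exact ⟨none, Subtype.ext (Arrow.eq_of_row_eq_up (f none).2 μ.2 (hnone.trans h.symm))⟩
    · rw [h] at h2
      have h3 : lam.rowLen (r + 1) < lam.rowLen r := by simpa using h2
      have h4 : Arrow.row (lam.removeNode_arrow r h3) = r := by
        refine Arrow.row_unique _ ?_
        have h5 : (lam.removeNode r h3).rowLen r = lam.rowLen r - 1 := by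
          have h6 : (r, lam.rowLen r - 1) ∉ lam.removeNode r h3 := by
            rw [← mem_cells]
            exact Finset.notMem_erase _ _
          have h7 : ∀ j < lam.rowLen r - 1, (r, j) ∈ lam.removeNode r h3 := by
            intro j hj
            rw [← mem_cells]
            refine Finset.mem_erase.2 ⟨fun h => ?_, ?_⟩
            · have := congrArg Prod.snd h
              simp only at this
              omega
            · rw [mem_cells, mem_iff_lt_rowLen]
              omega
          rw [mem_iff_lt_rowLen] at h6
          rcases Nat.lt_or_ge ((lam.removeNode r h3).rowLen r) (lam.rowLen r - 1) with h8 | h8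
          · exact absurd (mem_iff_lt_rowLen.1 (h7 _ h8)) (lt_irrefl _)
          · omega
        rw [h5]
        refine (Finset.insert_erase ?_).symm
        rw [mem_cells, mem_iff_lt_rowLen]
        omega
      exact ⟨some ⟨_, lam.removeNode_arrow r h3⟩,
        Subtype.ext (Arrow.eq_of_row_eq_up (f _).2 μ.2 ((hsome _).trans (by rw [h4, h])))⟩

/-- Two different diagrams of the same size have a common cover in Young's lattice exactly if they
cover a common diagram, and both are unique: they are the join and the meet. So the terms away from
`lam` correspond, and the terms at `lam` itself are counted by `card_up`, which leaves one extra
summand. -/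
theorem sum_up_down (F : YoungDiagram → ℕ) (lam : YoungDiagram) :
    ∑ μ : {μ : YoungDiagram // lam.Arrow μ}, ∑ ν : {ν : YoungDiagram // ν.Arrow μ.1}, F ν.1 =
      (∑ ν : {ν : YoungDiagram // ν.Arrow lam}, ∑ μ : {μ : YoungDiagram // ν.1.Arrow μ}, F μ.1) +
        F lam := by
  classical
  have h1 : ∀ μ : {μ : YoungDiagram // lam.Arrow μ},
      ∑ ν : {ν : YoungDiagram // ν.Arrow μ.1}, F ν.1 =
        (∑ ν : {ν : YoungDiagram // ν.Arrow μ.1} with ν.1 ≠ lam, F ν.1) + F lam := by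
    intro μ
    rw [← Finset.sum_filter_add_sum_filter_not _ fun ν : {ν : YoungDiagram // ν.Arrow μ.1} =>
      ν.1 ≠ lam]
    congr 1
    rw [Finset.sum_eq_single_of_mem (⟨lam, μ.2⟩ : {ν : YoungDiagram // ν.Arrow μ.1})]
    · simp
    · intro b hb hne
      simp only [ne_eq, not_not, Finset.mem_filter, Finset.mem_univ, true_and] at hb
      exact absurd (Subtype.ext hb) hne
  have h2 : ∀ ν : {ν : YoungDiagram // ν.Arrow lam},
      ∑ μ : {μ : YoungDiagram // ν.1.Arrow μ}, F μ.1 =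
        (∑ μ : {μ : YoungDiagram // ν.1.Arrow μ} with μ.1 ≠ lam, F μ.1) + F lam := by
    intro ν
    rw [← Finset.sum_filter_add_sum_filter_not _ fun μ : {μ : YoungDiagram // ν.1.Arrow μ} =>
      μ.1 ≠ lam]
    congr 1
    rw [Finset.sum_eq_single_of_mem (⟨lam, ν.2⟩ : {μ : YoungDiagram // ν.1.Arrow μ})]
    · simp
    · intro b hb hne
      simp only [ne_eq, not_not, Finset.mem_filter, Finset.mem_univ, true_and] at hb
      exact absurd (Subtype.ext hb) hne
  simp only [h1, h2, Finset.sum_add_distrib, Finset.sum_const, Finset.card_univ, smul_eq_mul,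
    card_up, add_mul, one_mul, ← add_assoc]
  congr 2
  rw [Finset.sum_sigma', Finset.sum_sigma']
  -- The sizes of join and meet add up to those of the two diagrams, so a join one node larger means
  -- a meet one node smaller.
  have key : ∀ {μ ν : YoungDiagram}, lam.Arrow μ → ν.Arrow μ → ν ≠ lam →
      (lam ⊓ ν).Arrow lam ∧ (lam ⊓ ν).Arrow ν ∧ lam ⊔ ν = μ := by
    intro μ ν h h' hne
    have e0 := card_sup_add_card_inf lam ν
    have e1 := h.card_eq
    have e2 := h'.card_eq
    have e3 : lam ⊔ ν ≤ μ := sup_le h.le h'.le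
    have e4 : lam.card < (lam ⊔ ν).card := by
      by_contra hc
      have h5 : lam = lam ⊔ ν := eq_of_le_of_card_le le_sup_left (not_lt.1 hc)
      have h6 : ν ≤ lam := by rw [h5]; exact le_sup_right
      exact hne (eq_of_le_of_card_le h6 (by omega))
    have e5 := card_le_card e3
    exact ⟨arrow_iff.2 ⟨inf_le_left, by omega⟩, arrow_iff.2 ⟨inf_le_right, by omega⟩,
      eq_of_le_of_card_le e3 (by omega)⟩
  have key' : ∀ {ν μ : YoungDiagram}, ν.Arrow lam → ν.Arrow μ → μ ≠ lam →
      lam.Arrow (lam ⊔ μ) ∧ μ.Arrow (lam ⊔ μ) ∧ lam ⊓ μ = ν := by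
    intro ν μ h h' hne
    have e0 := card_sup_add_card_inf lam μ
    have e1 := h.card_eq
    have e2 := h'.card_eq
    have e3 : ν ≤ lam ⊓ μ := le_inf h.le h'.le
    have e4 : (lam ⊓ μ).card < lam.card := by
      by_contra hc
      have h5 : lam ⊓ μ = lam := eq_of_le_of_card_le inf_le_left (not_lt.1 hc)
      have h6 : lam ≤ μ := by rw [← h5]; exact inf_le_right
      exact hne (eq_of_le_of_card_le h6 (by omega)).symm
    have e5 := card_le_card e3
    exact ⟨arrow_iff.2 ⟨le_sup_left, by omega⟩, arrow_iff.2 ⟨le_sup_right, by omega⟩,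
      (eq_of_le_of_card_le e3 (by omega)).symm⟩
  have ext1 : ∀ p q : Σ μ : {μ : YoungDiagram // lam.Arrow μ}, {ν : YoungDiagram // ν.Arrow μ.1},
      p.1.1 = q.1.1 → p.2.1 = q.2.1 → p = q := by
    rintro ⟨⟨_, _⟩, ⟨_, _⟩⟩ ⟨⟨_, _⟩, ⟨_, _⟩⟩ h h'
    dsimp only at h h'
    subst h h'
    rfl
  have ext2 : ∀ p q : Σ ν : {ν : YoungDiagram // ν.Arrow lam}, {μ : YoungDiagram // ν.1.Arrow μ},
      p.1.1 = q.1.1 → p.2.1 = q.2.1 → p = q := by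
    rintro ⟨⟨_, _⟩, ⟨_, _⟩⟩ ⟨⟨_, _⟩, ⟨_, _⟩⟩ h h'
    dsimp only at h h'
    subst h h'
    rfl
  refine Finset.sum_bij'
    (i := fun p hp => ⟨⟨lam ⊓ p.2.1, (key p.1.2 p.2.2 (by simpa using hp)).1⟩,
      ⟨p.2.1, (key p.1.2 p.2.2 (by simpa using hp)).2.1⟩⟩)
    (j := fun p hp => ⟨⟨lam ⊔ p.2.1, (key' p.1.2 p.2.2 (by simpa using hp)).1⟩,
      ⟨p.2.1, (key' p.1.2 p.2.2 (by simpa using hp)).2.1⟩⟩) ?_ ?_ ?_ ?_ ?_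
  · rintro ⟨μ, ν⟩ hp
    simpa using hp
  · rintro ⟨μ, ν⟩ hp
    simpa using hp
  · intro p hp
    exact ext1 _ _ (key p.1.2 p.2.2 (by simpa using hp)).2.2 rfl
  · intro p hp
    exact ext2 _ _ (key' p.1.2 p.2.2 (by simpa using hp)).2.2 rfl
  · intro p hp
    rfl

/-- The last non-empty row ends in a removable node; `Nat.find h1` is the first empty row. -/
theorem exists_down {lam : YoungDiagram} (h : lam.card ≠ 0) : ∃ μ : YoungDiagram, μ.Arrow lam := by
  have h1 : ∃ r, lam.rowLen r = 0 := by
    refine ⟨lam.colLen 0, ?_⟩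
    by_contra h2
    have h3 : (lam.colLen 0, 0) ∈ lam := mem_iff_lt_rowLen.2 (Nat.pos_of_ne_zero h2)
    exact lt_irrefl _ (mem_iff_lt_colLen.1 h3)
  classical
  have h2 : Nat.find h1 ≠ 0 := by
    intro h3
    rw [Nat.find_eq_zero] at h3
    apply h
    rw [YoungDiagram.card, Finset.card_eq_zero, Finset.eq_empty_iff_forall_notMem]
    rintro ⟨i, j⟩ hij
    have := mem_iff_lt_rowLen.1 ((mem_cells _).1 hij)
    have := lam.rowLen_anti 0 i (Nat.zero_le _)
    omega
  obtain ⟨r, hr⟩ := Nat.exists_eq_succ_of_ne_zero h2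
  have h3 := Nat.find_spec h1
  have h4 := Nat.find_min h1 (m := r) (by omega)
  rw [hr] at h3
  exact ⟨_, lam.removeNode_arrow r (by simp only [Nat.succ_eq_add_one] at h3; omega)⟩

end YoungDiagram

/-! ### Tableaux, polytabloids and signed column sums. -/

noncomputable section

set_option linter.unusedSectionVars false

namespace YoungDiagram

open Equiv

variable {lam lam' : YoungDiagram} {A : Type*}

variable (lam A) in
/-- Bijective tableaux of shape `lam` with entries in `A`. -/
abbrev Filling := {x // x ∈ lam.cells} ≃ A

namespace Filling

/-- The tabloid of `t`: the function that sends an entry to the index of its row. -/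
def rows (t : lam.Filling A) : A → ℕ := fun a => (t.symm a).1.1

/-- The function that sends an entry to the index of its column. -/
def cols (t : lam.Filling A) : A → ℕ := fun a => (t.symm a).1.2

theorem rows_trans (t : lam.Filling A) (π : Perm A) :
    rows (t.trans π) = rows t ∘ ⇑π⁻¹ := rfl

theorem cols_trans (t : lam.Filling A) (π : Perm A) :
    cols (t.trans π) = cols t ∘ ⇑π⁻¹ := rfl

theorem mem_cells (t : lam.Filling A) (a : A) : (t.rows a, t.cols a) ∈ lam.cells := (t.symm a).2

theorem ext_rows_cols {t : lam.Filling A} {a b : A} (h : t.rows a = t.rows b)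
    (h' : t.cols a = t.cols b) : a = b :=
  t.symm.injective (Subtype.ext (Prod.ext h h'))

end Filling

variable (A) in
/-- The permutation action on integral combinations of functions `A → ℕ`. -/
def permAct : Perm A →* Module.End ℤ ((A → ℕ) →₀ ℤ) where
  toFun w := Finsupp.lmapDomain ℤ ℤ fun f => f ∘ ⇑w⁻¹
  map_one' := Finsupp.lmapDomain_id ℤ ℤ
  map_mul' v w := by
    rw [Module.End.mul_eq_comp, ← Finsupp.lmapDomain_comp]
    rfl

theorem permAct_single (w : Perm A) (f : A → ℕ) (z : ℤ) :
    permAct A w (Finsupp.single f z) = Finsupp.single (f ∘ ⇑w⁻¹) z := by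
  simp [permAct]

theorem permAct_mul_apply (v w : Perm A) (x : (A → ℕ) →₀ ℤ) :
    permAct A (v * w) x = permAct A v (permAct A w x) := by
  rw [map_mul]
  rfl

theorem permAct_apply (w : Perm A) (x : (A → ℕ) →₀ ℤ) (f : A → ℕ) :
    permAct A w x f = x (f ∘ ⇑w) := by
  have h : f = (f ∘ ⇑w) ∘ ⇑w⁻¹ := by
    funext a
    simp
  conv_lhs => rw [h]
  refine Finsupp.mapDomain_apply (f := fun g : A → ℕ => g ∘ ⇑w⁻¹) ?_ x (f ∘ ⇑w)
  intro g g' hg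
  funext a
  simpa using congrFun hg (w a)

variable [Fintype A] [DecidableEq A]

namespace Filling

/-- The column stabilizer of `t`. -/
def colStab (t : lam.Filling A) : Finset (Perm A) :=
  Finset.univ.filter fun π => ∀ i, (t.symm (π i)).1.2 = (t.symm i).1.2

theorem mem_colStab {t : lam.Filling A} {π : Perm A} :
    π ∈ t.colStab ↔ ∀ i, t.cols (π i) = t.cols i := by
  simp [colStab, cols]

theorem mul_mem_colStab {t : lam.Filling A} {π σ : Perm A} (h : π ∈ t.colStab)
    (h' : σ ∈ t.colStab) : π * σ ∈ t.colStab := by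
  rw [mem_colStab] at *
  intro i
  rw [Perm.mul_apply, h, h']

theorem inv_mem_colStab {t : lam.Filling A} {π : Perm A} (h : π ∈ t.colStab) :
    π⁻¹ ∈ t.colStab := by
  rw [mem_colStab] at *
  intro i
  simpa using (h (π⁻¹ i)).symm

/-- The column stabilizer as a subgroup. -/
def colSubgroup (t : lam.Filling A) : Subgroup (Perm A) where
  carrier := t.colStab
  mul_mem' h h' := mul_mem_colStab h h'
  one_mem' := by simp [mem_colStab]
  inv_mem' h := inv_mem_colStab h

/-- Lagrange's theorem. This makes the order of the column stabilizer a unit when the factorial is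
one. -/
theorem card_colStab_dvd (t : lam.Filling A) :
    t.colStab.card ∣ (Fintype.card A).factorial := by
  have h := Subgroup.card_subgroup_dvd_card t.colSubgroup
  rw [Nat.card_perm, Nat.card_eq_fintype_card (α := A)] at h
  have h1 : Nat.card t.colSubgroup = t.colStab.card := by
    change Nat.card t.colStab = _
    simp
  rwa [h1] at h

/-- The polytabloid of `t`. -/
def polytabloid (t : lam.Filling A) : (A → ℕ) →₀ ℤ :=
  ∑ π ∈ t.colStab, Finsupp.single (rows (t.trans π)) (Perm.sign π : ℤ)

/-- The signed column sum of `t`. -/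
def colSum (t : lam.Filling A) : Module.End ℤ ((A → ℕ) →₀ ℤ) :=
  ∑ π ∈ t.colStab, (Perm.sign π : ℤ) • permAct A π

theorem colSum_apply (t : lam.Filling A) (x : (A → ℕ) →₀ ℤ) :
    t.colSum x = ∑ π ∈ t.colStab, (Perm.sign π : ℤ) • permAct A π x := by
  simp [colSum]

theorem polytabloid_eq (t : lam.Filling A) :
    t.polytabloid = t.colSum (Finsupp.single t.rows 1) := by
  rw [colSum_apply, polytabloid]
  refine Finset.sum_congr rfl fun π _ => ?_
  rw [permAct_single, Finsupp.smul_single, smul_eq_mul, mul_one]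
  rfl

theorem permAct_colSum (t : lam.Filling A) (w : Perm A) (x : (A → ℕ) →₀ ℤ) :
    permAct A w (t.colSum x) = colSum (t.trans w) (permAct A w x) := by
  rw [colSum_apply, colSum_apply, map_sum]
  refine Finset.sum_nbij' (fun π => w * π * w⁻¹) (fun π => w⁻¹ * π * w) ?_ ?_ ?_ ?_ ?_
  · intro π hπ
    rw [mem_colStab] at hπ ⊢
    intro i
    simpa [cols_trans] using hπ (w⁻¹ i)
  · intro π hπ
    rw [mem_colStab] at hπ ⊢
    intro i
    simpa [cols_trans] using hπ (w i)
  · intro π _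
    group
  · intro π _
    group
  · intro π _
    have h1 : Perm.sign (w * π * w⁻¹) = Perm.sign π := by
      rw [map_mul, map_mul, mul_right_comm, ← map_mul, mul_inv_cancel, map_one, one_mul]
    rw [h1, map_smul, ← permAct_mul_apply, ← permAct_mul_apply, inv_mul_cancel_right]

theorem permAct_polytabloid (t : lam.Filling A) (w : Perm A) :
    permAct A w t.polytabloid = polytabloid (t.trans w) := by
  rw [polytabloid_eq, polytabloid_eq, permAct_colSum, permAct_single]
  rfl

theorem colSum_permAct (t : lam.Filling A) {π : Perm A} (hπ : π ∈ t.colStab)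
    (x : (A → ℕ) →₀ ℤ) : t.colSum (permAct A π x) = (Perm.sign π : ℤ) • t.colSum x := by
  rw [colSum_apply, colSum_apply, Finset.smul_sum]
  refine Finset.sum_nbij' (fun σ => σ * π) (fun σ => σ * π⁻¹) ?_ ?_ ?_ ?_ ?_
  · exact fun σ hσ => mul_mem_colStab hσ hπ
  · exact fun σ hσ => mul_mem_colStab hσ (inv_mem_colStab hπ)
  · intro σ _
    group
  · intro σ _
    group
  · intro σ _
    rw [permAct_mul_apply, smul_smul, map_mul, Units.val_mul, mul_left_comm, ← Units.val_mul,
      Int.units_mul_self, Units.val_one, mul_one]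

/-- The transposition of `a` and `b` fixes the tabloid and belongs to the column stabilizer, where
it contributes the sign -1. The value is thus its own negative, and integral combinations have no
2-torsion. -/
theorem colSum_single_eq_zero (t : lam.Filling A) {f : A → ℕ} {a b : A} (hab : a ≠ b)
    (hf : f a = f b) (hc : t.cols a = t.cols b) : t.colSum (Finsupp.single f 1) = 0 := by
  have hs : swap a b ∈ t.colStab := by
    rw [mem_colStab]
    intro i
    rw [swap_apply_def]
    split_ifs with h1 h2
    · rw [h1, hc]
    · rw [h2, hc]
    · rfl
  have h := colSum_permAct t hs (Finsupp.single f 1)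
  have hfs : f ∘ ⇑(swap a b)⁻¹ = f := by
    funext i
    rw [swap_inv, Function.comp_apply, swap_apply_def]
    split_ifs with h1 h2
    · rw [h1, hf]
    · rw [h2, hf]
    · rfl
  rw [permAct_single, hfs, Perm.sign_swap hab] at h
  simpa [self_eq_neg] using h

/-- The counted entries of column j have different values of `f`, all at most i, so there are at
most i + 1 of them; and column j has only `colLen j` entries. The minimum of these bounds is the
number of cells of the column in the rows up to i. -/
theorem card_filter_le_of_injective (t : lam.Filling A) {f : A → ℕ}
    (hf : Function.Injective fun a => (f a, t.cols a)) (i j : ℕ) :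
    (Finset.univ.filter fun a => f a ≤ i ∧ t.cols a = j).card ≤
      (lam.cells.filter fun y => y.1 ≤ i ∧ y.2 = j).card := by
  have h1 : (lam.cells.filter fun y => y.1 ≤ i ∧ y.2 = j) =
      (Finset.range (min (i + 1) (lam.colLen j))).map ⟨fun r => (r, j), fun _ _ h => by
        simpa using h⟩ := by
    ext ⟨r, s⟩
    simp only [Finset.mem_filter, YoungDiagram.mem_cells, Finset.mem_map, Finset.mem_range,
      lt_inf_iff]
    constructor
    · rintro ⟨h1, h2, rfl⟩
      exact ⟨r, ⟨by omega, mem_iff_lt_colLen.1 h1⟩, rfl⟩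
    · rintro ⟨r', ⟨h1, h2⟩, h⟩
      obtain ⟨rfl, rfl⟩ := Prod.mk.inj h
      exact ⟨mem_iff_lt_colLen.2 h2, by omega, rfl⟩
  rw [h1, Finset.card_map, Finset.card_range, le_min_iff]
  constructor
  · rw [← Finset.card_range (i + 1)]
    refine Finset.card_le_card_of_injOn f ?_ ?_
    · intro a ha
      simp only [Finset.mem_coe, Finset.mem_filter, Finset.mem_univ, true_and] at ha
      simpa using Nat.lt_succ_of_le ha.1
    · intro a ha b hb hab
      simp only [Finset.mem_coe, Finset.mem_filter, Finset.mem_univ, true_and] at ha hb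
      exact hf (Prod.ext hab (ha.2.trans hb.2.symm))
  · rw [← Finset.card_range (lam.colLen j)]
    refine Finset.card_le_card_of_injOn t.rows ?_ ?_
    · intro a ha
      simp only [Finset.mem_coe, Finset.mem_filter, Finset.mem_univ, true_and] at ha
      have h2 := t.mem_cells a
      rw [ha.2, YoungDiagram.mem_cells, mem_iff_lt_colLen] at h2
      simpa using h2
    · intro a ha b hb hab
      simp only [Finset.mem_coe, Finset.mem_filter, Finset.mem_univ, true_and] at ha hb
      exact ext_rows_cols hab (ha.2.trans hb.2.symm)

theorem cols_lt (t : lam.Filling A) (a : A) : t.cols a < lam.rowLen 0 := by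
  have h := mem_iff_lt_rowLen.1 ((YoungDiagram.mem_cells _).1 (t.mem_cells a))
  exact h.trans_le (lam.rowLen_anti 0 _ (Nat.zero_le _))

theorem card_filter_eq_sum (t : lam.Filling A) (f : A → ℕ) (i : ℕ) :
    (Finset.univ.filter fun a => f a ≤ i).card = ∑ j ∈ Finset.range (lam.rowLen 0),
      (Finset.univ.filter fun a => f a ≤ i ∧ t.cols a = j).card := by
  rw [Finset.card_eq_sum_card_fiberwise (f := t.cols) (t := Finset.range (lam.rowLen 0))]
  · simp only [Finset.filter_filter]
  · intro a _
    simpa using t.cols_lt a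

theorem _root_.YoungDiagram.card_cells_filter_eq_sum (lam : YoungDiagram) (i : ℕ) :
    (lam.cells.filter fun y => y.1 ≤ i).card = ∑ j ∈ Finset.range (lam.rowLen 0),
      (lam.cells.filter fun y => y.1 ≤ i ∧ y.2 = j).card := by
  rw [Finset.card_eq_sum_card_fiberwise (f := Prod.snd) (t := Finset.range (lam.rowLen 0))]
  · simp only [Finset.filter_filter]
  · rintro ⟨r, s⟩ ha
    simp only [Finset.mem_coe, Finset.mem_filter, YoungDiagram.mem_cells] at ha
    have h := mem_iff_lt_rowLen.1 ha.1
    simpa using h.trans_le (lam.rowLen_anti 0 _ (Nat.zero_le _))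

theorem card_filter_rows (t : lam.Filling A) (i : ℕ) :
    (Finset.univ.filter fun a => t.rows a ≤ i).card = (lam.cells.filter fun y => y.1 ≤ i).card := by
  refine Finset.card_nbij (fun a => (t.rows a, t.cols a)) ?_ ?_ ?_
  · intro a ha
    simp only [Finset.mem_coe, Finset.mem_filter, Finset.mem_univ, true_and] at ha ⊢
    exact ⟨t.mem_cells a, ha⟩
  · intro a _ b _ hab
    exact ext_rows_cols (congrArg Prod.fst hab) (congrArg Prod.snd hab)
  · intro y hy
    simp only [Finset.mem_coe, Finset.mem_filter] at hy
    exact ⟨t ⟨y, hy.1⟩, Finset.mem_filter.2 ⟨Finset.mem_univ _, by simp [rows, hy.2]⟩, by simp [rows, cols]⟩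

/-- If no two entries are in the same column of `t` and the same row of `u`, then the shape of `t`
dominates the shape of `u`. -/
theorem dominance (t : lam.Filling A) (u : lam'.Filling A)
    (h : Function.Injective fun a => (u.rows a, t.cols a)) (i : ℕ) :
    (lam'.cells.filter fun y => y.1 ≤ i).card ≤ (lam.cells.filter fun y => y.1 ≤ i).card := by
  rw [← u.card_filter_rows, t.card_filter_eq_sum, lam.card_cells_filter_eq_sum]
  exact Finset.sum_le_sum fun j _ => t.card_filter_le_of_injective h i j

/-- This is the case of equality in `dominance`. The column-wise inequalities must all be
equalities, so the pairs (row in `u`, column in `t`) fill out exactly the cells of the diagram. They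
form a tableau with the tabloid of `u` and the columns of `t`. -/
theorem exists_rows_eq (t u : lam.Filling A)
    (h : Function.Injective fun a => (u.rows a, t.cols a)) :
    ∃ π ∈ t.colStab, u.rows = rows (t.trans π) := by
  have h1 : ∀ i, ∀ j ∈ Finset.range (lam.rowLen 0),
      (Finset.univ.filter fun a => u.rows a ≤ i ∧ t.cols a = j).card =
        (lam.cells.filter fun y => y.1 ≤ i ∧ y.2 = j).card := by
    intro i
    rw [← Finset.sum_eq_sum_iff_of_le fun j _ => t.card_filter_le_of_injective h i j,
      ← t.card_filter_eq_sum, ← lam.card_cells_filter_eq_sum, u.card_filter_rows]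
  have h2 : ∀ a, (u.rows a, t.cols a) ∈ lam.cells := by
    intro a
    by_contra ha
    rw [YoungDiagram.mem_cells, mem_iff_lt_colLen, not_lt] at ha
    -- With this bound on the rows the whole column of the diagram is counted. The column contains
    -- `a`, so its length is positive and the subtraction is genuine.
    have h3 := h1 (lam.colLen (t.cols a) - 1) (t.cols a) (Finset.mem_range.2 (t.cols_lt a))
    have h4 : (Finset.univ.filter fun b => t.cols b = t.cols a).card =
        (lam.cells.filter fun y => y.1 ≤ lam.colLen (t.cols a) - 1 ∧ y.2 = t.cols a).card := by
      refine Finset.card_nbij (fun b => (t.rows b, t.cols b)) ?_ ?_ ?_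
      · intro b hb
        simp only [Finset.mem_coe, Finset.mem_filter, Finset.mem_univ, true_and] at hb ⊢
        have h5 := t.mem_cells b
        refine ⟨h5, ?_, hb⟩
        rw [hb, YoungDiagram.mem_cells, mem_iff_lt_colLen] at h5
        omega
      · intro a _ b _ hab
        exact ext_rows_cols (congrArg Prod.fst hab) (congrArg Prod.snd hab)
      · intro y hy
        simp only [Finset.mem_coe, Finset.mem_filter] at hy
        exact ⟨t ⟨y, hy.1⟩, Finset.mem_filter.2 ⟨Finset.mem_univ _, by simp [cols, hy.2.2]⟩, by simp [rows, cols]⟩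
    rw [← h4] at h3
    have h5 := Finset.eq_of_subset_of_card_le (s := Finset.univ.filter fun b =>
      u.rows b ≤ lam.colLen (t.cols a) - 1 ∧ t.cols b = t.cols a)
      (t := Finset.univ.filter fun b => t.cols b = t.cols a) (by
        intro b hb
        simp only [Finset.mem_filter, Finset.mem_univ, true_and] at hb ⊢
        exact hb.2) h3.ge
    have h6 : a ∈ Finset.univ.filter fun b => t.cols b = t.cols a := by simp
    rw [← h5] at h6
    simp only [Finset.mem_filter, Finset.mem_univ, true_and, and_true] at h6
    have h7 := t.mem_cells a
    rw [YoungDiagram.mem_cells, mem_iff_lt_colLen] at h7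
    omega
  let g : A → {x // x ∈ lam.cells} := fun a => ⟨_, h2 a⟩
  have hg : Function.Injective g := fun a b hab => h (congrArg Subtype.val hab)
  have hg' : Function.Bijective g :=
    (Fintype.bijective_iff_injective_and_card g).2 ⟨hg, (Fintype.card_congr t).symm⟩
  let v : A ≃ {x // x ∈ lam.cells} := Equiv.ofBijective g hg'
  have hv : ∀ a, (t.symm.trans v.symm) a = v.symm (t.symm a) := fun a => rfl
  -- The permutation that carries `t` to the new tableau `v.symm`; it preserves columns by the
  -- choice of `g`.
  refine ⟨t.symm.trans v.symm, ?_, ?_⟩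
  · rw [mem_colStab]
    intro a
    have h3 : (v (v.symm (t.symm a))).1.2 = t.cols (v.symm (t.symm a)) := rfl
    rw [hv, ← h3, Equiv.apply_symm_apply]
    rfl
  · funext a
    have h3 : (t.trans (t.symm.trans v.symm) : lam.Filling A) = v.symm := by
      ext x
      simp
    rw [h3]
    rfl

/-- The signed column sum of `t` sends tabloids of the same shape to multiples of the polytabloid. -/
theorem exists_colSum_eq_smul (t u : lam.Filling A) :
    ∃ z : ℤ, t.colSum (Finsupp.single u.rows 1) = z • t.polytabloid := by
  by_cases h : Function.Injective fun a => (u.rows a, t.cols a)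
  · obtain ⟨π, hπ, hu⟩ := exists_rows_eq t u h
    refine ⟨Perm.sign π, ?_⟩
    rw [hu, rows_trans, ← permAct_single, colSum_permAct t hπ, polytabloid_eq]
  · simp only [Function.Injective, not_forall] at h
    obtain ⟨a, b, hab, hne⟩ := h
    refine ⟨0, ?_⟩
    rw [zero_smul]
    exact colSum_single_eq_zero t hne (Prod.mk.inj hab).1 (Prod.mk.inj hab).2

/-- Only the identity contributes, since a column permutation that also preserves the rows fixes
every cell. -/
theorem polytabloid_apply_rows (t : lam.Filling A) : t.polytabloid t.rows = 1 := by
  rw [polytabloid, Finsupp.finsetSum_apply, Finset.sum_eq_single_of_mem 1]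
  · simp [rows_trans]
  · simp [mem_colStab]
  · intro π hπ hne
    rw [Finsupp.single_apply, if_neg]
    intro h
    apply hne
    ext1 a
    rw [mem_colStab] at hπ
    refine (ext_rows_cols (t := t) ?_ ?_)
    · have := congrFun h (π a)
      simpa [rows_trans] using this.symm
    · simpa using hπ a

end Filling

end YoungDiagram

end

/-! ### Integral Specht modules and the symmetrizing map. -/

noncomputable section

set_option linter.unusedSectionVars false

namespace YoungDiagram

open Equiv

variable {lam lam' : YoungDiagram} {A : Type*} [Fintype A] [DecidableEq A]

variable (lam A) in
/-- The integral Specht module with entries in `A`: the span of the polytabloids. -/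
def spechtOf : Submodule ℤ ((A → ℕ) →₀ ℤ) :=
  Submodule.span ℤ (Set.range fun t : lam.Filling A => t.polytabloid)

theorem Filling.polytabloid_mem (t : lam.Filling A) : t.polytabloid ∈ lam.spechtOf A :=
  Submodule.subset_span ⟨t, rfl⟩

theorem permAct_mem (w : Perm A) {x : (A → ℕ) →₀ ℤ} (hx : x ∈ lam.spechtOf A) :
    permAct A w x ∈ lam.spechtOf A := by
  have h : lam.spechtOf A ≤ (lam.spechtOf A).comap (permAct A w) := by
    refine Submodule.span_le.2 ?_
    rintro _ ⟨t, rfl⟩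
    change permAct A w t.polytabloid ∈ lam.spechtOf A
    rw [Filling.permAct_polytabloid]
    exact Filling.polytabloid_mem _
  exact h hx

theorem Filling.exists_colSum_eq_smul_of_mem (t : lam.Filling A) {x : (A → ℕ) →₀ ℤ}
    (hx : x ∈ lam.spechtOf A) : ∃ z : ℤ, t.colSum x = z • t.polytabloid := by
  have h : lam.spechtOf A ≤ (Submodule.span ℤ {t.polytabloid}).comap t.colSum := by
    refine Submodule.span_le.2 ?_
    rintro _ ⟨u, rfl⟩
    change t.colSum (∑ π ∈ u.colStab, Finsupp.single (rows (u.trans π)) (Perm.sign π : ℤ)) ∈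
      Submodule.span ℤ {t.polytabloid}
    rw [map_sum]
    refine Submodule.sum_mem _ fun π _ => ?_
    obtain ⟨z, hz⟩ := t.exists_colSum_eq_smul (u.trans π)
    rw [← mul_one ((Perm.sign π : ℤ)), ← smul_eq_mul, ← Finsupp.smul_single, map_smul, hz]
    exact Submodule.smul_mem _ _ (Submodule.smul_mem _ _ (Submodule.mem_span_singleton_self _))
  obtain ⟨z, hz⟩ := Submodule.mem_span_singleton.1 (h hx)
  exact ⟨z, hz.symm⟩

variable (lam A) in
/-- The equivariant map that sends a tabloid to the sum of the polytabloids of its tableaux. -/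
def symmetrize : ((A → ℕ) →₀ ℤ) →ₗ[ℤ] lam.spechtOf A :=
  ∑ u : lam.Filling A, (LinearMap.toSpanSingleton ℤ _
    (⟨u.polytabloid, u.polytabloid_mem⟩ : lam.spechtOf A)) ∘ₗ Finsupp.lapply u.rows

theorem coe_symmetrize (x : (A → ℕ) →₀ ℤ) :
    (lam.symmetrize A x : (A → ℕ) →₀ ℤ) = ∑ u : lam.Filling A, x u.rows • u.polytabloid := by
  simp [symmetrize, LinearMap.sum_apply]

theorem symmetrize_permAct (w : Perm A) (x : (A → ℕ) →₀ ℤ) :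
    (lam.symmetrize A (permAct A w x) : (A → ℕ) →₀ ℤ) = permAct A w (lam.symmetrize A x) := by
  rw [coe_symmetrize, coe_symmetrize, map_sum]
  refine Finset.sum_nbij' (fun u => u.trans w⁻¹) (fun u => u.trans w) ?_ ?_ ?_ ?_ ?_
  · simp
  · simp
  · intro u _
    ext a
    simp
  · intro u _
    ext a
    simp
  · intro u _
    have h : (u.trans w⁻¹).trans w = u := by
      ext a
      simp
    rw [map_smul, Filling.permAct_polytabloid, permAct_apply, h]
    rfl

theorem symmetrize_colSum (t : lam'.Filling A) (x : (A → ℕ) →₀ ℤ) :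
    (lam.symmetrize A (t.colSum x) : (A → ℕ) →₀ ℤ) = t.colSum (lam.symmetrize A x) := by
  simp only [Filling.colSum_apply, map_sum, map_smul, AddSubmonoidClass.coe_finsetSum,
    Submodule.coe_smul, symmetrize_permAct]

/-- A polytabloid is a column sum of a tabloid, and `symmetrize` commutes with column sums. So its
image is the column sum of an element of the Specht module, which is a multiple of the same
polytabloid. Equivariance carries the scalar from one tableau to all others. -/
theorem exists_symmetrize_polytabloid (lam : YoungDiagram) (A : Type*) [Fintype A]
    [DecidableEq A] : ∃ c : ℤ, ∀ t : lam.Filling A,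
      (lam.symmetrize A t.polytabloid : (A → ℕ) →₀ ℤ) = c • t.polytabloid := by
  by_cases h : Nonempty (lam.Filling A)
  · obtain ⟨t₀⟩ := h
    obtain ⟨c, hc⟩ := t₀.exists_colSum_eq_smul_of_mem
      (lam.symmetrize A (Finsupp.single t₀.rows 1)).2
    rw [← symmetrize_colSum, ← Filling.polytabloid_eq] at hc
    refine ⟨c, fun t => ?_⟩
    have ht : t = t₀.trans (t₀.symm.trans t) := by
      ext a
      simp
    rw [ht, ← Filling.permAct_polytabloid, symmetrize_permAct, hc, map_smul]
  · exact ⟨0, fun t => absurd ⟨t⟩ h⟩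

variable (lam A) in
/-- The scalar by which `symmetrize` acts on the Specht module (the product of the hook lengths). -/
def hookScalar : ℤ := (exists_symmetrize_polytabloid lam A).choose

theorem symmetrize_polytabloid (t : lam.Filling A) :
    (lam.symmetrize A t.polytabloid : (A → ℕ) →₀ ℤ) = lam.hookScalar A • t.polytabloid :=
  (exists_symmetrize_polytabloid lam A).choose_spec t

/-- Let B be the matrix of coefficients of polytabloids at the tabloids of all tableaux. Evaluating
the scalar action of `symmetrize` gives B² = hookScalar · B. If the scalar lay in a maximal ideal, B
would be nilpotent over the residue field and have trace 0. But the diagonal entries are 1 and there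
are |A|! tableaux, so the trace is the image of a unit. -/
theorem isUnit_hookScalar {𝕜 : Type*} [CommRing 𝕜] (t₀ : lam.Filling A)
    (h : IsUnit ((Fintype.card A).factorial : 𝕜)) : IsUnit (lam.hookScalar A : 𝕜) := by
  by_contra hc
  obtain ⟨m, hm, hcm⟩ := exists_max_ideal_of_mem_nonunits hc
  let _ : Field (𝕜 ⧸ m) := Ideal.Quotient.field m
  let B : Matrix (lam.Filling A) (lam.Filling A) (𝕜 ⧸ m) :=
    fun t s => ((t.polytabloid s.rows : ℤ) : 𝕜 ⧸ m)
  have hB : B * B = 0 := by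
    ext t s
    have h1 := DFunLike.congr_fun (symmetrize_polytabloid t) s.rows
    rw [coe_symmetrize, Finsupp.finsetSum_apply] at h1
    simp only [Finsupp.smul_apply, smul_eq_mul] at h1
    have h2 := congrArg (Int.cast : ℤ → 𝕜 ⧸ m) h1
    have h3 : ((lam.hookScalar A : ℤ) : 𝕜 ⧸ m) = 0 := by
      rw [← map_intCast (Ideal.Quotient.mk m)]
      exact Ideal.Quotient.eq_zero_iff_mem.2 hcm
    rw [Int.cast_mul, h3, zero_mul, Int.cast_sum] at h2
    rw [Matrix.mul_apply, Matrix.zero_apply]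
    simpa only [B, Int.cast_mul] using h2
  have h1 : IsNilpotent B := ⟨2, by rw [pow_two, hB]⟩
  have h2 := (Matrix.isNilpotent_trace_of_isNilpotent h1).eq_zero
  have h3 : B.trace = ((Fintype.card A).factorial : 𝕜 ⧸ m) := by
    simp only [Matrix.trace, Matrix.diag, B, Filling.polytabloid_apply_rows, Int.cast_one,
      Finset.sum_const, Finset.card_univ, nsmul_eq_mul, mul_one]
    rw [Fintype.card_equiv t₀, Fintype.card_congr t₀]
  have h4 := h.map (Ideal.Quotient.mk m)
  rw [map_natCast, ← h3, h2] at h4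
  exact not_isUnit_zero h4

end YoungDiagram

end

/-! ### Adding and dropping one entry of a tableau. -/

noncomputable section

set_option linter.unusedSectionVars false

namespace YoungDiagram

open Equiv

variable {lam lam' μ : YoungDiagram} {A B : Type*}

/-- The extension of a permutation by a fixed point. -/
def extendPerm (e : Option A ≃ B) : Perm A →* Perm B where
  toFun σ := e.permCongr (optionCongr σ)
  map_one' := by
    ext b
    simp [Perm.one_def]
  map_mul' σ τ := by
    ext b
    rcases h : e.symm b with _ | a <;> simp [h]

@[simp]
theorem extendPerm_none (e : Option A ≃ B) (σ : Perm A) : extendPerm e σ (e none) = e none := by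
  simp [extendPerm]

@[simp]
theorem extendPerm_some (e : Option A ≃ B) (σ : Perm A) (a : A) :
    extendPerm e σ (e (some a)) = e (some (σ a)) := by
  simp [extendPerm]

theorem extendPerm_inv_none (e : Option A ≃ B) (σ : Perm A) :
    (extendPerm e σ)⁻¹ (e none) = e none := by
  rw [← map_inv, extendPerm_none]

theorem extendPerm_inv_some (e : Option A ≃ B) (σ : Perm A) (a : A) :
    (extendPerm e σ)⁻¹ (e (some a)) = e (some (σ⁻¹ a)) := by
  rw [← map_inv, extendPerm_some]

theorem forall_option_equiv (e : Option A ≃ B) {p : B → Prop} :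
    (∀ b, p b) ↔ p (e none) ∧ ∀ a, p (e (some a)) := by
  rw [← e.forall_congr_right (q := p), Option.forall]

theorem extendPerm_injective (e : Option A ≃ B) : Function.Injective (extendPerm e) := by
  intro σ τ h
  ext a
  have h1 := DFunLike.congr_fun h (e (some a))
  simpa using h1

/-- The image of `extendPerm e` is the stabilizer of the point `e none`. -/
theorem exists_extendPerm (e : Option A ≃ B) {π : Perm B} (h : π (e none) = e none) :
    ∃ σ, extendPerm e σ = π := by
  have h0 : (e.symm.permCongr π) none = none := by simp [h]
  refine ⟨removeNone (e.symm.permCongr π), ?_⟩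
  ext b
  revert b
  rw [forall_option_equiv e]
  refine ⟨by simp [h], fun a => ?_⟩
  rw [extendPerm_some, removeNone_some]
  · simp
  · refine Option.ne_none_iff_exists'.1 fun h1 => ?_
    have := (e.symm.permCongr π).injective (h1.trans h0.symm)
    simp at this

namespace Filling

/-- The tableau `t` with one more entry, in the added node. -/
def extend (h : μ.Arrow lam) (e : Option A ≃ B) (t : μ.Filling A) : lam.Filling B :=
  ((Equiv.subtypeEquivRight fun x => by rw [h.cells_eq]).trans
    (Finset.subtypeInsertEquivOption (h.notMem h.row))).trans ((optionCongr t).trans e)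

variable (h : μ.Arrow lam) (e : Option A ≃ B) (t : μ.Filling A)

@[simp]
theorem rows_extend_none : (t.extend h e).rows (e none) = h.row := by
  simp [rows, extend, Finset.subtypeInsertEquivOption]
  rfl

@[simp]
theorem cols_extend_none : (t.extend h e).cols (e none) = μ.rowLen h.row := by
  simp [cols, extend, Finset.subtypeInsertEquivOption]
  rfl

@[simp]
theorem rows_extend_some (a : A) : (t.extend h e).rows (e (some a)) = t.rows a := by
  simp [rows, extend, Finset.subtypeInsertEquivOption]
  rfl

@[simp]
theorem cols_extend_some (a : A) : (t.extend h e).cols (e (some a)) = t.cols a := by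
  simp [cols, extend, Finset.subtypeInsertEquivOption]
  rfl

end Filling

/-- Forget the last entry if it has the value `r`, and send all other functions to zero. -/
def dropLast (e : Option A ≃ B) (r : ℕ) : ((B → ℕ) →₀ ℤ) →ₗ[ℤ] ((A → ℕ) →₀ ℤ) :=
  Finsupp.linearCombination ℤ fun f =>
    if f (e none) = r then Finsupp.single (fun a => f (e (some a))) 1 else 0

theorem dropLast_single (e : Option A ≃ B) (r : ℕ) (f : B → ℕ) (z : ℤ) :
    dropLast e r (Finsupp.single f z) =
      if f (e none) = r then Finsupp.single (fun a => f (e (some a))) z else 0 := by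
  rw [dropLast, Finsupp.linearCombination_single]
  split_ifs <;> simp

theorem dropLast_permAct (e : Option A ≃ B) (r : ℕ) (σ : Perm A) (x : (B → ℕ) →₀ ℤ) :
    dropLast e r (permAct B (extendPerm e σ) x) = permAct A σ (dropLast e r x) := by
  induction x using Finsupp.induction_linear with
  | zero => simp
  | add x y hx hy => simp only [map_add, hx, hy]
  | single f z =>
    rw [permAct_single, dropLast_single, dropLast_single]
    simp only [Function.comp_apply, extendPerm_inv_none, extendPerm_inv_some]
    split_ifs
    · rw [permAct_single]
      rfl
    · simp

/-- Extend functions by the value `r` at the last entry. -/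
def appendLast (e : Option A ≃ B) (r : ℕ) : ((A → ℕ) →₀ ℤ) →ₗ[ℤ] ((B → ℕ) →₀ ℤ) :=
  Finsupp.lmapDomain ℤ ℤ fun f b => (e.symm b).elim r f

theorem appendLast_single (e : Option A ≃ B) (r : ℕ) (f : A → ℕ) (z : ℤ) :
    appendLast e r (Finsupp.single f z) = Finsupp.single (fun b => (e.symm b).elim r f) z := by
  simp [appendLast]

theorem appendLast_permAct (e : Option A ≃ B) (r : ℕ) (σ : Perm A) (x : (A → ℕ) →₀ ℤ) :
    appendLast e r (permAct A σ x) = permAct B (extendPerm e σ) (appendLast e r x) := by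
  induction x using Finsupp.induction_linear with
  | zero => simp
  | add x y hx hy => simp only [map_add, hx, hy]
  | single f z =>
    rw [permAct_single, appendLast_single, appendLast_single, permAct_single]
    congr 1
    funext b
    revert b
    rw [forall_option_equiv e]
    simp only [Function.comp_apply, extendPerm_inv_none, extendPerm_inv_some]
    simp

variable [Fintype A] [DecidableEq A] [Fintype B] [DecidableEq B]

theorem sign_extendPerm (e : Option A ≃ B) (σ : Perm A) :
    Perm.sign (extendPerm e σ) = Perm.sign σ := by
  change Perm.sign (e.permCongr (optionCongr σ)) = _
  rw [Perm.sign_permCongr, optionCongr_sign]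

theorem Filling.extendPerm_mem_colStab (h : μ.Arrow lam) (e : Option A ≃ B) (t : μ.Filling A)
    {σ : Perm A} : extendPerm e σ ∈ (t.extend h e).colStab ↔ σ ∈ t.colStab := by
  rw [mem_colStab, mem_colStab, forall_option_equiv e]
  simp

/-- A term survives only if the entry `e none` stays in its row. A column permutation keeps its
column as well, so it fixes the entry and comes from the column stabilizer of `t`. -/
theorem dropLast_polytabloid (h : μ.Arrow lam) (e : Option A ≃ B) (t : μ.Filling A) :
    dropLast e h.row (t.extend h e).polytabloid = t.polytabloid := by
  rw [Filling.polytabloid, map_sum, Filling.polytabloid]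
  symm
  refine Finset.sum_of_injOn (extendPerm e) (extendPerm_injective e).injOn ?_ ?_ ?_
  · intro σ hσ
    exact (Filling.extendPerm_mem_colStab h e t).2 hσ
  · intro π hπ hne
    rw [dropLast_single, if_neg]
    rw [Filling.rows_trans, Function.comp_apply]
    intro h1
    apply hne
    have h2 : π⁻¹ (e none) = e none := by
      refine Filling.ext_rows_cols (t := t.extend h e) ?_ ?_
      · rw [h1, Filling.rows_extend_none]
      · exact Filling.mem_colStab.1 (Filling.inv_mem_colStab hπ) _
    obtain ⟨σ, rfl⟩ := exists_extendPerm e (Perm.inv_eq_iff_eq.1 h2).symm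
    exact ⟨σ, (Filling.extendPerm_mem_colStab h e t).1 hπ, rfl⟩
  · intro σ _
    rw [dropLast_single, Filling.rows_trans, Filling.rows_trans, sign_extendPerm]
    simp only [Function.comp_apply, extendPerm_inv_none, extendPerm_inv_some,
      Filling.rows_extend_none, Filling.rows_extend_some, if_true]
    rfl

/-- The added node is the lowest one of its column, so no column permutation moves the entry `e
none` to a lower row. -/
theorem dropLast_polytabloid_of_lt (h : μ.Arrow lam) (e : Option A ≃ B) (t : μ.Filling A) {r : ℕ}
    (hr : h.row < r) : dropLast e r (t.extend h e).polytabloid = 0 := by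
  rw [Filling.polytabloid, map_sum]
  refine Finset.sum_eq_zero fun π hπ => ?_
  rw [dropLast_single, if_neg]
  rw [Filling.rows_trans, Function.comp_apply]
  intro h1
  have h2 := Filling.mem_colStab.1 (Filling.inv_mem_colStab hπ) (e none)
  have h3 := Filling.mem_cells (t.extend h e) (π⁻¹ (e none))
  rw [h1, h2, Filling.cols_extend_none, YoungDiagram.mem_cells, mem_iff_lt_rowLen] at h3
  have h4 := lam.rowLen_anti (h.row + 1) r hr
  have h5 := h.row_removable
  have h6 := h.rowLen_eq
  omega

theorem appendLast_rows (h : μ.Arrow lam) (e : Option A ≃ B) (t : μ.Filling A) :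
    appendLast e h.row (Finsupp.single t.rows 1) = Finsupp.single (t.extend h e).rows 1 := by
  rw [appendLast_single]
  congr 1
  funext b
  revert b
  rw [forall_option_equiv e]
  simp

variable (lam A) in
/-- The action of the permutations of the entries on the integral Specht module. -/
def spechtRepOf : Representation ℤ (Perm A) (lam.spechtOf A) where
  toFun w := (permAct A w).restrict fun _ hx => permAct_mem w hx
  map_one' := by
    refine LinearMap.ext fun x => Subtype.ext ?_
    simp
  map_mul' v w := by
    refine LinearMap.ext fun x => Subtype.ext ?_
    simp

theorem coe_spechtRepOf (w : Perm A) (x : lam.spechtOf A) :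
    (lam.spechtRepOf A w x : (A → ℕ) →₀ ℤ) = permAct A w x := rfl

/-- The restriction map from the Specht module of `lam` to the one of `μ`. -/
def resMap (h : μ.Arrow lam) (e : Option A ≃ B) : lam.spechtOf B →ₗ[ℤ] μ.spechtOf A :=
  μ.symmetrize A ∘ₗ dropLast e h.row ∘ₗ (lam.spechtOf B).subtype

theorem resMap_act (h : μ.Arrow lam) (e : Option A ≃ B) (σ : Perm A) :
    resMap h e ∘ₗ lam.spechtRepOf B (extendPerm e σ) = μ.spechtRepOf A σ ∘ₗ resMap h e := by
  refine LinearMap.ext fun x => Subtype.ext ?_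
  simp only [resMap, LinearMap.comp_apply, Submodule.subtype_apply, coe_spechtRepOf,
    dropLast_permAct, symmetrize_permAct]

/-- The polytabloid of `t` as an element of the Specht module. -/
def Filling.poly (t : lam.Filling A) : lam.spechtOf A := ⟨t.polytabloid, t.polytabloid_mem⟩

/-- Here the truncated polytabloid is a polytabloid again, and symmetrizing only multiplies it by
the scalar. For a general element the truncation need not lie in the Specht module of `μ`;
symmetrizing puts it there without losing equivariance. -/
theorem resMap_poly (h : μ.Arrow lam) (e : Option A ≃ B) (t : μ.Filling A) :
    resMap h e (t.extend h e).poly = μ.hookScalar A • t.poly := by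
  refine Subtype.ext ?_
  simp only [resMap, LinearMap.comp_apply, Submodule.subtype_apply, Filling.poly,
    dropLast_polytabloid, symmetrize_polytabloid, Submodule.coe_smul]

/-- With `resMap_poly` this makes the family of restriction maps triangular with respect to the row
of the removed node. -/
theorem resMap_poly_of_lt {μ' : YoungDiagram} (h : μ.Arrow lam) (h' : μ'.Arrow lam)
    (e : Option A ≃ B) (t : μ.Filling A) (hr : h.row < h'.row) :
    resMap h' e (t.extend h e).poly = 0 := by
  simp only [resMap, LinearMap.comp_apply, Submodule.subtype_apply, Filling.poly,
    dropLast_polytabloid_of_lt h e t hr, map_zero]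

/-- The map from the Specht module of `μ` to the one of `lam` that defines the map on the induced
module. -/
def indMap (h : μ.Arrow lam) (e : Option A ≃ B) : μ.spechtOf A →ₗ[ℤ] lam.spechtOf B :=
  lam.symmetrize B ∘ₗ appendLast e h.row ∘ₗ (μ.spechtOf A).subtype

theorem indMap_act (h : μ.Arrow lam) (e : Option A ≃ B) (σ : Perm A) :
    indMap h e ∘ₗ μ.spechtRepOf A σ = lam.spechtRepOf B (extendPerm e σ) ∘ₗ indMap h e := by
  refine LinearMap.ext fun x => Subtype.ext ?_
  simp only [indMap, LinearMap.comp_apply, Submodule.subtype_apply, coe_spechtRepOf,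
    appendLast_permAct, symmetrize_permAct]

/-- The signed column sum of a tableau, acting on the Specht module of another shape. -/
def colOp (t : lam.Filling A) (lam' : YoungDiagram) : Module.End ℤ (lam'.spechtOf A) :=
  ∑ π ∈ t.colStab, (Perm.sign π : ℤ) • lam'.spechtRepOf A π

theorem coe_colOp (t : lam.Filling A) (x : lam'.spechtOf A) :
    (colOp t lam' x : (A → ℕ) →₀ ℤ) = t.colSum x := by
  simp only [colOp, Filling.colSum_apply, LinearMap.sum_apply, LinearMap.smul_apply,
    AddSubmonoidClass.coe_finsetSum, Submodule.coe_smul, coe_spechtRepOf]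

/-- Each term of the polytabloid of `t` arises from its tabloid by a permutation in the column
stabilizer of the extended tableau. The column sum absorbs this permutation together with its sign,
so all terms contribute the same: the symmetrized polytabloid of the extended tableau. The other
factor is the number of terms. -/
theorem colOp_indMap (h : μ.Arrow lam) (e : Option A ≃ B) (t : μ.Filling A) :
    colOp (t.extend h e) lam (indMap h e t.poly) =
      (t.colStab.card * lam.hookScalar B : ℤ) • (t.extend h e).poly := by
  refine Subtype.ext ?_
  rw [coe_colOp]
  simp only [indMap, LinearMap.comp_apply, Submodule.subtype_apply, Filling.poly,
    Submodule.coe_smul]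
  rw [Filling.polytabloid_eq t, Filling.colSum_apply t]
  simp only [map_sum, map_smul, appendLast_permAct, appendLast_rows,
    AddSubmonoidClass.coe_finsetSum, Submodule.coe_smul, symmetrize_permAct]
  have h1 : ∀ σ ∈ t.colStab, (Perm.sign σ : ℤ) • (t.extend h e).colSum (permAct B (extendPerm e σ)
      (lam.symmetrize B (Finsupp.single (t.extend h e).rows 1))) =
        lam.hookScalar B • (t.extend h e).polytabloid := by
    intro σ hσ
    rw [Filling.colSum_permAct _ ((Filling.extendPerm_mem_colStab h e t).2 hσ), sign_extendPerm,
      smul_smul, ← Units.val_mul, Int.units_mul_self, Units.val_one, one_smul,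
      ← symmetrize_colSum, ← Filling.polytabloid_eq, symmetrize_polytabloid]
  rw [Finset.sum_congr rfl h1, Finset.sum_const, ← smul_smul, natCast_zsmul]

/-- A tabloid that is not annihilated would give, by `dominance`, at least as many cells of `lam` as
of `lam'` in the rows up to `h'.row`. But both diagrams are `μ` with one node added, and only the
node of `lam'` lies in these rows. -/
theorem colOp_eq_zero (h : μ.Arrow lam) (h' : μ.Arrow lam') (e : Option A ≃ B) (t : μ.Filling A)
    (hr : h'.row < h.row) : colOp (t.extend h e) lam' = 0 := by
  have h1 : ∀ u : lam'.Filling B, (t.extend h e).colSum (Finsupp.single u.rows 1) = 0 := by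
    intro u
    by_cases hi : Function.Injective fun a => (u.rows a, (t.extend h e).cols a)
    · have h2 := Filling.dominance (t.extend h e) u hi h'.row
      rw [h.cells_eq, h'.cells_eq, Finset.filter_insert, Finset.filter_insert, if_pos le_rfl,
        if_neg (by simpa using hr), Finset.card_insert_of_notMem] at h2
      · omega
      · exact fun h3 => h.notMem _ (Finset.mem_filter.1 h3).1
    · simp only [Function.Injective, not_forall] at hi
      obtain ⟨a, b, hab, hne⟩ := hi
      exact Filling.colSum_single_eq_zero _ hne (Prod.mk.inj hab).1 (Prod.mk.inj hab).2
  have h2 : lam'.spechtOf B ≤ LinearMap.ker (t.extend h e).colSum := by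
    refine Submodule.span_le.2 ?_
    rintro _ ⟨u, rfl⟩
    change (t.extend h e).colSum
      (∑ π ∈ u.colStab, Finsupp.single (Filling.rows (u.trans π)) (Perm.sign π : ℤ)) = 0
    rw [map_sum]
    refine Finset.sum_eq_zero fun π _ => ?_
    rw [← mul_one ((Perm.sign π : ℤ)), ← smul_eq_mul, ← Finsupp.smul_single, map_smul, h1,
      smul_zero]
  refine LinearMap.ext fun x => Subtype.ext ?_
  rw [coe_colOp]
  exact h2 x.2

end YoungDiagram

end

/-! ### The branching rule for symmetric groups over 𝕜. -/

noncomputable section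

set_option linter.unusedSectionVars false

open scoped TensorProduct

/-- A submodule of a product is everything if it contains enough elements in triangular form. -/
theorem Submodule.eq_top_of_triangular {𝕜 I α : Type*} [CommRing 𝕜] [Finite I] [LinearOrder α]
    {V : I → Type*} [∀ i, AddCommGroup (V i)] [∀ i, Module 𝕜 (V i)] (r : I → α)
    (hr : Function.Injective r) (R : Submodule 𝕜 (∀ i, V i)) (S : ∀ i, Set (V i))
    (hS : ∀ i, Submodule.span 𝕜 (S i) = ⊤)
    (h : ∀ i, ∀ v ∈ S i, ∃ y ∈ R, y i = v ∧ ∀ j, r i < r j → y j = 0) : R = ⊤ := by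
  classical
  have := Fintype.ofFinite I
  have hwf : WellFounded (InvImage (· < ·) r) := by
    have : IsTrans I (InvImage (· < ·) r) := ⟨fun _ _ _ h h' => lt_trans h h'⟩
    have : Std.Irrefl (InvImage (· < ·) r) := ⟨fun i => lt_irrefl (r i)⟩
    exact Finite.wellFounded_of_trans_of_irrefl _
  have key : ∀ i, ∀ v : V i, Pi.single i v ∈ R := by
    intro i
    induction i using hwf.induction with
    | h i ih =>
      suffices hs : (⊤ : Submodule 𝕜 (V i)) ≤ R.comap (LinearMap.single 𝕜 V i) from
        fun v => hs (x := v) trivial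
      rw [← hS i, Submodule.span_le]
      intro v hv
      obtain ⟨y, hy, hyi, hyj⟩ := h i v hv
      change Pi.single i v ∈ R
      -- Subtracting its other components from `y` leaves `v` in place `i`. The components of larger
      -- index vanish by hypothesis and those of smaller index lie in `R` by induction.
      have h1 : (Pi.single i v : ∀ i, V i) = y - ∑ j ∈ Finset.univ.erase i, Pi.single j (y j) := by
        rw [eq_sub_iff_add_eq, ← hyi, Finset.add_sum_erase _ (fun j => Pi.single j (y j))
          (Finset.mem_univ i), Finset.univ_sum_single]
      rw [h1]
      refine R.sub_mem hy (R.sum_mem fun j hj => ?_)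
      rcases lt_trichotomy (r j) (r i) with h2 | h2 | h2
      · exact ih j h2 _
      · exact absurd (hr h2) (Finset.ne_of_mem_erase hj)
      · rw [hyj j h2, Pi.single_zero]
        exact R.zero_mem
  rw [eq_top_iff]
  intro y _
  rw [← Finset.univ_sum_single y]
  exact R.sum_mem fun i _ => key i _

/-- After identifying the two modules, this is the injectivity of surjective endomorphisms of a
finite module. -/
theorem LinearMap.bijective_of_surjective_of_finrank_eq {𝕜 M N : Type*} [CommRing 𝕜]
    [Nontrivial 𝕜] [AddCommGroup M] [AddCommGroup N] [Module 𝕜 M] [Module 𝕜 N]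
    [Module.Free 𝕜 M] [Module.Finite 𝕜 M] [Module.Free 𝕜 N] [Module.Finite 𝕜 N] (f : M →ₗ[𝕜] N)
    (hf : Function.Surjective f) (h : Module.finrank 𝕜 M = Module.finrank 𝕜 N) :
    Function.Bijective f := by
  let e : N ≃ₗ[𝕜] M := LinearEquiv.ofFinrankEq N M h.symm
  have h1 := OrzechProperty.injective_of_surjective_endomorphism (e.toLinearMap ∘ₗ f)
    (e.surjective.comp hf)
  exact ⟨Function.Injective.of_comp (f := e) h1, hf⟩

theorem finrank_le_of_surjective {K M N : Type*} [Field K] [AddCommGroup M] [AddCommGroup N]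
    [Module K M] [Module K N] [Module.Finite K M] (f : M →ₗ[K] N)
    (hf : Function.Surjective f) : Module.finrank K N ≤ Module.finrank K M := by
  rw [← finrank_top K N, ← LinearMap.range_eq_top.2 hf]
  exact f.finrank_range_le

namespace YoungDiagram

open Equiv

variable (𝕜 : Type*) [CommRing 𝕜] (lam : YoungDiagram) {A B : Type*} [Fintype A] [DecidableEq A]
  [Fintype B] [DecidableEq B]

variable (A) in
/-- The Specht module over `𝕜`, with entries in `A`. -/
abbrev SpechtBase := 𝕜 ⊗[ℤ] lam.spechtOf A

variable (A) in
/-- The action of permutations of the entries on the Specht module over `𝕜`. -/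
def actBase : Representation 𝕜 (Perm A) (lam.SpechtBase 𝕜 A) where
  toFun w := (lam.spechtRepOf A w).baseChange 𝕜
  map_one' := by
    rw [map_one]
    exact LinearMap.baseChange_id
  map_mul' v w := by
    rw [map_mul]
    exact LinearMap.baseChange_comp _ _

theorem actBase_def (w : Perm A) : lam.actBase 𝕜 A w = (lam.spechtRepOf A w).baseChange 𝕜 := rfl

theorem span_poly : Submodule.span 𝕜
    (Set.range fun t : lam.Filling A => (1 : 𝕜) ⊗ₜ[ℤ] t.poly) = ⊤ := by
  have h : Submodule.span ℤ (Set.range fun t : lam.Filling A => t.poly) = ⊤ := by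
    have h1 : Submodule.map (lam.spechtOf A).subtype
        (Submodule.span ℤ (Set.range fun t : lam.Filling A => t.poly)) = lam.spechtOf A := by
      rw [Submodule.map_span, ← Set.range_comp]
      rfl
    refine Submodule.map_injective_of_injective (lam.spechtOf A).injective_subtype ?_
    rw [h1, Submodule.map_subtype_top]
  have h2 := Submodule.baseChange_span (R := ℤ) (A := 𝕜) (Set.range fun t : lam.Filling A => t.poly)
  rw [h, Submodule.baseChange_top, ← Set.range_comp] at h2
  exact h2.symm

/-- The restriction maps to the Specht modules of all diagrams with one node less. -/
def resBase (e : Option A ≃ B) : lam.SpechtBase 𝕜 B →ₗ[𝕜]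
    ∀ μ : {μ : YoungDiagram // μ.Arrow lam}, μ.1.SpechtBase 𝕜 A :=
  LinearMap.pi fun μ => (resMap μ.2 e).baseChange 𝕜

theorem resBase_apply (e : Option A ≃ B) (v : lam.SpechtBase 𝕜 B)
    (μ : {μ : YoungDiagram // μ.Arrow lam}) :
    lam.resBase 𝕜 e v μ = (resMap μ.2 e).baseChange 𝕜 v := rfl

theorem baseChange_comp_act {μ : YoungDiagram} (f : lam.spechtOf B →ₗ[ℤ] μ.spechtOf A)
    {σ : Perm B} {τ : Perm A} (h : f ∘ₗ lam.spechtRepOf B σ = μ.spechtRepOf A τ ∘ₗ f)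
    (v : lam.SpechtBase 𝕜 B) :
    f.baseChange 𝕜 (lam.actBase 𝕜 B σ v) = μ.actBase 𝕜 A τ (f.baseChange 𝕜 v) := by
  have h1 := congrArg (LinearMap.baseChange 𝕜) h
  rw [LinearMap.baseChange_comp, LinearMap.baseChange_comp] at h1
  exact LinearMap.congr_fun h1 v

theorem resBase_act (e : Option A ≃ B) (σ : Perm A) (v : lam.SpechtBase 𝕜 B)
    (μ : {μ : YoungDiagram // μ.Arrow lam}) :
    lam.resBase 𝕜 e (lam.actBase 𝕜 B (extendPerm e σ) v) μ =
      μ.1.actBase 𝕜 A σ (lam.resBase 𝕜 e v μ) :=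
  baseChange_comp_act 𝕜 lam _ (resMap_act μ.2 e σ) v

/-- By triangularity it suffices to treat polytabloids. The polytabloid of the extended tableau,
divided by the invertible hook scalar, maps to the given one in its own component and to 0 in the
components of lower removed nodes. -/
theorem resBase_surjective (e : Option A ≃ B) (hA : IsUnit ((Fintype.card A).factorial : 𝕜)) :
    Function.Surjective (lam.resBase 𝕜 e) := by
  rw [← LinearMap.range_eq_top]
  refine Submodule.eq_top_of_triangular
    (fun μ : {μ : YoungDiagram // μ.Arrow lam} => Arrow.row μ.2)
    (fun μ μ' h => Subtype.ext (Arrow.eq_of_row_eq_down μ.2 μ'.2 h)) _ _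
    (fun μ => span_poly 𝕜 μ.1) ?_
  rintro ⟨μ, h⟩ _ ⟨t, rfl⟩
  obtain ⟨c, hc⟩ := (isUnit_hookScalar (𝕜 := 𝕜) t hA).exists_left_inv
  refine ⟨_, LinearMap.mem_range_self _ (c ⊗ₜ (t.extend h e).poly), ?_, ?_⟩
  · rw [resBase_apply, LinearMap.baseChange_tmul, resMap_poly, TensorProduct.tmul_smul,
      TensorProduct.smul_tmul', zsmul_eq_mul, mul_comm, hc]
  · rintro ⟨μ', h'⟩ hr
    rw [resBase_apply, LinearMap.baseChange_tmul, resMap_poly_of_lt h h' e t hr, TensorProduct.tmul_zero]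

/-- The maps `indMap` to the Specht modules of all diagrams with one node more. -/
def upBase (e : Option A ≃ B) : lam.SpechtBase 𝕜 A →ₗ[𝕜]
    ∀ μ : {μ : YoungDiagram // lam.Arrow μ}, μ.1.SpechtBase 𝕜 B :=
  LinearMap.pi fun μ => (indMap μ.2 e).baseChange 𝕜

variable (B) in
/-- The permutation action on the product of the Specht modules of all diagrams with one node
more. -/
def upAct : Representation 𝕜 (Perm B)
    (∀ μ : {μ : YoungDiagram // lam.Arrow μ}, μ.1.SpechtBase 𝕜 B) where
  toFun σ := LinearMap.pi fun μ => μ.1.actBase 𝕜 B σ ∘ₗ LinearMap.proj μ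
  map_one' := by
    refine LinearMap.ext fun y => funext fun μ => ?_
    change μ.1.actBase 𝕜 B 1 (y μ) = y μ
    rw [map_one]
    rfl
  map_mul' σ τ := by
    refine LinearMap.ext fun y => funext fun μ => ?_
    change μ.1.actBase 𝕜 B (σ * τ) (y μ) = μ.1.actBase 𝕜 B σ (μ.1.actBase 𝕜 B τ (y μ))
    rw [map_mul]
    rfl

theorem upAct_apply (σ : Perm B)
    (y : ∀ μ : {μ : YoungDiagram // lam.Arrow μ}, μ.1.SpechtBase 𝕜 B)
    (μ : {μ : YoungDiagram // lam.Arrow μ}) :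
    lam.upAct 𝕜 B σ y μ = μ.1.actBase 𝕜 B σ (y μ) := rfl

theorem upBase_act (e : Option A ≃ B) (σ : Perm A) (v : lam.SpechtBase 𝕜 A) :
    lam.upBase 𝕜 e (lam.actBase 𝕜 A σ v) =
      lam.upAct 𝕜 B (extendPerm e σ) (lam.upBase 𝕜 e v) :=
  funext fun μ => baseChange_comp_act 𝕜 lam _ (indMap_act μ.2 e σ) v

/-- The map from the induced module, whose elements are families indexed by the cosets, to the
product of the Specht modules of all diagrams with one node more. -/
def indBase (e : Option A ≃ B) : (B → lam.SpechtBase 𝕜 A) →ₗ[𝕜]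
    ∀ μ : {μ : YoungDiagram // lam.Arrow μ}, μ.1.SpechtBase 𝕜 B :=
  ∑ b : B, lam.upAct 𝕜 B (swap b (e none)) ∘ₗ lam.upBase 𝕜 e ∘ₗ LinearMap.proj b

theorem indBase_single (e : Option A ≃ B) (b : B) (v : lam.SpechtBase 𝕜 A) :
    lam.indBase 𝕜 e (Pi.single b v) =
      lam.upAct 𝕜 B (swap b (e none)) (lam.upBase 𝕜 e v) := by
  rw [indBase, LinearMap.sum_apply, Finset.sum_eq_single_of_mem b (Finset.mem_univ b)]
  · simp
  · intro b' _ hb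
    simp [Pi.single_eq_of_ne hb]

/-- The transpositions of `b` and `e none` represent the cosets of the stabilizer of `e none`. This
is why `B` indexes the induced module. -/
theorem exists_eq_swap_mul (e : Option A ≃ B) (σ : Perm B) :
    ∃ τ, σ = swap (σ (e none)) (e none) * extendPerm e τ := by
  obtain ⟨τ, hτ⟩ := exists_extendPerm e
    (π := swap (σ (e none)) (e none) * σ) (by simp)
  exact ⟨τ, by rw [hτ, ← mul_assoc, swap_mul_self, one_mul]⟩

theorem upAct_upBase (e : Option A ≃ B) (σ : Perm B) (v : lam.SpechtBase 𝕜 A) :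
    ∃ τ : Perm A, σ = swap (σ (e none)) (e none) * extendPerm e τ ∧
      lam.upAct 𝕜 B σ (lam.upBase 𝕜 e v) =
        lam.indBase 𝕜 e (Pi.single (σ (e none)) (lam.actBase 𝕜 A τ v)) := by
  obtain ⟨τ, hτ⟩ := exists_eq_swap_mul e σ
  refine ⟨τ, hτ, ?_⟩
  rw [indBase_single, upBase_act]
  conv_lhs => rw [hτ, map_mul]
  rfl

/-- The source of `indBase` carries no group action here; multiplying a coset representative by a
permutation gives another representative times an element of the stabilizer, which `upBase_act`
absorbs. Invariance of the range is all that surjectivity needs. -/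
theorem upAct_mem_range (e : Option A ≃ B) (σ : Perm B) {y}
    (hy : y ∈ LinearMap.range (lam.indBase 𝕜 e)) :
    lam.upAct 𝕜 B σ y ∈ LinearMap.range (lam.indBase 𝕜 e) := by
  obtain ⟨w, rfl⟩ := hy
  rw [← Finset.univ_sum_single w, map_sum, map_sum]
  refine Submodule.sum_mem _ fun b _ => ?_
  rw [indBase_single]
  obtain ⟨τ, -, h⟩ := lam.upAct_upBase 𝕜 e (σ * swap b (e none)) (w b)
  rw [map_mul] at h
  exact ⟨_, h.symm⟩

theorem baseChange_colOp {μ : YoungDiagram} (t : lam.Filling A) (v : μ.SpechtBase 𝕜 A) :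
    (colOp t μ).baseChange 𝕜 v =
      ∑ π ∈ t.colStab, (Perm.sign π : ℤ) • μ.actBase 𝕜 A π v := by
  induction v using TensorProduct.induction_on with
  | zero => simp
  | add x y hx hy => simp only [map_add, hx, hy, smul_add, Finset.sum_add_distrib]
  | tmul a x =>
    simp only [actBase_def, LinearMap.baseChange_tmul, colOp, LinearMap.sum_apply,
      LinearMap.smul_apply, TensorProduct.tmul_sum, TensorProduct.tmul_smul]

/-- Applying the column sum of an extended tableau to the image of a polytabloid isolates one
component: it gives a unit multiple of a polytabloid there (`colOp_indMap`) and 0 wherever the node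
is added in a higher row (`colOp_eq_zero`). -/
theorem indBase_surjective (e : Option A ≃ B) (hB : IsUnit ((Fintype.card B).factorial : 𝕜))
    (hA : Fintype.card A = lam.card) : Function.Surjective (lam.indBase 𝕜 e) := by
  rw [← LinearMap.range_eq_top]
  refine Submodule.eq_top_of_triangular
    -- Components with smaller row vanish, opposite to the situation for restriction; hence the
    -- reversed order.
    (fun μ : {μ : YoungDiagram // lam.Arrow μ} => OrderDual.toDual (Arrow.row μ.2))
    (fun μ μ' h => Subtype.ext (Arrow.eq_of_row_eq_up μ.2 μ'.2 (OrderDual.toDual.injective h))) _ _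
    (fun μ => span_poly 𝕜 μ.1) ?_
  rintro ⟨μ, h⟩ _ ⟨u, rfl⟩
  obtain ⟨t⟩ : Nonempty (lam.Filling A) := Fintype.card_eq.1 (by
    rw [hA, Fintype.card_coe])
  have hA' : IsUnit ((t.colStab.card : ℕ) : 𝕜) := by
    have hc : Fintype.card A ≤ Fintype.card B := by
      rw [← Fintype.card_congr e, Fintype.card_option]
      omega
    exact isUnit_of_dvd_unit (Nat.cast_dvd_cast
      (t.card_colStab_dvd.trans (Nat.factorial_dvd_factorial hc))) hB
  have hu : IsUnit ((t.colStab.card * μ.hookScalar B : ℤ) : 𝕜) := by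
    rw [Int.cast_mul, Int.cast_natCast]
    exact hA'.mul (isUnit_hookScalar (t.extend h e) hB)
  obtain ⟨c, hc⟩ := hu.exists_left_inv
  let y := ∑ π ∈ (t.extend h e).colStab,
    (Perm.sign π : ℤ) • lam.upAct 𝕜 B π (lam.upBase 𝕜 e (c ⊗ₜ t.poly))
  have hy : y ∈ LinearMap.range (lam.indBase 𝕜 e) := by
    refine Submodule.sum_mem _ fun π _ => zsmul_mem (upAct_mem_range 𝕜 lam e π ?_) _
    obtain ⟨τ, -, hτ⟩ := lam.upAct_upBase 𝕜 e 1 (c ⊗ₜ t.poly)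
    rw [map_one] at hτ
    exact ⟨_, hτ.symm⟩
  have hy' : ∀ μ', y μ' = (colOp (t.extend h e) μ'.1).baseChange 𝕜
      ((indMap μ'.2 e).baseChange 𝕜 (c ⊗ₜ t.poly)) := by
    intro μ'
    rw [baseChange_colOp]
    simp only [y, Finset.sum_apply, Pi.smul_apply, upAct_apply]
    rfl
  -- One tableau `t` suffices, since a permutation of the entries carries its extension to the
  -- prescribed tableau `u`.
  refine ⟨lam.upAct 𝕜 B ((t.extend h e).symm.trans u) y, upAct_mem_range 𝕜 lam e _ hy, ?_, ?_⟩
  · have h1 : μ.spechtRepOf B ((t.extend h e).symm.trans u) (t.extend h e).poly = u.poly := by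
      refine Subtype.ext ?_
      rw [coe_spechtRepOf, Filling.poly, Filling.permAct_polytabloid]
      congr 1
      ext a
      simp
    rw [upAct_apply, hy', LinearMap.baseChange_tmul, LinearMap.baseChange_tmul, colOp_indMap,
      TensorProduct.tmul_smul, TensorProduct.smul_tmul', zsmul_eq_mul, mul_comm, hc, actBase_def,
      LinearMap.baseChange_tmul, h1]
  · rintro ⟨μ', h'⟩ hr
    rw [upAct_apply, hy', colOp_eq_zero h h' e t (OrderDual.toDual_lt_toDual.1 hr),
      LinearMap.baseChange_zero, LinearMap.zero_apply, map_zero]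

instance : Module.Finite ℤ (lam.spechtOf A) :=
  Module.Finite.span_of_finite ℤ (Set.finite_range _)

instance : Module.Free ℤ (lam.spechtOf A) :=
  Module.free_of_finite_type_torsion_free'

/-- The rank of the Specht module. -/
def spechtRank : ℕ := Module.finrank ℤ (lam.spechtOf (Fin lam.card))

variable {lam}

theorem spechtRank_eq {k : ℕ} (h : lam.card = k) :
    lam.spechtRank = Module.finrank ℤ (lam.spechtOf (Fin k)) := by
  subst h
  rfl

theorem finrank_down [Nontrivial 𝕜] {k : ℕ} (h : lam.card = k + 1) :
    Module.finrank 𝕜 (∀ μ : {μ : YoungDiagram // μ.Arrow lam}, μ.1.SpechtBase 𝕜 (Fin k)) =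
      ∑ μ : {μ : YoungDiagram // μ.Arrow lam}, μ.1.spechtRank := by
  rw [Module.finrank_pi_fintype]
  refine Finset.sum_congr rfl fun μ _ => ?_
  rw [Module.finrank_baseChange, spechtRank_eq]
  have := Arrow.card_eq μ.2
  omega

theorem finrank_up [Nontrivial 𝕜] {k : ℕ} (h : lam.card = k) :
    Module.finrank 𝕜 (∀ μ : {μ : YoungDiagram // lam.Arrow μ}, μ.1.SpechtBase 𝕜 (Fin (k + 1))) =
      ∑ μ : {μ : YoungDiagram // lam.Arrow μ}, μ.1.spechtRank := by
  rw [Module.finrank_pi_fintype]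
  refine Finset.sum_congr rfl fun μ _ => ?_
  rw [Module.finrank_baseChange, spechtRank_eq]
  have := Arrow.card_eq μ.2
  omega

theorem finrank_ind [Nontrivial 𝕜] {k : ℕ} (h : lam.card = k) :
    Module.finrank 𝕜 (Fin (k + 1) → lam.SpechtBase 𝕜 (Fin k)) = (k + 1) * lam.spechtRank := by
  rw [Module.finrank_pi_fintype, Finset.sum_const, Finset.card_univ, Fintype.card_fin,
    Module.finrank_baseChange, spechtRank_eq h, smul_eq_mul]

/-- The ranks belong to free ℤ-modules, so they may be compared over ℚ, where all factorials are
invertible; nothing is assumed about 𝕜. -/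
theorem sum_down_le {k : ℕ} (h : lam.card = k + 1) :
    ∑ μ : {μ : YoungDiagram // μ.Arrow lam}, μ.1.spechtRank ≤ lam.spechtRank := by
  rw [← finrank_down ℚ h, spechtRank_eq h, ← Module.finrank_baseChange (R := ℚ) (S := ℤ)]
  refine finrank_le_of_surjective (lam.resBase ℚ finSuccEquivLast.symm)
    (lam.resBase_surjective ℚ _ ?_)
  simpa using Nat.factorial_ne_zero _

theorem sum_up_le : ∑ μ : {μ : YoungDiagram // lam.Arrow μ}, μ.1.spechtRank ≤
    (lam.card + 1) * lam.spechtRank := by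
  rw [← finrank_up ℚ rfl, ← finrank_ind ℚ rfl]
  refine finrank_le_of_surjective (lam.indBase ℚ finSuccEquivLast.symm)
    (lam.indBase_surjective ℚ _ ?_ (by simp))
  simpa using Nat.factorial_ne_zero _

/-- Write f for the rank and k for the size of `lam`. By induction, going down and then up from
`lam` yields k f(lam), so by `sum_up_down` going up and then down yields (k + 1) f(lam). This is at
most the sum of f over the diagrams above `lam`, by `sum_down_le`, and that sum is at most (k + 1)
f(lam), by `sum_up_le`. All inequalities are therefore equalities, term by term. -/
theorem sum_up_and_sum_down (k : ℕ) :
    (∀ lam : YoungDiagram, lam.card = k →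
      ∑ μ : {μ : YoungDiagram // lam.Arrow μ}, μ.1.spechtRank = (k + 1) * lam.spechtRank) ∧
    ∀ lam : YoungDiagram, lam.card = k + 1 →
      ∑ μ : {μ : YoungDiagram // μ.Arrow lam}, μ.1.spechtRank = lam.spechtRank := by
  have key : ∀ lam : YoungDiagram, lam.card = k →
      ∑ ν : {ν : YoungDiagram // ν.Arrow lam}, ∑ μ : {μ : YoungDiagram // ν.1.Arrow μ},
        μ.1.spechtRank = k * lam.spechtRank →
      ∑ μ : {μ : YoungDiagram // lam.Arrow μ}, μ.1.spechtRank = (k + 1) * lam.spechtRank ∧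
      ∀ μ : {μ : YoungDiagram // lam.Arrow μ},
        ∑ ν : {ν : YoungDiagram // ν.Arrow μ.1}, ν.1.spechtRank = μ.1.spechtRank := by
    intro lam hlam h
    have h1 := sum_up_down spechtRank lam
    rw [h, ← Nat.succ_mul] at h1
    have h2 := sum_up_le (lam := lam)
    rw [hlam] at h2
    have h3 : ∀ μ ∈ (Finset.univ : Finset {μ : YoungDiagram // lam.Arrow μ}),
        ∑ ν : {ν : YoungDiagram // ν.Arrow μ.1}, ν.1.spechtRank ≤ μ.1.spechtRank :=
      fun μ _ => sum_down_le (Arrow.card_eq μ.2)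
    have h4 := Finset.sum_le_sum h3
    have h5 := le_antisymm h2 (h1 ▸ h4)
    refine ⟨h5, fun μ => ?_⟩
    exact (Finset.sum_eq_sum_iff_of_le h3).1 (h1.trans h5.symm) μ (Finset.mem_univ μ)
  have key' : (∀ lam : YoungDiagram, lam.card = k →
      ∑ ν : {ν : YoungDiagram // ν.Arrow lam}, ∑ μ : {μ : YoungDiagram // ν.1.Arrow μ},
        μ.1.spechtRank = k * lam.spechtRank) → (∀ lam : YoungDiagram, lam.card = k →
      ∑ μ : {μ : YoungDiagram // lam.Arrow μ}, μ.1.spechtRank = (k + 1) * lam.spechtRank) ∧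
    ∀ lam : YoungDiagram, lam.card = k + 1 →
      ∑ μ : {μ : YoungDiagram // μ.Arrow lam}, μ.1.spechtRank = lam.spechtRank := by
    refine fun h => ⟨fun lam hlam => (key lam hlam (h lam hlam)).1, fun lam hlam => ?_⟩
    -- The downward identity for a diagram of size k + 1 is read off from the squeeze at any diagram
    -- below it.
    obtain ⟨μ, hμ⟩ := exists_down (lam := lam) (by omega)
    have hc : μ.card = k := by
      have := hμ.card_eq
      omega
    exact (key μ hc (h μ hc)).2 ⟨lam, hμ⟩
  refine key' ?_
  intro lam hlam
  rcases k with _ | k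
  · rw [zero_mul]
    refine Finset.sum_eq_zero fun ν _ => ?_
    have := Arrow.card_eq ν.2
    omega
  · obtain ⟨h1, h2⟩ := sum_up_and_sum_down k
    have h3 : ∀ ν : {ν : YoungDiagram // ν.Arrow lam}, ∑ μ : {μ : YoungDiagram // ν.1.Arrow μ},
        μ.1.spechtRank = (k + 1) * ν.1.spechtRank := by
      intro ν
      have := Arrow.card_eq ν.2
      exact h1 _ (by omega)
    rw [Finset.sum_congr rfl fun ν _ => h3 ν, ← Finset.mul_sum, h2 lam hlam]

theorem resBase_bijective {k : ℕ} (hk : lam.card = k + 1) (e : Option (Fin k) ≃ Fin (k + 1))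
    (h : IsUnit (k.factorial : 𝕜)) : Function.Bijective (lam.resBase 𝕜 e) := by
  have hs : Function.Surjective (lam.resBase 𝕜 e) :=
    lam.resBase_surjective 𝕜 e (by rwa [Fintype.card_fin])
  rcases subsingleton_or_nontrivial 𝕜 with h1 | h1
  · have := Module.subsingleton 𝕜 (lam.SpechtBase 𝕜 (Fin (k + 1)))
    exact ⟨Function.injective_of_subsingleton _, hs⟩
  · refine LinearMap.bijective_of_surjective_of_finrank_eq _ hs ?_
    rw [finrank_down 𝕜 hk, Module.finrank_baseChange, ← spechtRank_eq hk,
      (sum_up_and_sum_down k).2 lam hk]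

theorem indBase_bijective {k : ℕ} (hk : lam.card = k) (e : Option (Fin k) ≃ Fin (k + 1))
    (h : IsUnit ((k + 1).factorial : 𝕜)) : Function.Bijective (lam.indBase 𝕜 e) := by
  have hs : Function.Surjective (lam.indBase 𝕜 e) :=
    lam.indBase_surjective 𝕜 e (by rwa [Fintype.card_fin]) (by rw [hk, Fintype.card_fin])
  rcases subsingleton_or_nontrivial 𝕜 with h1 | h1
  · have := Module.subsingleton 𝕜 (Fin (k + 1) → lam.SpechtBase 𝕜 (Fin k))
    exact ⟨Function.injective_of_subsingleton _, hs⟩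
  · refine LinearMap.bijective_of_surjective_of_finrank_eq _ hs ?_
    rw [finrank_up 𝕜 hk, finrank_ind 𝕜 hk, (sum_up_and_sum_down k).1 lam hk]

end YoungDiagram

end

/-! ### Matchings with free right-hand vertices; bending, isolated points and lines. -/

set_option linter.unusedSectionVars false

namespace Matching

variable {X Y : Type*}

/-- Renaming the points of a matching along a bijection. -/
def mapEquiv (E : X ≃ Y) (m : Matching X) : Matching Y where
  partner p := E (m.partner (E.symm p))
  invol p := by simp [m.invol _]

@[simp]
theorem mapEquiv_partner (E : X ≃ Y) (m : Matching X) (p : X) :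
    (mapEquiv E m).partner (E p) = E (m.partner p) := by
  simp [mapEquiv]

theorem mapEquiv_eq {E : X ≃ Y} {m : Matching X} {m' : Matching Y}
    (h : ∀ p, m'.partner (E p) = E (m.partner p)) : m' = mapEquiv E m := by
  ext1
  funext p
  obtain ⟨p, rfl⟩ := E.surjective p
  rw [h, mapEquiv_partner]

theorem mapEquiv_symm_mapEquiv (E : X ≃ Y) (m : Matching X) :
    mapEquiv E.symm (mapEquiv E m) = m := by
  ext1
  funext p
  simp [mapEquiv]

theorem mapEquiv_mapEquiv_symm (E : X ≃ Y) (m : Matching Y) :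
    mapEquiv E (mapEquiv E.symm m) = m := by
  ext1
  funext p
  simp [mapEquiv]

end Matching

namespace Diagram

open Matching

variable {n : ℕ} {K K' A B : Type*} [DecidableEq K] [DecidableEq K'] [DecidableEq A] [DecidableEq B]

/-- The juxtaposition of a diagram and a matching with right-hand vertices in `K`. -/
def juxt (d : Diagram n) (x : Matching (Fin n ⊕ K)) :
    Matching ((Fin n ⊕ Fin n) ⊕ (Fin n ⊕ K)) where
  partner := Sum.map d.partner x.partner
  invol := by
    rintro (p | p)
    · simp [d.invol p]
    · simp [x.invol p]

variable (n K) in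
/-- The pairs of points that are identified in a juxtaposition. -/
def seam : List (((Fin n ⊕ Fin n) ⊕ (Fin n ⊕ K)) × ((Fin n ⊕ Fin n) ⊕ (Fin n ⊕ K))) :=
  (List.finRange n).map fun i => (Sum.inl (Sum.inr i), Sum.inr (Sum.inl i))

theorem mem_seam {q : ((Fin n ⊕ Fin n) ⊕ (Fin n ⊕ K)) × ((Fin n ⊕ Fin n) ⊕ (Fin n ⊕ K))} :
    q ∈ seam n K ↔ ∃ i, (Sum.inl (Sum.inr i), Sum.inr (Sum.inl i)) = q := by
  simp [seam]

/-- The result of gluing `d` and `x` along the seam, with the numbers of loops and open strings. -/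
def glue (d : Diagram n) (x : Matching (Fin n ⊕ K)) :
    Matching ((Fin n ⊕ Fin n) ⊕ (Fin n ⊕ K)) × ℕ × ℕ :=
  (juxt d x).contract (seam n K)

/-- The exterior vertices of a juxtaposition. -/
def outer : Fin n ⊕ K → (Fin n ⊕ Fin n) ⊕ (Fin n ⊕ K) := Sum.map Sum.inl Sum.inr

theorem outer_injective : Function.Injective (outer (n := n) (K := K)) :=
  Function.Injective.sumMap Sum.inl_injective Sum.inr_injective

theorem glue_outer (d : Diagram n) (x : Matching (Fin n ⊕ K)) (p : Fin n ⊕ K) :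
    ∃ q, outer q = (glue d x).1.partner (outer p) := by
  have key : ∀ i, (glue d x).1.partner (outer p) ≠ Sum.inl (Sum.inr i) ∧
      (glue d x).1.partner (outer p) ≠ Sum.inr (Sum.inl i) := by
    intro i
    have hd := Matching.contract_dead (seam n K) (juxt d x)
      (q := (Sum.inl (Sum.inr i), Sum.inr (Sum.inl i))) (mem_seam.2 ⟨i, rfl⟩)
    have hi := (glue d x).1.invol (outer p)
    constructor
    · intro h
      rw [h] at hi
      have := hd.1.symm.trans hi
      rcases p with p | p <;> simp [outer] at this
    · intro h
      rw [h] at hi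
      have := hd.2.symm.trans hi
      rcases p with p | p <;> simp [outer] at this
  rcases h : (glue d x).1.partner (outer p) with (i | i) | (i | i)
  · exact ⟨Sum.inl i, rfl⟩
  · exact absurd h (key i).1
  · exact absurd h (key i).2
  · exact ⟨Sum.inr i, rfl⟩

/-- The inverse of `outer`; the value `p` on the seam does not matter. -/
def toOuter (p : Fin n ⊕ K) : (Fin n ⊕ Fin n) ⊕ (Fin n ⊕ K) → Fin n ⊕ K
  | Sum.inl (Sum.inl i) => Sum.inl i
  | Sum.inr (Sum.inr i) => Sum.inr i
  | _ => p

theorem outer_toOuter (d : Diagram n) (x : Matching (Fin n ⊕ K)) (p : Fin n ⊕ K) :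
    outer (toOuter p ((glue d x).1.partner (outer p))) = (glue d x).1.partner (outer p) := by
  obtain ⟨q, hq⟩ := glue_outer d x p
  rw [← hq]
  rcases q with q | q <;> rfl

/-- The action of diagrams on matchings with right-hand vertices in `K`. -/
def act (d : Diagram n) (x : Matching (Fin n ⊕ K)) : Matching (Fin n ⊕ K) where
  partner p := toOuter p ((glue d x).1.partner (outer p))
  invol p := outer_injective (by
    rw [outer_toOuter, outer_toOuter, (glue d x).1.invol])

theorem outer_act (d : Diagram n) (x : Matching (Fin n ⊕ K)) (p : Fin n ⊕ K) :
    outer ((act d x).partner p) = (glue d x).1.partner (outer p) :=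
  outer_toOuter d x p

theorem comp_eq_act (d x : Diagram n) : comp d x = act d x := by
  ext1
  funext p
  apply outer_injective
  rw [outer_act]
  exact exterior_comp d x p

/-- Gluing takes place on the left-hand vertices only, so an injective renaming of the right-hand
ones commutes with it. The matching `x'` may have further right-hand vertices outside the image. -/
theorem act_map {ε : K → K'} (hε : Function.Injective ε) (d : Diagram n)
    {x : Matching (Fin n ⊕ K)} {x' : Matching (Fin n ⊕ K')}
    (h : ∀ p, x'.partner (Sum.map id ε p) = Sum.map id ε (x.partner p)) :
    (∀ p, (act d x').partner (Sum.map id ε p) = Sum.map id ε ((act d x).partner p)) ∧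
      (glue d x').2 = (glue d x).2 := by
  let F : (Fin n ⊕ Fin n) ⊕ (Fin n ⊕ K) → (Fin n ⊕ Fin n) ⊕ (Fin n ⊕ K') :=
    Sum.map id (Sum.map id ε)
  have hF : Function.Injective F := Function.Injective.sumMap Function.injective_id
    (Function.Injective.sumMap Function.injective_id hε)
  have h1 := contract_map hF (seam n K) (m := juxt d x) (m' := juxt d x')
    (by rintro (p | p) <;> simp [juxt, F, h])
  have hl : (seam n K).map (Prod.map F F) = seam n K' := by
    simp [seam, F, Function.comp_def]
  rw [hl] at h1
  refine ⟨fun p => ?_, h1.2⟩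
  apply outer_injective
  have hx : ∀ q : Fin n ⊕ K, outer (Sum.map id ε q) = F (outer q) := by
    rintro (q | q) <;> simp [outer, F]
  rw [outer_act, hx, hx, outer_act]
  exact h1.1 (outer p)

theorem act_inr (d : Diagram n) {x : Matching (Fin n ⊕ K)} {r s : K}
    (h : x.partner (Sum.inr r) = Sum.inr s) : (act d x).partner (Sum.inr r) = Sum.inr s := by
  apply outer_injective
  rw [outer_act, glue, contract_of_ne]
  · simp [outer, juxt, h]
  · intro q hq
    obtain ⟨i, rfl⟩ := mem_seam.1 hq
    simp [outer, juxt, h]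

/-- The bijection that turns the right-hand vertex `e none` into the last left-hand vertex. -/
def bendEquiv (n : ℕ) (e : Option A ≃ B) : Fin n ⊕ B ≃ Fin (n + 1) ⊕ A where
  toFun := Sum.elim (fun i => Sum.inl i.castSucc)
    (fun b => (e.symm b).elim (Sum.inl (Fin.last n)) Sum.inr)
  invFun := Sum.elim (Fin.lastCases (Sum.inr (e none)) Sum.inl) (fun a => Sum.inr (e (some a)))
  left_inv := by
    rintro (i | b)
    · simp
    · obtain ⟨b, rfl⟩ := e.surjective b
      rcases b with _ | a <;> simp
  right_inv := by
    rintro (i | a)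
    · induction i using Fin.lastCases <;> simp
    · simp

section Bend

variable (e : Option A ≃ B)

@[simp]
theorem bendEquiv_inl (i : Fin n) : bendEquiv n e (Sum.inl i) = Sum.inl i.castSucc := rfl

@[simp]
theorem bendEquiv_none : bendEquiv n e (Sum.inr (e none)) = Sum.inl (Fin.last n) := by
  simp [bendEquiv]

@[simp]
theorem bendEquiv_some (a : A) : bendEquiv n e (Sum.inr (e (some a))) = Sum.inr a := by
  simp [bendEquiv]

/-- Bending a right-hand vertex to the left is compatible with the action of diagrams. -/
theorem act_bend (d : Diagram n) (x : Matching (Fin n ⊕ B)) :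
    act (addStrand d) (mapEquiv (bendEquiv n e) x) = mapEquiv (bendEquiv n e) (act d x) ∧
      (glue (addStrand d) (mapEquiv (bendEquiv n e) x)).2 = (glue d x).2 := by
  set E := bendEquiv n e with hE
  let F : (Fin n ⊕ Fin n) ⊕ (Fin n ⊕ B) →
      (Fin (n + 1) ⊕ Fin (n + 1)) ⊕ (Fin (n + 1) ⊕ A) :=
    Sum.map (Sum.map Fin.castSucc Fin.castSucc) E
  have hF : Function.Injective F := Function.Injective.sumMap
    (Function.Injective.sumMap (Fin.castSucc_injective n) (Fin.castSucc_injective n)) E.injective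
  obtain ⟨h1, h2⟩ := contract_map hF (seam n B) (m := juxt d x)
    (m' := juxt (addStrand d) (mapEquiv E x))
    (by rintro (p | p) <;> simp [juxt, F, addStrand_castSucc])
  have hl : seam (n + 1) A = (seam n B).map (Prod.map F F) ++
      [(Sum.inl (Sum.inr (Fin.last n)), Sum.inr (Sum.inl (Fin.last n)))] := by
    simp [seam, List.finRange_succ_last, F, E, Function.comp_def]
  have hg : glue (addStrand d) (mapEquiv E x) =
      (juxt (addStrand d) (mapEquiv E x)).contract ((seam n B).map (Prod.map F F) ++
      [(Sum.inl (Sum.inr (Fin.last n)), Sum.inr (Sum.inl (Fin.last n)))]) := by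
    rw [glue, hl]
  rw [contract_append] at hg
  set t := (juxt (addStrand d) (mapEquiv E x)).contract ((seam n B).map (Prod.map F F)) with ht
  -- The strand {n, n'} of `addStrand d` is untouched until the last pair of the seam is glued; by
  -- `join_straight` that gluing merely moves the last left-hand vertex of the bent matching to the
  -- outside.
  have hlast : t.1.partner (Sum.inl (Sum.inr (Fin.last n))) = Sum.inl (Sum.inl (Fin.last n)) := by
    rw [ht, contract_of_ne]
    · simp [juxt, addStrand_inr_last]
    · intro q hq
      obtain ⟨q', hq', rfl⟩ := List.mem_map.1 hq
      obtain ⟨i, rfl⟩ := mem_seam.1 hq'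
      have h3 := (Fin.castSucc_lt_last i).ne'
      simp [juxt, addStrand_inr_last, F, E, h3]
  have h3 := join_straight h1 hlast (y := Sum.inr (Sum.inl (Fin.last n))) (by simp)
    (by
      rintro ((i | i) | p) <;> simp [F, (Fin.castSucc_lt_last _).ne])
    (by
      rintro ((i | i) | p) <;> simp [F, (Fin.castSucc_lt_last _).ne])
  have hx : ∀ q : Fin n ⊕ B, Equiv.swap (Sum.inr (Sum.inl (Fin.last n)))
      (Sum.inl (Sum.inl (Fin.last n))) (F (outer q)) = outer (E q) := by
    rintro (i | b)
    · have h4 := (Fin.castSucc_lt_last i).ne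
      simp [F, E, outer, Equiv.swap_apply_def, h4]
    · obtain ⟨b, rfl⟩ := e.surjective b
      rcases b with _ | a <;> simp [F, E, outer, Equiv.swap_apply_def]
  constructor
  · refine mapEquiv_eq fun p => outer_injective ?_
    rw [outer_act, ← hx, ← hx, outer_act, hg]
    exact h3 (outer p)
  · rw [hg, glue, ← h2]
    simp [contract, joinLoops, joinStrings, hlast]

end Bend

/-- All right-hand vertices belong to propagating lines. -/
def Propagating (x : Matching (Fin n ⊕ K)) : Prop := ∀ k, (x.partner (Sum.inr k)).isLeft

/-- The right action by permutations of the right-hand vertices. -/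
def permute (x : Matching (Fin n ⊕ K)) (w : Equiv.Perm K) : Matching (Fin n ⊕ K) :=
  mapEquiv (Equiv.sumCongr (Equiv.refl _) w⁻¹) x

theorem permute_partner (x : Matching (Fin n ⊕ K)) (w : Equiv.Perm K) (p : Fin n ⊕ K) :
    (permute x w).partner (Sum.map id ⇑w⁻¹ p) = Sum.map id ⇑w⁻¹ (x.partner p) :=
  mapEquiv_partner (Equiv.sumCongr (Equiv.refl _) w⁻¹) x p

theorem eq_permute {x x' : Matching (Fin n ⊕ K)} {w : Equiv.Perm K}
    (h : ∀ p, x'.partner (Sum.map id ⇑w⁻¹ p) = Sum.map id ⇑w⁻¹ (x.partner p)) :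
    x' = permute x w :=
  mapEquiv_eq h

theorem permute_one (x : Matching (Fin n ⊕ K)) : permute x 1 = x := by
  refine (eq_permute fun p => ?_).symm
  simp

theorem permute_permute (x : Matching (Fin n ⊕ K)) (v w : Equiv.Perm K) :
    permute (permute x v) w = permute x (v * w) := by
  refine eq_permute fun p => ?_
  have h : ∀ p : Fin n ⊕ K, Sum.map id ⇑(v * w)⁻¹ p = Sum.map id ⇑w⁻¹ (Sum.map id ⇑v⁻¹ p) := by
    rintro (p | p) <;> simp
  rw [h, h, permute_partner, permute_partner]

theorem propagating_permute {x : Matching (Fin n ⊕ K)} (w : Equiv.Perm K) :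
    Propagating (permute x w) ↔ Propagating x := by
  have key : ∀ (x : Matching (Fin n ⊕ K)) (w : Equiv.Perm K), Propagating x →
      Propagating (permute x w) := by
    intro x w h k
    have h1 := permute_partner x w (Sum.inr (w k))
    rw [Sum.map_inr, Equiv.Perm.inv_def, Equiv.symm_apply_apply] at h1
    rw [h1]
    have h2 := h (w k)
    rcases h3 : x.partner (Sum.inr (w k)) with i | i
    · simp
    · simp [h3] at h2
  refine ⟨fun h => ?_, key x w⟩
  have := key _ w⁻¹ h
  rwa [permute_permute, mul_inv_cancel, permute_one] at this

/-- Parts on the right-hand side persist under the action, so non-propagating matchings are never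
made propagating. This is what allows them to be set to zero. -/
theorem propagating_of_act {d : Diagram n} {x : Matching (Fin n ⊕ K)} (h : Propagating (act d x)) :
    Propagating x := by
  intro k
  rcases h1 : x.partner (Sum.inr k) with i | i
  · rfl
  · have := h k
    rw [act_inr d h1] at this
    exact this

/-- Adding an isolated last left-hand vertex. -/
def addPoint (x : Matching (Fin n ⊕ A)) : Matching (Fin (n + 1) ⊕ A) where
  partner := Sum.elim
    (Fin.lastCases (Sum.inl (Fin.last n)) fun i => Sum.map Fin.castSucc id (x.partner (Sum.inl i)))
    (fun a => Sum.map Fin.castSucc id (x.partner (Sum.inr a)))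
  invol := by
    rintro (p | p)
    · induction p using Fin.lastCases with
      | last => simp
      | cast i =>
        have key := x.invol (Sum.inl i)
        rcases h : x.partner (Sum.inl i) with j | j <;> rw [h] at key <;> simp [h, key]
    · have key := x.invol (Sum.inr p)
      rcases h : x.partner (Sum.inr p) with j | j <;> rw [h] at key <;> simp [h, key]

theorem addPoint_partner (x : Matching (Fin n ⊕ A)) (p : Fin n ⊕ A) :
    (addPoint x).partner (Sum.map Fin.castSucc id p) = Sum.map Fin.castSucc id (x.partner p) := by
  rcases p with p | p <;> simp [addPoint]

theorem addPoint_last (x : Matching (Fin n ⊕ A)) :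
    (addPoint x).partner (Sum.inl (Fin.last n)) = Sum.inl (Fin.last n) := by
  simp [addPoint]

theorem castSucc_map_ne {C : Type*} (f : A → C) (p : Fin n ⊕ A) :
    Sum.map Fin.castSucc f p ≠ Sum.inl (Fin.last n) := by
  rcases p with p | p <;> simp [(Fin.castSucc_lt_last _).ne]

theorem eq_addPoint {x : Matching (Fin n ⊕ A)} {y : Matching (Fin (n + 1) ⊕ A)}
    (h : ∀ p, y.partner (Sum.map Fin.castSucc id p) = Sum.map Fin.castSucc id (x.partner p)) :
    y = addPoint x := by
  have hp : ∀ q : Fin (n + 1) ⊕ A, q = Sum.inl (Fin.last n) ∨ ∃ p, q = Sum.map Fin.castSucc id p := by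
    rintro (i | a)
    · induction i using Fin.lastCases with
      | last => exact Or.inl rfl
      | cast i => exact Or.inr ⟨Sum.inl i, rfl⟩
    · exact Or.inr ⟨Sum.inr a, rfl⟩
  ext1
  funext q
  rcases hp q with rfl | ⟨p, rfl⟩
  · rw [addPoint_last]
    rcases hp (y.partner (Sum.inl (Fin.last n))) with h1 | ⟨p, h1⟩
    · exact h1
    · have h2 := y.invol (Sum.inl (Fin.last n))
      rw [h1, h] at h2
      exact absurd h2 (castSucc_map_ne _ _)
  · rw [h, addPoint_partner]

theorem addPoint_injective : Function.Injective (addPoint (n := n) (A := A)) := by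
  intro x x' h
  ext1
  funext p
  have h1 := addPoint_partner x p
  rw [h, addPoint_partner] at h1
  exact (Function.Injective.sumMap (Fin.castSucc_injective n) Function.injective_id h1).symm

theorem bendEquiv_refl_some (p : Fin n ⊕ A) :
    bendEquiv n (Equiv.refl (Option A)) (Sum.map id some p) = Sum.map Fin.castSucc id p := by
  rcases p with p | p <;> rfl

/-- Unbending turns the isolated last vertex into the additional right-hand vertex `none`. So
`act_bend` reduces the claim to `act_map` for the inclusion `some`. -/
theorem act_addPoint (d : Diagram n) (x : Matching (Fin n ⊕ A)) :
    act (addStrand d) (addPoint x) = addPoint (act d x) ∧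
      (glue (addStrand d) (addPoint x)).2 = (glue d x).2 := by
  set E := bendEquiv n (Equiv.refl (Option A)) with hE
  have h1 := act_bend (Equiv.refl (Option A)) d (mapEquiv E.symm (addPoint x))
  rw [mapEquiv_mapEquiv_symm] at h1
  have h2 := act_map (Option.some_injective A) d (x := x) (x' := mapEquiv E.symm (addPoint x))
    (fun p => by
      apply E.injective
      rw [← mapEquiv_partner, mapEquiv_mapEquiv_symm, bendEquiv_refl_some, bendEquiv_refl_some,
        addPoint_partner])
  refine ⟨eq_addPoint fun p => ?_, h1.2.trans h2.2⟩
  rw [h1.1, ← bendEquiv_refl_some, mapEquiv_partner, h2.1, bendEquiv_refl_some]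

theorem propagating_addPoint {x : Matching (Fin n ⊕ A)} :
    Propagating (addPoint x) ↔ Propagating x := by
  refine forall_congr' fun a => ?_
  have := addPoint_partner x (Sum.inr a)
  rw [Sum.map_inr, id] at this
  rw [this]
  rcases x.partner (Sum.inr a) with i | i <;> simp

theorem addPoint_permute (x : Matching (Fin n ⊕ A)) (w : Equiv.Perm A) :
    addPoint (permute x w) = permute (addPoint x) w := by
  refine (eq_addPoint fun p => ?_).symm
  obtain ⟨p, rfl⟩ : ∃ q, p = Sum.map id ⇑w⁻¹ q :=
    ⟨Sum.map id ⇑w p, by rcases p with p | p <;> simp⟩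
  have h : ∀ q : Fin n ⊕ A, Sum.map Fin.castSucc id (Sum.map id ⇑w⁻¹ q) =
      Sum.map id ⇑w⁻¹ (Sum.map Fin.castSucc id q) := by
    rintro (q | q) <;> rfl
  rw [h, permute_partner, addPoint_partner, permute_partner, h]

/-- Adding a last left-hand vertex that is joined to the additional right-hand vertex `e none`. -/
def addLine (e : Option A ≃ B) (x : Matching (Fin n ⊕ A)) : Matching (Fin (n + 1) ⊕ B) where
  partner := Sum.elim
    (Fin.lastCases (Sum.inr (e none)) fun i =>
      Sum.map Fin.castSucc (fun a => e (some a)) (x.partner (Sum.inl i)))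
    (fun b => (e.symm b).elim (Sum.inl (Fin.last n))
      fun a => Sum.map Fin.castSucc (fun a => e (some a)) (x.partner (Sum.inr a)))
  invol := by
    rintro (p | p)
    · induction p using Fin.lastCases with
      | last => simp
      | cast i =>
        have key := x.invol (Sum.inl i)
        rcases h : x.partner (Sum.inl i) with j | j <;> rw [h] at key <;> simp [h, key]
    · obtain ⟨p, rfl⟩ := e.surjective p
      rcases p with _ | p
      · simp
      · have key := x.invol (Sum.inr p)
        rcases h : x.partner (Sum.inr p) with j | j <;> rw [h] at key <;> simp [h, key]

section Line

variable (e : Option A ≃ B)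

theorem addLine_partner (x : Matching (Fin n ⊕ A)) (p : Fin n ⊕ A) :
    (addLine e x).partner (Sum.map Fin.castSucc (fun a => e (some a)) p) =
      Sum.map Fin.castSucc (fun a => e (some a)) (x.partner p) := by
  rcases p with p | p <;> simp [addLine]

theorem addLine_last (x : Matching (Fin n ⊕ A)) :
    (addLine e x).partner (Sum.inl (Fin.last n)) = Sum.inr (e none) := by
  simp [addLine]

theorem addLine_none (x : Matching (Fin n ⊕ A)) :
    (addLine e x).partner (Sum.inr (e none)) = Sum.inl (Fin.last n) := by
  simp [addLine]

theorem castSucc_some_injective :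
    Function.Injective (Sum.map (Fin.castSucc (n := n)) fun a => e (some a)) :=
  Function.Injective.sumMap (Fin.castSucc_injective n)
    (e.injective.comp (Option.some_injective A))

theorem eq_addLine {x : Matching (Fin n ⊕ A)} {y : Matching (Fin (n + 1) ⊕ B)}
    (h : ∀ p, y.partner (Sum.map Fin.castSucc (fun a => e (some a)) p) =
      Sum.map Fin.castSucc (fun a => e (some a)) (x.partner p))
    (h' : y.partner (Sum.inl (Fin.last n)) = Sum.inr (e none)) : y = addLine e x := by
  ext1
  funext q
  rcases q with i | b
  · induction i using Fin.lastCases with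
    | last => rw [h', addLine_last]
    | cast i => exact (h (Sum.inl i)).trans (addLine_partner e x (Sum.inl i)).symm
  · obtain ⟨b, rfl⟩ := e.surjective b
    rcases b with _ | a
    · rw [addLine_none, ← h', y.invol]
    · exact (h (Sum.inr a)).trans (addLine_partner e x (Sum.inr a)).symm

theorem addLine_injective : Function.Injective (addLine (n := n) e) := by
  intro x x' h
  ext1
  funext p
  have h1 := addLine_partner e x p
  rw [h, addLine_partner] at h1
  exact (castSucc_some_injective e h1).symm

/-- Unbending turns the last propagating line into a part joining the right-hand vertices `none` and
`some (e none)`. The action preserves such a part by `act_inr`, and `act_map` describes the rest. -/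
theorem act_addLine (d : Diagram n) (x : Matching (Fin n ⊕ A)) :
    act (addStrand d) (addLine e x) = addLine e (act d x) ∧
      (glue (addStrand d) (addLine e x)).2 = (glue d x).2 := by
  set E := bendEquiv n (Equiv.refl (Option B)) with hE
  have h1 := act_bend (Equiv.refl (Option B)) d (mapEquiv E.symm (addLine e x))
  rw [mapEquiv_mapEquiv_symm] at h1
  have hEx : ∀ p : Fin n ⊕ A, E (Sum.map id (fun a => some (e (some a))) p) =
      Sum.map Fin.castSucc (fun a => e (some a)) p := by
    rintro (p | p) <;> rfl
  have h2 := act_map (ε := fun a => some (e (some a)))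
    ((Option.some_injective B).comp (e.injective.comp (Option.some_injective A))) d (x := x)
    (x' := mapEquiv E.symm (addLine e x))
    (fun p => by
      apply E.injective
      rw [← mapEquiv_partner, mapEquiv_mapEquiv_symm, hEx, hEx, addLine_partner])
  refine ⟨eq_addLine e (fun p => ?_) ?_, h1.2.trans h2.2⟩
  · rw [h1.1, ← hEx, mapEquiv_partner, h2.1, hEx]
  · have h3 : (Sum.inl (Fin.last n) : Fin (n + 1) ⊕ B) = E (Sum.inr none) := rfl
    have h4 : (mapEquiv E.symm (addLine e x)).partner (Sum.inr none) =
        Sum.inr (some (e none)) := by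
      apply E.injective
      rw [← mapEquiv_partner, mapEquiv_mapEquiv_symm, ← h3, addLine_last]
      rfl
    rw [h1.1, h3, mapEquiv_partner, act_inr d h4]
    rfl

theorem propagating_addLine {x : Matching (Fin n ⊕ A)} :
    Propagating (addLine e x) ↔ Propagating x := by
  rw [Propagating, YoungDiagram.forall_option_equiv e, addLine_none]
  simp only [Sum.isLeft_inl, true_and]
  refine forall_congr' fun a => ?_
  have := addLine_partner e x (Sum.inr a)
  rw [Sum.map_inr] at this
  rw [this]
  rcases x.partner (Sum.inr a) with i | i <;> simp

theorem addLine_permute (x : Matching (Fin n ⊕ A)) (w : Equiv.Perm A) :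
    addLine e (permute x w) = permute (addLine e x) (YoungDiagram.extendPerm e w) := by
  refine (eq_addLine e (fun p => ?_) ?_).symm
  · obtain ⟨p, rfl⟩ : ∃ q, p = Sum.map id ⇑w⁻¹ q :=
      ⟨Sum.map id ⇑w p, by rcases p with p | p <;> simp⟩
    have h : ∀ q : Fin n ⊕ A,
        Sum.map Fin.castSucc (fun a => e (some a)) (Sum.map id ⇑w⁻¹ q) =
          Sum.map id ⇑(YoungDiagram.extendPerm e w)⁻¹
            (Sum.map Fin.castSucc (fun a => e (some a)) q) := by
      rintro (q | q)
      · rfl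
      · simp only [Sum.map_inr, YoungDiagram.extendPerm_inv_some]
    rw [h, permute_partner, addLine_partner, permute_partner, h]
  · have h := permute_partner (addLine e x) (YoungDiagram.extendPerm e w) (Sum.inl (Fin.last n))
    rw [addLine_last, Sum.map_inr, YoungDiagram.extendPerm_inv_none] at h
    exact h

end Line

end Diagram

/-! ### Sorting matchings by the last vertex; left cells as propagating matchings. -/

noncomputable section

set_option linter.unusedSectionVars false

open scoped TensorProduct DirectSum

universe u

theorem Matching.exists_restrict {X Y : Type*} {ε : X → Y} (hε : Function.Injective ε)
    (y : Matching Y) (h : ∀ p, ∃ q, y.partner (ε p) = ε q) :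
    ∃ x : Matching X, ∀ p, y.partner (ε p) = ε (x.partner p) := by
  choose f hf using h
  refine ⟨⟨f, fun p => hε ?_⟩, hf⟩
  rw [← hf, ← hf, y.invol]

namespace Diagram

open Matching

variable {n k : ℕ} {A B : Type*} [DecidableEq A] [DecidableEq B]

theorem exists_addPoint {y : Matching (Fin (n + 1) ⊕ A)}
    (h : y.partner (Sum.inl (Fin.last n)) = Sum.inl (Fin.last n)) : ∃ x, y = addPoint x := by
  obtain ⟨x, hx⟩ := exists_restrict (ε := Sum.map Fin.castSucc id)
    (Function.Injective.sumMap (Fin.castSucc_injective n) Function.injective_id) y (fun p => by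
      rcases h1 : y.partner (Sum.map Fin.castSucc id p) with i | a
      · induction i using Fin.lastCases with
        | last =>
          have h2 := y.invol (Sum.map Fin.castSucc id p)
          rw [h1, h] at h2
          exact absurd h2.symm (castSucc_map_ne _ _)
        | cast i => exact ⟨Sum.inl i, rfl⟩
      · exact ⟨Sum.inr a, rfl⟩)
  exact ⟨x, eq_addPoint hx⟩

theorem exists_addLine (e : Option A ≃ B) {y : Matching (Fin (n + 1) ⊕ B)}
    (h : y.partner (Sum.inl (Fin.last n)) = Sum.inr (e none)) : ∃ x, y = addLine e x := by
  have h' : y.partner (Sum.inr (e none)) = Sum.inl (Fin.last n) := by rw [← h, y.invol]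
  obtain ⟨x, hx⟩ := exists_restrict (castSucc_some_injective e) y (fun p => by
      have h2 := y.invol (Sum.map Fin.castSucc (fun a => e (some a)) p)
      rcases h1 : y.partner (Sum.map Fin.castSucc (fun a => e (some a)) p) with i | a
      · induction i using Fin.lastCases with
        | last =>
          rw [h1, h] at h2
          rcases p with p | p <;> simp at h2
        | cast i => exact ⟨Sum.inl i, rfl⟩
      · obtain ⟨a, rfl⟩ := e.surjective a
        rcases a with _ | a
        · rw [h1, h'] at h2
          exact absurd h2.symm (castSucc_map_ne _ _)
        · exact ⟨Sum.inr a, rfl⟩)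
  exact ⟨x, eq_addLine e hx h⟩

/-- A transposition moves the right-hand end of the line to the normalized position `e none`. -/
theorem exists_permute_addLine (e : Option A ≃ B) {y : Matching (Fin (n + 1) ⊕ B)} {b : B}
    (h : y.partner (Sum.inl (Fin.last n)) = Sum.inr b) :
    ∃ x w, y = permute (addLine e x) w := by
  have h1 := permute_partner y (Equiv.swap b (e none)) (Sum.inl (Fin.last n))
  rw [h] at h1
  obtain ⟨x, hx⟩ := exists_addLine e (y := permute y (Equiv.swap b (e none))) (by
    simpa using h1)
  refine ⟨x, Equiv.swap b (e none), ?_⟩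
  rw [← hx, permute_permute, Equiv.swap_mul_self, permute_one]

/-- Different right-hand vertices have different left-hand partners. -/
theorem card_le_of_propagating {x : Matching (Fin n ⊕ Fin k)} (h : Propagating x) : k ≤ n := by
  have h1 : ∀ i, ∃ j, x.partner (Sum.inr i) = Sum.inl j := fun i => Sum.isLeft_iff.1 (h i)
  choose f hf using h1
  have hinj : Function.Injective f := by
    intro i j hij
    have h2 : x.partner (Sum.inr i) = x.partner (Sum.inr j) := by rw [hf, hf, hij]
    exact Sum.inr_injective (x.invol.injective h2)
  simpa using Fintype.card_le_of_injective f hinj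

section Fill

variable (c : Diagram n) (hc : c.propEnds.card = k)

/-- The `i`-th right-hand end of a propagating line. -/
def propEnd (i : Fin k) : Fin n := c.propEnds.orderIsoOfFin hc i

theorem propEnd_injective : Function.Injective (propEnd c hc) :=
  Subtype.val_injective.comp (c.propEnds.orderIsoOfFin hc).injective

theorem propEnd_mem (i : Fin k) : propEnd c hc i ∈ c.propEnds := (c.propEnds.orderIsoOfFin hc i).2

theorem exists_propEnd {s : Fin n} (hs : s ∈ c.propEnds) : ∃ i, propEnd c hc i = s :=
  ⟨(c.propEnds.orderIsoOfFin hc).symm ⟨s, hs⟩, by simp [propEnd]⟩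

theorem endPerm_propEnd (w : Equiv.Perm (Fin k)) (i : Fin k) :
    endPerm c k w (propEnd c hc i) = propEnd c hc (w i) := by
  rw [endPerm, dif_pos hc]
  exact Equiv.Perm.extendDomain_apply_image w (c.propEnds.orderIsoOfFin hc).toEquiv i

theorem orderIsoOfFin_symm_propEnd (i : Fin k) :
    (c.propEnds.orderIsoOfFin hc).symm ⟨propEnd c hc i, propEnd_mem c hc i⟩ = i :=
  OrderIso.symm_apply_apply _ _

/-- The diagram whose parts are those of `x`, with right-hand vertices numbered by the ends of
propagating lines of `c`, and the parts of `c` on the right-hand side. -/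
def fill (x : Matching (Fin n ⊕ Fin k)) : Diagram n where
  partner := Sum.elim (fun i => Sum.map id (propEnd c hc) (x.partner (Sum.inl i)))
    (fun s => if hs : s ∈ c.propEnds then Sum.map id (propEnd c hc)
      (x.partner (Sum.inr ((c.propEnds.orderIsoOfFin hc).symm ⟨s, hs⟩))) else c.partner (Sum.inr s))
  invol := by
    have key : ∀ p : Fin n ⊕ Fin k, Sum.elim
        (fun i => Sum.map id (propEnd c hc) (x.partner (Sum.inl i)))
        (fun s => if hs : s ∈ c.propEnds then Sum.map id (propEnd c hc)
          (x.partner (Sum.inr ((c.propEnds.orderIsoOfFin hc).symm ⟨s, hs⟩)))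
            else c.partner (Sum.inr s)) (Sum.map id (propEnd c hc) p) =
        Sum.map id (propEnd c hc) (x.partner p) := by
      rintro (p | p)
      · rfl
      · simp only [Sum.map_inr, Sum.elim_inr]
        rw [dif_pos (propEnd_mem c hc p), orderIsoOfFin_symm_propEnd]
    rintro (i | s)
    · rw [Sum.elim_inl, key, x.invol]
      rfl
    · by_cases hs : s ∈ c.propEnds
      · rw [Sum.elim_inr, dif_pos hs, key, x.invol]
        simp [propEnd]
      · rw [Sum.elim_inr, dif_neg hs]
        have h1 := hs
        rw [mem_propEnds, not_forall] at h1
        obtain ⟨s', hs'⟩ := h1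
        rw [not_not] at hs'
        have h2 := c.invol (Sum.inr s)
        rw [hs'] at h2
        rw [hs', Sum.elim_inr, dif_neg, h2]
        rw [mem_propEnds]
        exact fun h => h s h2

theorem fill_partner (x : Matching (Fin n ⊕ Fin k)) (p : Fin n ⊕ Fin k) :
    (fill c hc x).partner (Sum.map id (propEnd c hc) p) =
      Sum.map id (propEnd c hc) (x.partner p) := by
  rcases p with p | p
  · rfl
  · simp only [fill, Sum.map_inr, Sum.elim_inr]
    rw [dif_pos (propEnd_mem c hc p), orderIsoOfFin_symm_propEnd]

theorem fill_of_notMem (x : Matching (Fin n ⊕ Fin k)) {s : Fin n} (hs : s ∉ c.propEnds) :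
    (fill c hc x).partner (Sum.inr s) = c.partner (Sum.inr s) := by
  simp only [fill, Sum.elim_inr]
  rw [dif_neg hs]

theorem eq_fill {x : Matching (Fin n ⊕ Fin k)} {y : Diagram n}
    (h : ∀ p, y.partner (Sum.map id (propEnd c hc) p) = Sum.map id (propEnd c hc) (x.partner p))
    (h' : ∀ s ∉ c.propEnds, y.partner (Sum.inr s) = c.partner (Sum.inr s)) :
    y = fill c hc x := by
  ext1
  funext q
  rcases q with i | s
  · exact (h (Sum.inl i)).trans (fill_partner c hc x (Sum.inl i)).symm
  · by_cases hs : s ∈ c.propEnds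
    · obtain ⟨i, rfl⟩ := exists_propEnd c hc hs
      exact (h (Sum.inr i)).trans (fill_partner c hc x (Sum.inr i)).symm
    · rw [h' s hs, fill_of_notMem c hc x hs]

theorem fill_injective : Function.Injective (fill c hc) := by
  intro x x' h
  ext1
  funext p
  have h1 := fill_partner c hc x p
  rw [h, fill_partner] at h1
  exact (Function.Injective.sumMap Function.injective_id (propEnd_injective c hc) h1).symm

/-- Apply `act_map` to the numbering of the ends; the parts of `c` on the right-hand side survive by
`act_inr`. With `relabel_fill` and `inCell_fill` this replaces the cell of `c` by propagating
matchings, independent of `c`. -/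
theorem comp_fill (d : Diagram n) (x : Matching (Fin n ⊕ Fin k)) :
    comp d (fill c hc x) = fill c hc (act d x) ∧
      (straighten d (fill c hc x)).2 = (glue d x).2 := by
  have h := act_map (propEnd_injective c hc) d (fill_partner c hc x)
  refine ⟨?_, h.2⟩
  rw [comp_eq_act]
  refine eq_fill c hc h.1 fun s hs => ?_
  have h1 := hs
  rw [mem_propEnds, not_forall] at h1
  obtain ⟨s', hs'⟩ := h1
  rw [not_not] at hs'
  rw [hs']
  exact act_inr d ((fill_of_notMem c hc x hs).trans hs')

theorem relabel_fill (w : Equiv.Perm (Fin k)) (x : Matching (Fin n ⊕ Fin k)) :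
    relabel (endPerm c k w⁻¹) (fill c hc x) = fill c hc (permute x w) := by
  refine eq_fill c hc (fun p => ?_) fun s hs => ?_
  · obtain ⟨p, rfl⟩ : ∃ q, p = Sum.map id ⇑w⁻¹ q :=
      ⟨Sum.map id ⇑w p, by rcases p with p | p <;> simp⟩
    have h : ∀ q : Fin n ⊕ Fin k, Sum.map id (propEnd c hc) (Sum.map id ⇑w⁻¹ q) =
        Sum.map id ⇑(endPerm c k w⁻¹) (Sum.map id (propEnd c hc) q) := by
      rintro (q | q)
      · rfl
      · simp only [Sum.map_inr, endPerm_propEnd]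
    rw [h, relabel_apply, fill_partner, permute_partner, h]
  · have h := relabel_apply (endPerm c k w⁻¹) (fill c hc x) (Sum.inr s)
    rw [Sum.map_inr, endPerm_of_notMem c k _ hs, fill_of_notMem c hc x hs] at h
    rw [h]
    rw [mem_propEnds, not_forall] at hs
    obtain ⟨s', hs'⟩ := hs
    rw [not_not] at hs'
    have h2 : s' ∉ c.propEnds := by
      have h2 := c.invol (Sum.inr s)
      rw [hs'] at h2
      rw [mem_propEnds]
      exact fun h => h s h2
    rw [hs', Sum.map_inr, endPerm_of_notMem c k _ h2]

theorem inCell_fill {x : Matching (Fin n ⊕ Fin k)} :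
    InCell c k (fill c hc x) ↔ Propagating x := by
  constructor
  · intro h i
    have h1 := fill_partner c hc x (Sum.inr i)
    rcases h2 : x.partner (Sum.inr i) with j | j
    · rfl
    · rw [h2] at h1
      exact absurd ((h.1 _ _).1 h1) (mem_propEnds.1 (propEnd_mem c hc i) _)
  · intro h
    have h1 : LeftRel (fill c hc x) c := by
      intro r s
      by_cases hr : r ∈ c.propEnds
      · have h2 := mem_propEnds.1 hr s
        obtain ⟨i, rfl⟩ := exists_propEnd c hc hr
        have h3 := fill_partner c hc x (Sum.inr i)
        obtain ⟨j, hj⟩ := Sum.isLeft_iff.1 (h i)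
        rw [hj, Sum.map_inr, Sum.map_inl] at h3
        rw [h3]
        simpa using h2
      · rw [fill_of_notMem c hc x hr]
    refine ⟨h1, ?_⟩
    rw [propNumber, h1.propEnds_eq, hc]

theorem exists_fill {y : Diagram n} (h : InCell c k y) : ∃ x, y = fill c hc x := by
  have hy := h.1.propEnds_eq
  obtain ⟨x, hx⟩ := exists_restrict (ε := Sum.map id (propEnd c hc))
    (Function.Injective.sumMap Function.injective_id (propEnd_injective c hc)) y (fun p => by
      rcases h1 : y.partner (Sum.map id (propEnd c hc) p) with i | s
      · exact ⟨Sum.inl i, rfl⟩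
      · have h2 := y.invol (Sum.map id (propEnd c hc) p)
        rw [h1] at h2
        rcases p with p | p
        · have hs : s ∈ c.propEnds := by
            rw [← hy, mem_propEnds]
            intro s' hs'
            rw [hs'] at h2
            simp at h2
          obtain ⟨i, rfl⟩ := exists_propEnd c hc hs
          exact ⟨Sum.inr i, rfl⟩
        · exact absurd h1 (mem_propEnds.1 (hy ▸ propEnd_mem c hc p) s))
  refine ⟨x, eq_fill c hc hx fun s hs => ?_⟩
  rw [mem_propEnds, not_forall] at hs
  obtain ⟨s', hs'⟩ := hs
  rw [not_not] at hs'
  rw [hs', (h.1 s s').2 hs']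

end Fill

end Diagram

/-! ### Presentations of modules by matchings and vectors. -/

section Model

open Diagram

variable {𝕜 : Type u} [CommRing 𝕜] (δ δ' : 𝕜)

/-- The scalar `δ ^ (number of loops) * δ' ^ (number of open strings)` of the product of a diagram
and a matching. -/
def actCoef {n : ℕ} {K : Type*} [DecidableEq K] (d : Diagram n) (x : Matching (Fin n ⊕ K)) : 𝕜 :=
  δ ^ (glue d x).2.1 * δ' ^ (glue d x).2.2

/-- A presentation of a module over the partial Brauer algebra by symbols `tens x v`, where `x` is
a matching with right-hand vertices in `K`, all of them propagating, and `v` is an element of a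
representation of the permutations of `K`. -/
structure DeltaModel (n : ℕ) {K : Type} [DecidableEq K] {V : Type u} [AddCommGroup V] [Module 𝕜 V]
    (ρ : Representation 𝕜 (Equiv.Perm K) V) (D : Type u) [AddCommGroup D]
    [Module (PartialBrauer δ δ' n) D] where
  tens : Matching (Fin n ⊕ K) → V →+ D
  -- Symbols of non-propagating matchings are allowed and vanish, so the action needs no case
  -- distinction.
  tens_eq_zero : ∀ x, ¬ Propagating x → tens x = 0
  tens_permute : ∀ x w v, tens (permute x w) v = tens x (ρ w v)
  smul_tens : ∀ a d x v, (a • PartialBrauer.of δ δ' d) • tens x v =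
    tens (act d x) ((a * actCoef δ δ' d x) • v)
  closure_eq : AddSubgroup.closure {z | ∃ x v, z = tens x v} = ⊤
  -- The universal property is stated for additive maps, since the retractions and sections built
  -- from it need not be linear over the algebra. Scalars are absorbed in `V`.
  exists_lift : ∀ (N : Type u) [AddCommGroup N] (φ : Matching (Fin n ⊕ K) → V →+ N),
    (∀ x w v, Propagating x → φ (permute x w) v = φ x (ρ w v)) →
      ∃ L : D →+ N, ∀ x, Propagating x → ∀ v, L (tens x v) = φ x v

namespace DeltaModel

variable {δ δ'} {n : ℕ} {K : Type} [DecidableEq K] {V : Type u} [AddCommGroup V] [Module 𝕜 V]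
  {ρ : Representation 𝕜 (Equiv.Perm K) V} {D : Type u} [AddCommGroup D]
  [Module (PartialBrauer δ δ' n) D] (M : DeltaModel δ δ' n ρ D)

theorem induction {P : D → Prop} (z : D) (h0 : P 0) (hadd : ∀ x y, P x → P y → P (x + y))
    (hneg : ∀ x, P x → P (-x)) (ht : ∀ x v, Propagating x → P (M.tens x v)) : P z := by
  have h : z ∈ AddSubgroup.closure {z | ∃ x v, z = M.tens x v} := by
    rw [M.closure_eq]
    trivial
  induction h using AddSubgroup.closure_induction with
  | mem z hz =>
    obtain ⟨x, v, rfl⟩ := hz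
    by_cases hx : Propagating x
    · exact ht x v hx
    · rw [M.tens_eq_zero x hx]
      exact h0
  | zero => exact h0
  | add x y _ _ hx hy => exact hadd x y hx hy
  | neg x _ hx => exact hneg x hx

theorem hom_ext {N : Type*} [AddCommGroup N] {f g : D →+ N}
    (h : ∀ x v, Propagating x → f (M.tens x v) = g (M.tens x v)) : f = g := by
  ext z
  refine M.induction (P := fun z => f z = g z) z (by simp) (fun x y hx hy => ?_)
    (fun x hx => ?_) h
  · rw [map_add, map_add, hx, hy]
  · rw [map_neg, map_neg, hx]

/-- The additive lift is compatible with the elements a • d on generators, and these elements span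
the algebra additively. -/
theorem exists_linear_lift {N : Type u} [AddCommGroup N] [Module (PartialBrauer δ δ' n) N]
    (φ : Matching (Fin n ⊕ K) → V →+ N) (h0 : ∀ x, ¬ Propagating x → φ x = 0)
    (hp : ∀ x w v, φ (permute x w) v = φ x (ρ w v))
    (hs : ∀ a d x v, (a • PartialBrauer.of δ δ' d) • φ x v =
      φ (act d x) ((a * actCoef δ δ' d x) • v)) :
    ∃ L : D →ₗ[PartialBrauer δ δ' n] N, ∀ x v, L (M.tens x v) = φ x v := by
  obtain ⟨L, hL⟩ := M.exists_lift N φ fun x w v _ => hp x w v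
  have hL' : ∀ x v, L (M.tens x v) = φ x v := by
    intro x v
    by_cases hx : Propagating x
    · exact hL x hx v
    · rw [M.tens_eq_zero x hx, h0 x hx, AddMonoidHom.zero_apply, AddMonoidHom.zero_apply, map_zero]
  refine ⟨{ L with map_smul' := fun a z => ?_ }, hL'⟩
  change L (a • z) = a • L z
  induction a using PartialBrauer.induction with
  | h0 => rw [zero_smul, zero_smul, map_zero]
  | hadd a b ha hb => rw [add_smul, add_smul, map_add, ha, hb]
  | hof a d =>
    refine M.induction (P := fun z => L ((a • PartialBrauer.of δ δ' d) • z) =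
      (a • PartialBrauer.of δ δ' d) • L z) z (by simp) (fun x y hx hy => ?_) (fun x hx => ?_)
      fun x v _ => ?_
    · rw [smul_add, map_add, map_add, smul_add, hx, hy]
    · rw [smul_neg, map_neg, map_neg, smul_neg, hx]
    · rw [M.smul_tens, hL', hL', hs]

end DeltaModel

end Model

end

/-! ### The Specht modules of the partial Brauer algebra have such presentations. -/

noncomputable section

set_option linter.unusedSectionVars false

open scoped TensorProduct DirectSum

universe u

section DeltaPresentation

open Diagram

variable {𝕜 : Type u} [CommRing 𝕜] (δ δ' : 𝕜) {n : ℕ} (c : Diagram n) (lam : YoungDiagram)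

/-- The representation on the Specht module over `𝕜` that defines `Delta`. -/
def spechtBaseRep : Representation 𝕜 (Equiv.Perm (Fin lam.card)) (𝕜 ⊗[ℤ] lam.specht) where
  toFun w := (lam.spechtRep w).baseChange 𝕜
  map_one' := by
    rw [map_one]
    exact LinearMap.baseChange_id
  map_mul' v w := by
    rw [map_mul]
    exact LinearMap.baseChange_comp _ _

theorem rightAct_of_fill {k : ℕ} (hc : c.propEnds.card = k) (w : Equiv.Perm (Fin k))
    (x : Matching (Fin n ⊕ Fin k)) :
    CellModule.rightAct δ δ' (MulOpposite.op w) (CellModule.proj δ δ' c k (fill c hc x)) =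
      CellModule.proj δ δ' c k (fill c hc (permute x w)) := by
  change CellModule.relabelHom δ δ' w⁻¹ _ = _
  rw [CellModule.relabelHom_proj, relabel_fill]

theorem of_smul_proj_fill {k : ℕ} (hc : c.propEnds.card = k) (d : Diagram n)
    (x : Matching (Fin n ⊕ Fin k)) :
    PartialBrauer.of δ δ' d • CellModule.proj δ δ' c k (fill c hc x) =
      actCoef δ δ' d x • CellModule.proj δ δ' c k (fill c hc (act d x)) := by
  by_cases hx : Propagating x
  · have h1 : CellModule.proj δ δ' c k (fill c hc x) =
        CellModule.of δ δ' ⟨fill c hc x, (inCell_fill c hc).2 hx⟩ :=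
      CellModule.proj_coe δ δ' ⟨fill c hc x, (inCell_fill c hc).2 hx⟩
    obtain ⟨h2, h3⟩ := comp_fill c hc d x
    rw [h1, CellModule.smul_def, CellModule.actHom_of, ← h2]
    congr 1
    simp only [PartialBrauer.coef, loops, strings, actCoef, h3]
  · have h1 : CellModule.proj δ δ' c k (fill c hc x) = 0 :=
      dif_neg fun h => hx ((inCell_fill c hc).1 h)
    have h2 : CellModule.proj δ δ' c k (fill c hc (act d x)) = 0 :=
      dif_neg fun h => hx (propagating_of_act ((inCell_fill c hc).1 h))
    rw [h1, h2, smul_zero, smul_zero]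

theorem CellModule.induction {k : ℕ} (hc : c.propEnds.card = k) {P : CellModule δ δ' c k → Prop}
    (X : CellModule δ δ' c k) (h0 : P 0) (hadd : ∀ X Y, P X → P Y → P (X + Y))
    (hof : ∀ (a : 𝕜) x, Propagating x → P (a • CellModule.proj δ δ' c k (fill c hc x))) : P X := by
  refine Finsupp.induction_linear (motive := P) X h0 hadd fun d a => ?_
  obtain ⟨x, hx⟩ := exists_fill c hc d.2
  have h1 : CellModule.proj δ δ' c k (fill c hc x) = CellModule.of δ δ' d := by
    rw [← hx, CellModule.proj_coe]
  have h2 : a • CellModule.of δ δ' d =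
      (Finsupp.single d a : {d : Diagram n // c.InCell k d} →₀ 𝕜) :=
    (Finsupp.smul_single a d 1).trans (by rw [smul_eq_mul, mul_one])
  have h3 := hof a x ((inCell_fill c hc).1 (hx ▸ d.2))
  rw [h1] at h3
  exact h2 ▸ h3

/-- Additive maps out of the tensor product of the cell module with a module `V`, defined on the
basis of the cell module. -/
theorem CellModule.exists_tensor_lift {k : ℕ} (hc : c.propEnds.card = k) {V N : Type*}
    [AddCommGroup V] [Module 𝕜 V] [AddCommGroup N] (φ : Matching (Fin n ⊕ Fin k) → V →+ N) :
    ∃ L : CellModule δ δ' c k ⊗[𝕜] V →+ N, ∀ (a : 𝕜) x v, Propagating x →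
      L ((a • CellModule.proj δ δ' c k (fill c hc x)) ⊗ₜ v) = φ x (a • v) := by
  classical
  let E : ({d : Diagram n // c.InCell k d} →₀ 𝕜) ⊗[𝕜] V ≃ₗ[𝕜]
      ({d : Diagram n // c.InCell k d} →₀ V) := TensorProduct.finsuppScalarLeft 𝕜 V _
  let L : CellModule δ δ' c k ⊗[𝕜] V →+ N :=
    (Finsupp.liftAddHom fun d => φ (exists_fill c hc d.2).choose).comp E.toLinearMap.toAddMonoidHom
  refine ⟨L, fun a x v hx => ?_⟩
  let d : {d : Diagram n // c.InCell k d} := ⟨fill c hc x, (inCell_fill c hc).2 hx⟩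
  have h1 : (exists_fill c hc d.2).choose = x :=
    (fill_injective c hc (exists_fill c hc d.2).choose_spec).symm
  have h2 : a • CellModule.proj δ δ' c k (fill c hc x) =
      (Finsupp.single d a : {d : Diagram n // c.InCell k d} →₀ 𝕜) := by
    rw [show CellModule.proj δ δ' c k (fill c hc x) = CellModule.of δ δ' d from
      CellModule.proj_coe δ δ' d]
    exact (Finsupp.smul_single a d 1).trans (by rw [smul_eq_mul, mul_one])
  rw [h2]
  change Finsupp.liftAddHom (fun d => φ (exists_fill c hc d.2).choose)
    (TensorProduct.finsuppScalarLeft 𝕜 V {d : Diagram n // c.InCell k d} ((Finsupp.single d a) ⊗ₜ v)) = _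
  rw [TensorProduct.finsuppScalarLeft_apply_tmul, Finsupp.sum_single_index (by simp),
    Finsupp.liftAddHom_apply_single, h1]

/-- The cell module is free on the propagating matchings, so its tensor product with `V` is a direct
sum of copies of `V`. Passing to the quotient by `balanced` imposes exactly the relation
`tens_permute`. -/
theorem nonempty_deltaModel_of_eq (hc : c.propEnds.card = lam.card) :
    Nonempty (DeltaModel δ δ' n (spechtBaseRep (𝕜 := 𝕜) lam) (Delta δ δ' c lam)) := by
  refine ⟨{
    tens := fun x =>
      { toFun := fun v => Submodule.Quotient.mk
          (CellModule.proj δ δ' c lam.card (fill c hc x) ⊗ₜ[𝕜] v)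
        map_zero' := by rw [TensorProduct.tmul_zero, Submodule.Quotient.mk_zero]
        map_add' := fun v w => by rw [TensorProduct.tmul_add, Submodule.Quotient.mk_add] }
    tens_eq_zero := ?_
    tens_permute := ?_
    smul_tens := ?_
    closure_eq := ?_
    exists_lift := ?_ }⟩
  · intro x hx
    ext v
    have h1 : CellModule.proj δ δ' c lam.card (fill c hc x) = 0 :=
      dif_neg fun h => hx ((inCell_fill c hc).1 h)
    change Submodule.Quotient.mk (CellModule.proj δ δ' c lam.card (fill c hc x) ⊗ₜ[𝕜] v) = 0
    rw [h1, TensorProduct.zero_tmul, Submodule.Quotient.mk_zero]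
  · intro x w v
    refine (Submodule.Quotient.eq _).2 (Submodule.subset_span
      ⟨CellModule.proj δ δ' c lam.card (fill c hc x), w, v, ?_⟩)
    rw [rightAct_of_fill]
    rfl
  · intro a d x v
    change (a • PartialBrauer.of δ δ' d) • Submodule.Quotient.mk _ = Submodule.Quotient.mk _
    rw [← Submodule.Quotient.mk_smul, TensorProduct.smul_tmul', smul_assoc, of_smul_proj_fill,
      smul_smul, TensorProduct.smul_tmul]
  · rw [eq_top_iff]
    intro z hz
    obtain ⟨z, rfl⟩ := Submodule.Quotient.mk_surjective _ z
    clear hz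
    induction z using TensorProduct.induction_on with
    | zero => exact zero_mem _
    | add x y hx hy => exact add_mem hx hy
    | tmul X v =>
      refine CellModule.induction δ δ' c hc (P := fun X => (Submodule.Quotient.mk (X ⊗ₜ[𝕜] v) :
        Delta δ δ' c lam) ∈ AddSubgroup.closure _) X ?_ (fun X Y hX hY => ?_) fun a x _ => ?_
      · rw [TensorProduct.zero_tmul]
        exact zero_mem _
      · rw [TensorProduct.add_tmul]
        exact add_mem hX hY
      · refine AddSubgroup.subset_closure ⟨x, a • v, ?_⟩
        rw [TensorProduct.smul_tmul]
        rfl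
  · intro N _ φ hφ
    obtain ⟨L, hL⟩ := CellModule.exists_tensor_lift δ δ' c hc φ
    have key : ∀ (X : CellModule δ δ' c lam.card) (w : Equiv.Perm (Fin lam.card))
        (b : 𝕜 ⊗[ℤ] lam.specht), L (CellModule.rightAct δ δ' (MulOpposite.op w) X ⊗ₜ[𝕜] b -
          X ⊗ₜ[𝕜] (lam.spechtRep w).baseChange 𝕜 b) = 0 := by
      intro X w b
      refine CellModule.induction δ δ' c hc (P := fun X =>
        L (CellModule.rightAct δ δ' (MulOpposite.op w) X ⊗ₜ[𝕜] b -
          X ⊗ₜ[𝕜] (lam.spechtRep w).baseChange 𝕜 b) = 0) X ?_ (fun X Y hX hY => ?_)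
          fun a x hx => ?_
      · rw [map_zero, TensorProduct.zero_tmul, TensorProduct.zero_tmul, sub_zero, map_zero]
      · rw [map_add, TensorProduct.add_tmul, TensorProduct.add_tmul, add_sub_add_comm, map_add,
          hX, hY, add_zero]
      · have h1 : CellModule.rightAct δ δ' (MulOpposite.op w)
            (a • CellModule.proj δ δ' c lam.card (fill c hc x)) =
              a • CellModule.proj δ δ' c lam.card (fill c hc (permute x w)) := by
          rw [← rightAct_of_fill]
          exact map_smul (CellModule.relabelHom δ δ' w⁻¹) a _
        rw [h1, map_sub, hL _ _ _ ((propagating_permute w).2 hx), hL _ _ _ hx, hφ x w _ hx,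
          map_smul, sub_eq_zero]
        rfl
    -- `balanced` is a span over the algebra while `L` is only additive. The right action commutes
    -- with the algebra, so multiples of the generators are again generators, and the claim is
    -- carried along for all multiples `r • z`.
    have hker : ∀ z ∈ balanced δ δ' c lam, ∀ r : PartialBrauer δ δ' n, L (r • z) = 0 := by
      intro z hz
      induction hz using Submodule.span_induction with
      | mem z hz =>
        obtain ⟨X, w, b, rfl⟩ := hz
        intro r
        rw [smul_sub, TensorProduct.smul_tmul', TensorProduct.smul_tmul', ← map_smul]
        exact key (r • X) w b
      | zero => intro r; rw [smul_zero, map_zero]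
      | add x y _ _ hx hy => intro r; rw [smul_add, map_add, hx, hy, add_zero]
      | smul a x _ hx => intro r; rw [smul_smul]; exact hx _
    refine ⟨QuotientAddGroup.lift (balanced δ δ' c lam).toAddSubgroup L fun z hz => ?_, ?_⟩
    · have := hker z hz 1
      rwa [one_smul] at this
    · intro x hx v
      change L (CellModule.proj δ δ' c lam.card (fill c hc x) ⊗ₜ[𝕜] v) = φ x v
      have := hL 1 x v hx
      rwa [one_smul, one_smul] at this

/-- For k > n the cell is empty and no matching is propagating, so both the module and the
conditions are trivial. -/
theorem nonempty_deltaModel_of_lt (hk : n < lam.card) :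
    Nonempty (DeltaModel δ δ' n (spechtBaseRep (𝕜 := 𝕜) lam) (Delta δ δ' c lam)) := by
  have hE : IsEmpty {d : Diagram n // c.InCell lam.card d} := by
    refine ⟨fun d => ?_⟩
    have h1 := d.2.2
    have h2 : propNumber d.1 ≤ n := (Finset.card_le_univ _).trans (by simp)
    omega
  have hC : Subsingleton (CellModule δ δ' c lam.card) :=
    inferInstanceAs (Subsingleton ({d : Diagram n // c.InCell lam.card d} →₀ 𝕜))
  have hD : Subsingleton (Delta δ δ' c lam) :=
    (Submodule.Quotient.mk_surjective (balanced δ δ' c lam)).subsingleton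
  have hP : ∀ x : Matching (Fin n ⊕ Fin lam.card), ¬ Propagating x := fun x hx =>
    absurd (card_le_of_propagating hx) (not_le.2 hk)
  exact ⟨{
    tens := fun _ => 0
    tens_eq_zero := fun _ _ => rfl
    tens_permute := fun _ _ _ => rfl
    smul_tens := fun _ _ _ _ => Subsingleton.elim _ _
    closure_eq := Subsingleton.elim _ _
    exists_lift := fun N _ φ _ => ⟨0, fun x hx => absurd hx (hP x)⟩ }⟩

theorem specht_eq_spechtOf : lam.specht = lam.spechtOf (Fin lam.card) := by
  have h1 : ∀ t : lam.Tableau, YoungDiagram.Tableau.polytabloid t =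
      YoungDiagram.Filling.polytabloid (A := Fin lam.card) t := by
    intro t
    refine Finset.sum_congr (Finset.ext fun π => ?_) fun π _ => rfl
    rw [YoungDiagram.Filling.mem_colStab]
    simp [YoungDiagram.Tableau.colStab, YoungDiagram.Filling.cols]
  unfold YoungDiagram.specht YoungDiagram.spechtOf
  congr 2
  funext t
  exact h1 t

/-- Transport of a presentation along an isomorphism of representations. -/
def DeltaModel.ofEquiv {δ δ' : 𝕜} {K : Type} [DecidableEq K] {V V' : Type u} [AddCommGroup V]
    [Module 𝕜 V] [AddCommGroup V'] [Module 𝕜 V'] {ρ : Representation 𝕜 (Equiv.Perm K) V}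
    {ρ' : Representation 𝕜 (Equiv.Perm K) V'} {D : Type u} [AddCommGroup D]
    [Module (PartialBrauer δ δ' n) D] (M : DeltaModel δ δ' n ρ D) (E : V ≃ₗ[𝕜] V')
    (hE : ∀ w v, E (ρ w v) = ρ' w (E v)) : DeltaModel δ δ' n ρ' D where
  tens x := (M.tens x).comp E.symm.toLinearMap.toAddMonoidHom
  tens_eq_zero x hx := by
    rw [M.tens_eq_zero x hx, AddMonoidHom.zero_comp]
  tens_permute x w v := by
    change M.tens _ (E.symm v) = M.tens _ (E.symm (ρ' w v))
    rw [M.tens_permute]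
    congr 1
    rw [LinearEquiv.eq_symm_apply, hE, E.apply_symm_apply]
  smul_tens a d x v := by
    change _ • M.tens _ (E.symm v) = M.tens _ (E.symm (_ • v))
    rw [M.smul_tens, map_smul E.symm]
  closure_eq := by
    rw [← M.closure_eq]
    congr 1
    ext z
    constructor
    · rintro ⟨x, v, rfl⟩
      exact ⟨x, E.symm v, rfl⟩
    · rintro ⟨x, v, rfl⟩
      exact ⟨x, E v, congrArg (M.tens x) (E.symm_apply_apply v).symm⟩
  exists_lift N _ φ hφ := by
    obtain ⟨L, hL⟩ := M.exists_lift N (fun x => (φ x).comp E.toLinearMap.toAddMonoidHom)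
      fun x w v hx => by
        change φ (permute x w) (E v) = φ x (E (ρ w v))
        rw [hφ x w _ hx, hE]
    refine ⟨L, fun x hx v => ?_⟩
    change L (M.tens x (E.symm v)) = _
    rw [hL x hx]
    exact congrArg (φ x) (E.apply_symm_apply v)

theorem baseChange_intertwine {P Q : Type*} [AddCommGroup P] [AddCommGroup Q] (E : P ≃ₗ[ℤ] Q)
    {f : P →ₗ[ℤ] P} {g : Q →ₗ[ℤ] Q} (h : ∀ x, E (f x) = g (E x)) (v : 𝕜 ⊗[ℤ] P) :
    E.baseChange ℤ 𝕜 _ _ (f.baseChange 𝕜 v) = g.baseChange 𝕜 (E.baseChange ℤ 𝕜 _ _ v) := by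
  induction v using TensorProduct.induction_on with
  | zero => simp only [map_zero]
  | add x y hx hy => simp only [map_add, hx, hy]
  | tmul a x =>
    rw [LinearMap.baseChange_tmul, LinearEquiv.baseChange_tmul, LinearEquiv.baseChange_tmul,
      LinearMap.baseChange_tmul, h]

/-- The presentation depends on the cell only through k, so the choice of cells is immaterial from
here on. The number k is a separate variable in order that one symmetric group acts on the Specht
modules of several shapes. -/
theorem nonempty_deltaModel {k : ℕ} (hk : lam.card = k) (hc : k ≤ n → c.propNumber = k) :
    Nonempty (DeltaModel δ δ' n (lam.actBase 𝕜 (Fin k)) (Delta δ δ' c lam)) := by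
  subst hk
  have h1 : Nonempty (DeltaModel δ δ' n (spechtBaseRep (𝕜 := 𝕜) lam) (Delta δ δ' c lam)) := by
    rcases le_or_gt lam.card n with h | h
    · exact nonempty_deltaModel_of_eq δ δ' c lam (hc h)
    · exact nonempty_deltaModel_of_lt δ δ' c lam h
  obtain ⟨M⟩ := h1
  let E : lam.specht ≃ₗ[ℤ] lam.spechtOf (Fin lam.card) :=
    LinearEquiv.ofEq _ _ (specht_eq_spechtOf lam)
  have hE : ∀ w x, E (lam.spechtRep w x) = lam.spechtRepOf (Fin lam.card) w (E x) := by
    intro w x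
    refine Subtype.ext ?_
    rw [YoungDiagram.coe_spechtRepOf, LinearEquiv.coe_ofEq_apply, LinearEquiv.coe_ofEq_apply]
    rfl
  exact ⟨M.ofEquiv (E.baseChange ℤ 𝕜 _ _) fun w v => baseChange_intertwine E (hE w) v⟩

end DeltaPresentation

end

/-! ### Restriction: bending conventions and the summand of isolated last vertices. -/

noncomputable section

set_option linter.unusedSectionVars false

open scoped TensorProduct DirectSum

universe u

section Bend

open Matching Diagram

variable {n : ℕ} {A B : Type*} [DecidableEq A] [DecidableEq B] (e : Option A ≃ B)

theorem mapEquiv_bend_permute (x : Matching (Fin n ⊕ B)) (w : Equiv.Perm A) :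
    mapEquiv (bendEquiv n e) (permute x (YoungDiagram.extendPerm e w)) =
      permute (mapEquiv (bendEquiv n e) x) w := by
  have h : ∀ p : Fin n ⊕ B,
      bendEquiv n e (Sum.map id ⇑(YoungDiagram.extendPerm e w)⁻¹ p) =
        Sum.map id ⇑w⁻¹ (bendEquiv n e p) := by
    rintro (i | b)
    · rfl
    · revert b
      rw [YoungDiagram.forall_option_equiv e]
      constructor
      · rw [Sum.map_inr, YoungDiagram.extendPerm_inv_none, bendEquiv_none, Sum.map_inl, id]
      · intro a
        rw [Sum.map_inr, YoungDiagram.extendPerm_inv_some, bendEquiv_some, bendEquiv_some,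
          Sum.map_inr]
  refine eq_permute fun p => ?_
  obtain ⟨p, rfl⟩ := (bendEquiv n e).surjective p
  rw [← h, mapEquiv_partner, permute_partner, h, mapEquiv_partner]

/-- Under bending the vertex `e none` becomes the last left-hand vertex, so its propagating line
becomes an arc on the left-hand side. If it were isolated or joined to a right-hand vertex instead,
the last vertex would be isolated or on a propagating line. -/
theorem propagating_iff_bend {x : Matching (Fin n ⊕ B)} :
    Propagating x ↔ Propagating (mapEquiv (bendEquiv n e) x) ∧
      ∃ j, (mapEquiv (bendEquiv n e) x).partner (Sum.inl (Fin.last n)) = Sum.inl (Fin.castSucc j) := by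
  have h0 : (mapEquiv (bendEquiv n e) x).partner (Sum.inl (Fin.last n)) =
      bendEquiv n e (x.partner (Sum.inr (e none))) := by
    rw [← bendEquiv_none e, mapEquiv_partner]
  have h1 : ∀ a, (mapEquiv (bendEquiv n e) x).partner (Sum.inr a) =
      bendEquiv n e (x.partner (Sum.inr (e (some a)))) := by
    intro a
    rw [← bendEquiv_some e, mapEquiv_partner]
  constructor
  · intro hx
    have h2 : ∀ b, ∃ j, x.partner (Sum.inr b) = Sum.inl j := fun b => Sum.isLeft_iff.1 (hx b)
    refine ⟨fun a => ?_, ?_⟩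
    · obtain ⟨j, hj⟩ := h2 (e (some a))
      rw [h1, hj]
      rfl
    · obtain ⟨j, hj⟩ := h2 (e none)
      exact ⟨j, by rw [h0, hj, bendEquiv_inl]⟩
  · rintro ⟨hx, j, hj⟩
    rw [h0, ← bendEquiv_inl e] at hj
    have h3 := (bendEquiv n e).injective hj
    rw [Propagating, YoungDiagram.forall_option_equiv e]
    refine ⟨by rw [h3]; rfl, fun a => ?_⟩
    have h4 := hx a
    rw [h1] at h4
    rcases h5 : x.partner (Sum.inr (e (some a))) with i | b
    · rfl
    · exfalso
      obtain ⟨b, rfl⟩ := e.surjective b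
      rcases b with _ | b
      · have h6 := x.invol (Sum.inr (e (some a)))
        rw [h5, h3] at h6
        exact Sum.inl_ne_inr h6
      · rw [h5, bendEquiv_some] at h4
        exact Bool.false_ne_true h4

end Bend

section Branching

open Matching Diagram

variable {𝕜 : Type u} [CommRing 𝕜] {δ δ' : 𝕜} {n : ℕ}

namespace DeltaModel

section Restriction

variable {K : Type} [DecidableEq K] {V : Type u} [AddCommGroup V] [Module 𝕜 V]
  {ρ : Representation 𝕜 (Equiv.Perm K) V} {D : Type u} [AddCommGroup D]
  [Module (PartialBrauer δ δ' (n + 1)) D] (M : DeltaModel δ δ' (n + 1) ρ D)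

/-- The generators of the restricted module. -/
def rtens (y : Matching (Fin (n + 1) ⊕ K)) : V →+ Restrict δ δ' n D := M.tens y

theorem rtens_eq_zero {y : Matching (Fin (n + 1) ⊕ K)} (hy : ¬ Propagating y) : M.rtens y = 0 :=
  M.tens_eq_zero y hy

theorem rtens_permute (y : Matching (Fin (n + 1) ⊕ K)) (w : Equiv.Perm K) (v : V) :
    M.rtens (permute y w) v = M.rtens y (ρ w v) := M.tens_permute y w v

theorem smul_rtens (a : 𝕜) (d : Diagram n) (y : Matching (Fin (n + 1) ⊕ K)) (v : V) :
    (a • PartialBrauer.of δ δ' d) • M.rtens y v =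
      M.rtens (act (addStrand d) y) ((a * actCoef δ δ' (addStrand d) y) • v) := by
  refine Eq.trans ?_ (M.smul_tens a (addStrand d) y v)
  change (PartialBrauer.strandHom δ δ' (a • PartialBrauer.of δ δ' d)) • M.tens y v = _
  rw [map_smul]
  congr 2
  exact PartialBrauer.lift_of ..

theorem hom_ext_rtens {N : Type*} [AddCommGroup N] {f g : Restrict δ δ' n D →+ N}
    (h : ∀ y v, Propagating y → f (M.rtens y v) = g (M.rtens y v)) : f = g :=
  M.hom_ext h

theorem exists_rlift (N : Type u) [AddCommGroup N] (φ : Matching (Fin (n + 1) ⊕ K) → V →+ N)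
    (h : ∀ y w v, Propagating y → φ (permute y w) v = φ y (ρ w v)) :
    ∃ L : Restrict δ δ' n D →+ N, ∀ y, Propagating y → ∀ v, L (M.rtens y v) = φ y v :=
  M.exists_lift N φ h

theorem exists_linear_rlift {N : Type u} [AddCommGroup N] [Module (PartialBrauer δ δ' n) N]
    (φ : Matching (Fin (n + 1) ⊕ K) → V →+ N) (h0 : ∀ y, ¬ Propagating y → φ y = 0)
    (hp : ∀ y w v, φ (permute y w) v = φ y (ρ w v))
    (hs : ∀ a d y v, (a • PartialBrauer.of δ δ' d) • φ y v =
      φ (act (addStrand d) y) ((a * actCoef δ δ' (addStrand d) y) • v)) :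
    ∃ L : Restrict δ δ' n D →ₗ[PartialBrauer δ δ' n] N, ∀ y v, L (M.rtens y v) = φ y v := by
  obtain ⟨L, hL⟩ := M.exists_rlift N φ fun x w v _ => hp x w v
  have hL' : ∀ y v, L (M.rtens y v) = φ y v := by
    intro y v
    by_cases hy : Propagating y
    · exact hL y hy v
    · rw [M.rtens_eq_zero hy, h0 y hy, AddMonoidHom.zero_apply, AddMonoidHom.zero_apply, map_zero]
  refine ⟨{ L with map_smul' := fun a z => ?_ }, hL'⟩
  change L (a • z) = a • L z
  induction a using PartialBrauer.induction with
  | h0 => rw [zero_smul, zero_smul, map_zero]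
  | hadd a b ha hb => rw [add_smul, add_smul, map_add, ha, hb]
  | hof a d =>
    have h : L.comp (DistribSMul.toAddMonoidHom _ (a • PartialBrauer.of δ δ' d)) =
        (DistribSMul.toAddMonoidHom _ (a • PartialBrauer.of δ δ' d)).comp L := by
      refine M.hom_ext_rtens fun y v _ => ?_
      change L ((a • PartialBrauer.of δ δ' d) • M.rtens y v) =
        (a • PartialBrauer.of δ δ' d) • L (M.rtens y v)
      rw [M.smul_rtens, hL', hL', hs]
    exact DFunLike.congr_fun h z

end Restriction

section Point

variable {K : Type} [DecidableEq K] {V : Type u} [AddCommGroup V] [Module 𝕜 V]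
  {ρ : Representation 𝕜 (Equiv.Perm K) V} {D D' : Type u} [AddCommGroup D]
  [Module (PartialBrauer δ δ' (n + 1)) D] (M : DeltaModel δ δ' (n + 1) ρ D)
  [AddCommGroup D'] [Module (PartialBrauer δ δ' n) D'] (M' : DeltaModel δ δ' n ρ D')

theorem exists_point_hom : ∃ f : D' →ₗ[PartialBrauer δ δ' n] Restrict δ δ' n D,
    ∀ x v, f (M'.tens x v) = M.rtens (addPoint x) v := by
  refine M'.exists_linear_lift (fun x => M.rtens (addPoint x)) (fun x hx => ?_) (fun x w v => ?_)
    fun a d x v => ?_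
  · exact M.rtens_eq_zero fun h => hx (propagating_addPoint.1 h)
  · rw [addPoint_permute, M.rtens_permute]
  · rw [M.smul_rtens, (act_addPoint d x).1, actCoef, (act_addPoint d x).2, actCoef]

/-- Only an additive map is claimed: arcs are sent to 0, but the action can turn an arc into an
isolated last vertex. -/
theorem exists_point_retraction : ∃ r : Restrict δ δ' n D →+ D',
    (∀ x v, r (M.rtens (addPoint x) v) = M'.tens x v) ∧
      ∀ y v, y.partner (Sum.inl (Fin.last n)) ≠ Sum.inl (Fin.last n) → r (M.rtens y v) = 0 := by
  classical
  let φ : Matching (Fin (n + 1) ⊕ K) → V →+ D' := fun y =>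
    if h : ∃ x, y = addPoint x then M'.tens h.choose else 0
  have h1 : ∀ x, φ (addPoint x) = M'.tens x := by
    intro x
    have h : ∃ x', addPoint x = addPoint x' := ⟨x, rfl⟩
    rw [show φ (addPoint x) = M'.tens h.choose from dif_pos h,
      ← addPoint_injective h.choose_spec]
  have h2 : ∀ y, (¬ ∃ x, y = addPoint x) → φ y = 0 := fun y hy => dif_neg hy
  obtain ⟨r, hr⟩ := M.exists_rlift D' φ fun y w v _ => by
    by_cases h : ∃ x, y = addPoint x
    · obtain ⟨x, rfl⟩ := h
      rw [← addPoint_permute, h1, h1, M'.tens_permute]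
    · rw [h2 y h, h2, AddMonoidHom.zero_apply, AddMonoidHom.zero_apply]
      rintro ⟨x, hx⟩
      refine h ⟨permute x w⁻¹, ?_⟩
      rw [addPoint_permute, ← hx, permute_permute, mul_inv_cancel, permute_one]
  refine ⟨r, fun x v => ?_, fun y v hy => ?_⟩
  · by_cases hx : Propagating x
    · rw [hr _ (propagating_addPoint.2 hx), h1]
    · rw [M'.tens_eq_zero x hx, M.rtens_eq_zero fun h => hx (propagating_addPoint.1 h),
        AddMonoidHom.zero_apply, map_zero, AddMonoidHom.zero_apply]
  · by_cases hp : Propagating y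
    · rw [hr _ hp, h2, AddMonoidHom.zero_apply]
      rintro ⟨x, rfl⟩
      exact hy (addPoint_last x)
    · rw [M.rtens_eq_zero hp, AddMonoidHom.zero_apply, map_zero]

end Point

end DeltaModel

end Branching

end

/-! ### The summand in which the last vertex lies on a propagating line. -/

noncomputable section

set_option linter.unusedSectionVars false

open scoped TensorProduct DirectSum

universe u

section Line

open Matching Diagram

variable {𝕜 : Type u} [CommRing 𝕜] {δ δ' : 𝕜} {n : ℕ}

namespace DeltaModel

variable {A B : Type} [DecidableEq A] [DecidableEq B] {V : Type u} [AddCommGroup V] [Module 𝕜 V]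
  {ρ : Representation 𝕜 (Equiv.Perm B) V} {D : Type u} [AddCommGroup D]
  [Module (PartialBrauer δ δ' (n + 1)) D] (M : DeltaModel δ δ' (n + 1) ρ D)
  {ι : Type} [Fintype ι] [DecidableEq ι] {W : ι → Type u} [∀ i, AddCommGroup (W i)]
  [∀ i, Module 𝕜 (W i)] {ρ' : ∀ i, Representation 𝕜 (Equiv.Perm A) (W i)} {D' : ι → Type u}
  [∀ i, AddCommGroup (D' i)] [∀ i, Module (PartialBrauer δ δ' n) (D' i)]
  (M' : ∀ i, DeltaModel δ δ' n (ρ' i) (D' i))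

/-- The sum over all components of the generators with the same matching. -/
def sumTens (x : Matching (Fin n ⊕ A)) : (∀ i, W i) →+ ⨁ i, D' i :=
  ∑ i, (DirectSum.of D' i).comp (((M' i).tens x).comp (Pi.evalAddMonoidHom W i))

theorem sumTens_apply (x : Matching (Fin n ⊕ A)) (u : ∀ i, W i) :
    sumTens M' x u = ∑ i, DirectSum.of D' i ((M' i).tens x (u i)) := by
  rw [sumTens, AddMonoidHom.finsetSum_apply]
  rfl

theorem sumTens_single (x : Matching (Fin n ⊕ A)) (i : ι) (v : W i) :
    sumTens M' x (Pi.single i v) = DirectSum.of D' i ((M' i).tens x v) := by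
  rw [sumTens_apply, Finset.sum_eq_single_of_mem i (Finset.mem_univ i), Pi.single_eq_same]
  intro j _ hj
  rw [Pi.single_eq_of_ne hj, map_zero, map_zero]

theorem sumTens_eq_zero {x : Matching (Fin n ⊕ A)} (hx : ¬ Propagating x) : sumTens M' x = 0 := by
  refine AddMonoidHom.ext fun u => ?_
  rw [sumTens_apply]
  refine Finset.sum_eq_zero fun i _ => ?_
  rw [(M' i).tens_eq_zero x hx, AddMonoidHom.zero_apply, map_zero]

theorem sumTens_permute (x : Matching (Fin n ⊕ A)) (w : Equiv.Perm A) (u : ∀ i, W i) :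
    sumTens M' (permute x w) u = sumTens M' x fun i => ρ' i w (u i) := by
  rw [sumTens_apply, sumTens_apply]
  refine Finset.sum_congr rfl fun i _ => ?_
  rw [(M' i).tens_permute]

theorem smul_sumTens (a : 𝕜) (d : Diagram n) (x : Matching (Fin n ⊕ A)) (u : ∀ i, W i) :
    (a • PartialBrauer.of δ δ' d) • sumTens M' x u =
      sumTens M' (act d x) ((a * actCoef δ δ' d x) • u) := by
  rw [sumTens_apply, sumTens_apply, Finset.smul_sum]
  refine Finset.sum_congr rfl fun i _ => ?_
  rw [Pi.smul_apply, ← (M' i).smul_tens]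
  exact (map_smul (DirectSum.lof (PartialBrauer δ δ' n) ι D' i) _ _).symm

theorem hom_ext_sum {N : Type*} [AddCommGroup N] {f g : (⨁ i, D' i) →+ N}
    (h : ∀ i x v, Propagating x → f (DirectSum.of D' i ((M' i).tens x v)) =
      g (DirectSum.of D' i ((M' i).tens x v))) : f = g :=
  DirectSum.addHom_ext' fun i => (M' i).hom_ext fun x v hx => h i x v hx

/-- The stabilizer of the end `e none` acts on `V` through its decomposition `R` into the `W i`. So
attaching the line and embedding the vector by the inverse of `R` respects the permutation
relations. -/
theorem exists_line_hom
    (e : Option A ≃ B) (R : V ≃ₗ[𝕜] ∀ i, W i)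
    (hR : ∀ σ v i, R (ρ (YoungDiagram.extendPerm e σ) v) i = ρ' i σ (R v i)) :
    ∃ f : (⨁ i, D' i) →ₗ[PartialBrauer δ δ' n] Restrict δ δ' n D,
    ∀ i x v, f (DirectSum.of D' i ((M' i).tens x v)) =
      M.rtens (addLine e x) (R.symm (Pi.single i v)) := by
  have key : ∀ i, ∃ f : D' i →ₗ[PartialBrauer δ δ' n] Restrict δ δ' n D,
      ∀ x v, f ((M' i).tens x v) = M.rtens (addLine e x) (R.symm (Pi.single i v)) := by
    intro i
    let j : W i →ₗ[𝕜] V := R.symm.toLinearMap ∘ₗ LinearMap.single 𝕜 W i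
    refine (M' i).exists_linear_lift (fun x => (M.rtens (addLine e x)).comp j.toAddMonoidHom)
      (fun x hx => ?_) (fun x w v => ?_) fun a d x v => ?_
    · rw [M.rtens_eq_zero fun h => hx ((propagating_addLine e).1 h), AddMonoidHom.zero_comp]
    · change M.rtens (addLine e (permute x w)) (j v) = M.rtens (addLine e x) (j (ρ' i w v))
      rw [addLine_permute, M.rtens_permute]
      congr 1
      apply R.injective
      funext i'
      rw [hR]
      change ρ' i' w (R (R.symm (Pi.single i v)) i') = R (R.symm (Pi.single i (ρ' i w v))) i'
      rw [R.apply_symm_apply, R.apply_symm_apply]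
      rcases eq_or_ne i' i with rfl | h
      · rw [Pi.single_eq_same, Pi.single_eq_same]
      · rw [Pi.single_eq_of_ne h, Pi.single_eq_of_ne h, map_zero]
    · change _ • M.rtens (addLine e x) (j v) = M.rtens (addLine e (act d x)) (j (_ • v))
      rw [M.smul_rtens, (act_addLine e d x).1, actCoef, (act_addLine e d x).2, actCoef,
        map_smul j]
  choose f hf using key
  refine ⟨DirectSum.toModule _ _ _ f, fun i x v => ?_⟩
  rw [← hf]
  exact DirectSum.toModule_lof _ i _

theorem exists_line_retraction
    (e : Option A ≃ B) (R : V ≃ₗ[𝕜] ∀ i, W i)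
    (hR : ∀ σ v i, R (ρ (YoungDiagram.extendPerm e σ) v) i = ρ' i σ (R v i)) :
    ∃ r : Restrict δ δ' n D →+ ⨁ i, D' i,
    (∀ x w v, r (M.rtens (permute (addLine e x) w) v) = sumTens M' x (R (ρ w v))) ∧
      ∀ y v, (∀ b, y.partner (Sum.inl (Fin.last n)) ≠ Sum.inr b) → r (M.rtens y v) = 0 := by
  classical
  -- A generator of this kind has several normal forms. Two of them differ by a permutation fixing
  -- `e none`, which the equivariance of `R` moves into the component modules.
  have hwd : ∀ x w x' w' v, permute (addLine e x) w = permute (addLine e x') w' →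
      sumTens M' x (R (ρ w v)) = sumTens M' x' (R (ρ w' v)) := by
    intro x w x' w' v h
    have h1 : addLine e x' = permute (addLine e x) (w * w'⁻¹) := by
      rw [← permute_permute, h, permute_permute, mul_inv_cancel, permute_one]
    have h2 := permute_partner (addLine e x) (w * w'⁻¹) (Sum.inl (Fin.last n))
    rw [← h1, Sum.map_inl, id, addLine_last, addLine_last, Sum.map_inr] at h2
    have h3 : (w * w'⁻¹) (e none) = e none := by
      conv_lhs => rw [Sum.inr.inj h2]
      exact Equiv.apply_symm_apply _ _
    obtain ⟨τ, hτ⟩ := YoungDiagram.exists_extendPerm e h3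
    rw [← hτ, ← addLine_permute] at h1
    rw [addLine_injective e h1, sumTens_permute]
    congr 1
    funext i
    rw [← hR, hτ, ← Module.End.mul_apply, ← map_mul, inv_mul_cancel_right]
  let φ : Matching (Fin (n + 1) ⊕ B) → V →+ ⨁ i, D' i := fun y =>
    if h : ∃ q : Matching (Fin n ⊕ A) × Equiv.Perm B, y = permute (addLine e q.1) q.2 then
      (sumTens M' h.choose.1).comp (R.toLinearMap ∘ₗ ρ h.choose.2).toAddMonoidHom else 0
  have h1 : ∀ x w v, φ (permute (addLine e x) w) v = sumTens M' x (R (ρ w v)) := by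
    intro x w v
    have h : ∃ q : Matching (Fin n ⊕ A) × Equiv.Perm B,
        permute (addLine e x) w = permute (addLine e q.1) q.2 := ⟨(x, w), rfl⟩
    rw [show φ (permute (addLine e x) w) = (sumTens M' h.choose.1).comp
      (R.toLinearMap ∘ₗ ρ h.choose.2).toAddMonoidHom from dif_pos h]
    exact (hwd _ _ _ _ v h.choose_spec).symm
  have h2 : ∀ y, (¬ ∃ x w, y = permute (addLine e x) w) → φ y = 0 :=
    fun y hy => dif_neg fun ⟨q, hq⟩ => hy ⟨q.1, q.2, hq⟩
  obtain ⟨r, hr⟩ := M.exists_rlift (⨁ i, D' i) φ fun y w v _ => by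
    by_cases h : ∃ x w, y = permute (addLine e x) w
    · obtain ⟨x, w', rfl⟩ := h
      rw [permute_permute, h1, h1, map_mul]
      rfl
    · rw [h2 y h, h2, AddMonoidHom.zero_apply, AddMonoidHom.zero_apply]
      rintro ⟨x, w', hx⟩
      refine h ⟨x, w' * w⁻¹, ?_⟩
      rw [← permute_permute, ← hx, permute_permute, mul_inv_cancel, permute_one]
  refine ⟨r, fun x w v => ?_, fun y v hy => ?_⟩
  · by_cases hx : Propagating x
    · rw [hr _ ((propagating_permute w).2 ((propagating_addLine e).2 hx)), h1]
    · rw [sumTens_eq_zero M' hx, M.rtens_eq_zero fun h => hx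
        ((propagating_addLine e).1 ((propagating_permute w).1 h)),
        AddMonoidHom.zero_apply, map_zero, AddMonoidHom.zero_apply]
  · by_cases hp : Propagating y
    · rw [hr _ hp, h2, AddMonoidHom.zero_apply]
      rintro ⟨x, w, rfl⟩
      have h3 := permute_partner (addLine e x) w (Sum.inl (Fin.last n))
      rw [addLine_last] at h3
      exact hy _ h3
    · rw [M.rtens_eq_zero hp, AddMonoidHom.zero_apply, map_zero]

/-- The part of the restricted module in which the last vertex is on a propagating line. -/
theorem exists_line_split (M' : ∀ i, DeltaModel δ δ' n (ρ' i) (D' i))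
    (e : Option A ≃ B) (R : V ≃ₗ[𝕜] ∀ i, W i)
    (hR : ∀ σ v i, R (ρ (YoungDiagram.extendPerm e σ) v) i = ρ' i σ (R v i)) :
    ∃ (f : (⨁ i, D' i) →ₗ[PartialBrauer δ δ' n] Restrict δ δ' n D)
    (r : Restrict δ δ' n D →+ ⨁ i, D' i), (∀ z, r (f z) = z) ∧
      (∀ y v b, y.partner (Sum.inl (Fin.last n)) = Sum.inr b →
        f (r (M.rtens y v)) = M.rtens y v) ∧
      (∀ y v, (∀ b, y.partner (Sum.inl (Fin.last n)) ≠ Sum.inr b) → r (M.rtens y v) = 0) ∧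
      ∀ (N : Type u) [AddCommGroup N] (h : Restrict δ δ' n D →+ N),
        (∀ y v b, y.partner (Sum.inl (Fin.last n)) = Sum.inr b → h (M.rtens y v) = 0) →
          ∀ z, h (f z) = 0 := by
  obtain ⟨f, hf⟩ := exists_line_hom M M' e R hR
  obtain ⟨r, hr, hr'⟩ := exists_line_retraction M M' e R hR
  refine ⟨f, r, fun z => ?_, fun y v b hy => ?_, hr', fun N _ h hh z => ?_⟩
  · have h1 : r.comp f.toAddMonoidHom = AddMonoidHom.id _ := by
      refine hom_ext_sum M' fun i x v _ => ?_
      change r (f _) = _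
      rw [hf, ← permute_one (addLine e x), hr, map_one, Module.End.one_apply, R.apply_symm_apply,
        sumTens_single]
      rfl
    exact DFunLike.congr_fun h1 z
  · obtain ⟨x, w, rfl⟩ := exists_permute_addLine e hy
    have h1 : ∀ u : ∀ i, W i, f (sumTens M' x u) = M.rtens (addLine e x) (R.symm u) := by
      intro u
      rw [sumTens_apply, map_sum]
      simp only [hf]
      rw [← map_sum, ← map_sum, Finset.univ_sum_single]
    rw [hr, h1, R.symm_apply_apply, M.rtens_permute]
  · have h1 : h.comp f.toAddMonoidHom = 0 := by
      refine hom_ext_sum M' fun i x v _ => ?_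
      change h (f _) = 0
      rw [hf, hh _ _ _ (addLine_last e x)]
    exact DFunLike.congr_fun h1 z

end DeltaModel

end Line

end

/-! ### The quotient in which the last vertex is joined to a left-hand vertex. -/

noncomputable section

set_option linter.unusedSectionVars false

open scoped TensorProduct DirectSum

universe u

section Arc

open Matching Diagram

variable {𝕜 : Type u} [CommRing 𝕜] {δ δ' : 𝕜} {n : ℕ}

namespace DeltaModel

variable {A B : Type} [Fintype A] [Fintype B] [DecidableEq A] [DecidableEq B] {V : Type u}
  [AddCommGroup V] [Module 𝕜 V]
  {ρ : Representation 𝕜 (Equiv.Perm A) V} {D : Type u} [AddCommGroup D]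
  [Module (PartialBrauer δ δ' (n + 1)) D] (M : DeltaModel δ δ' (n + 1) ρ D)
  {ι : Type} [Fintype ι] [DecidableEq ι] {W : ι → Type u} [∀ i, AddCommGroup (W i)]
  [∀ i, Module 𝕜 (W i)] {ρ' : ∀ i, Representation 𝕜 (Equiv.Perm B) (W i)} {D' : ι → Type u}
  [∀ i, AddCommGroup (D' i)] [∀ i, Module (PartialBrauer δ δ' n) (D' i)]
  (M' : ∀ i, DeltaModel δ δ' n (ρ' i) (D' i))

/-- Unbend the last vertex and apply `up` to the vector. By `propagating_iff_bend` an isolated last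
vertex or one on a propagating line unbends to a non-propagating matching, hence to 0; this makes
the map linear although the action does not preserve arcs. -/
theorem exists_arc_hom (e : Option A ≃ B) (up : V →ₗ[𝕜] ∀ i, W i)
    (hup : ∀ σ v i, up (ρ σ v) i = ρ' i (YoungDiagram.extendPerm e σ) (up v i)) :
    ∃ g : Restrict δ δ' n D →ₗ[PartialBrauer δ δ' n] ⨁ i, D' i,
      (∀ x v, g (M.rtens (mapEquiv (bendEquiv n e) x) v) = sumTens M' x (up v)) ∧
      ∀ y v, (∀ j, y.partner (Sum.inl (Fin.last n)) ≠ Sum.inl (Fin.castSucc j)) →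
        g (M.rtens y v) = 0 := by
  obtain ⟨g, hg⟩ := M.exists_linear_rlift
    (fun y => (sumTens M' (mapEquiv (bendEquiv n e).symm y)).comp up.toAddMonoidHom)
    (fun y hy => by
      rw [sumTens_eq_zero M', AddMonoidHom.zero_comp]
      intro h
      rw [propagating_iff_bend e, mapEquiv_mapEquiv_symm] at h
      exact hy h.1)
    (fun y w v => by
      obtain ⟨x, rfl⟩ : ∃ x, y = mapEquiv (bendEquiv n e) x :=
        ⟨_, (mapEquiv_mapEquiv_symm _ y).symm⟩
      rw [← mapEquiv_bend_permute]
      simp only [mapEquiv_symm_mapEquiv]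
      change sumTens M' (permute x _) (up v) = sumTens M' x (up (ρ w v))
      rw [sumTens_permute]
      congr 1
      funext i
      rw [hup])
    (fun a d y v => by
      obtain ⟨x, rfl⟩ : ∃ x, y = mapEquiv (bendEquiv n e) x :=
        ⟨_, (mapEquiv_mapEquiv_symm _ y).symm⟩
      rw [(act_bend e d x).1, actCoef, (act_bend e d x).2]
      simp only [mapEquiv_symm_mapEquiv]
      change (a • PartialBrauer.of δ δ' d) • sumTens M' x (up v) =
        sumTens M' (act d x) (up ((a * actCoef δ δ' d x) • v))
      rw [smul_sumTens, map_smul up])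
  refine ⟨g, fun x v => ?_, fun y v hy => ?_⟩
  · rw [hg, mapEquiv_symm_mapEquiv]
    rfl
  · rw [hg, sumTens_eq_zero M', AddMonoidHom.zero_comp, AddMonoidHom.zero_apply]
    intro h
    rw [propagating_iff_bend e, mapEquiv_mapEquiv_symm] at h
    obtain ⟨j, hj⟩ := h.2
    exact hy j hj

/-- Writing u as the sum over b of the translates of `up` of v_b by coset representatives, the
generator x ⊗ u is the sum of the images of the bent matchings with vectors v_b. Bijectivity of `U`
makes the v_b unique. -/
theorem exists_arc_section (e : Option A ≃ B) (up : V →ₗ[𝕜] ∀ i, W i)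
    (hup : ∀ σ v i, up (ρ σ v) i = ρ' i (YoungDiagram.extendPerm e σ) (up v i))
    (U : (B → V) ≃ₗ[𝕜] ∀ i, W i)
    (hU : ∀ b v i, U (Pi.single b v) i = ρ' i (Equiv.swap b (e none)) (up v i)) :
    ∃ s : (⨁ i, D' i) →+ Restrict δ δ' n D, ∀ x u, Propagating x →
      s (sumTens M' x u) = ∑ b, M.rtens (mapEquiv (bendEquiv n e)
        (permute x (Equiv.swap b (e none)))) (U.symm u b) := by
  let S : Matching (Fin n ⊕ B) → (∀ i, W i) →+ Restrict δ δ' n D := fun x =>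
    ∑ b, (M.rtens (mapEquiv (bendEquiv n e) (permute x (Equiv.swap b (e none))))).comp
      (LinearMap.proj b ∘ₗ U.symm.toLinearMap).toAddMonoidHom
  have hS : ∀ x u, S x u = ∑ b, M.rtens (mapEquiv (bendEquiv n e)
      (permute x (Equiv.swap b (e none)))) (U.symm u b) := by
    intro x u
    rw [AddMonoidHom.finsetSum_apply]
    rfl
  have hS1 : ∀ x b v, S x (U (Pi.single b v)) =
      M.rtens (mapEquiv (bendEquiv n e) (permute x (Equiv.swap b (e none)))) v := by
    intro x b v
    rw [hS, U.symm_apply_apply, Finset.sum_eq_single_of_mem b (Finset.mem_univ b),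
      Pi.single_eq_same]
    intro b' _ hb
    rw [Pi.single_eq_of_ne hb, map_zero]
  have hS2 : ∀ x σ u, S (permute x σ) u = S x fun i => ρ' i σ (u i) := by
    intro x σ u
    let T : (∀ i, W i) →ₗ[𝕜] ∀ i, W i := LinearMap.pi fun i => ρ' i σ ∘ₗ LinearMap.proj i
    have h1 : (S (permute x σ)).comp U.toLinearMap.toAddMonoidHom =
        ((S x).comp T.toAddMonoidHom).comp U.toLinearMap.toAddMonoidHom := by
      refine AddMonoidHom.functions_ext _ _ _ fun b v => ?_
      change S (permute x σ) (U (Pi.single b v)) = S x (T (U (Pi.single b v)))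
      -- Acting by `σ` moves the coset of `b` to that of `b'`, and the remaining factor `τ` in the
      -- stabilizer acts on the vector.
      obtain ⟨τ, hτ⟩ := YoungDiagram.exists_eq_swap_mul e (σ * Equiv.swap b (e none))
      set b' := (σ * Equiv.swap b (e none)) (e none)
      have h2 : T (U (Pi.single b v)) = U (Pi.single b' (ρ τ v)) := by
        funext i
        change ρ' i σ (U (Pi.single b v) i) = _
        rw [hU, hU, hup, ← Module.End.mul_apply, ← Module.End.mul_apply, ← map_mul, ← map_mul, hτ]
      rw [h2, hS1, hS1, permute_permute, hτ, ← permute_permute, mapEquiv_bend_permute,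
        M.rtens_permute]
    have h2 := DFunLike.congr_fun h1 (U.symm u)
    change S (permute x σ) (U (U.symm u)) = S x (T (U (U.symm u))) at h2
    rw [U.apply_symm_apply] at h2
    exact h2
  have key : ∀ i, ∃ s : D' i →+ Restrict δ δ' n D, ∀ x, Propagating x → ∀ v,
      s ((M' i).tens x v) = S x (Pi.single i v) := by
    intro i
    refine (M' i).exists_lift (Restrict δ δ' n D)
      (fun x => (S x).comp (AddMonoidHom.single W i)) fun x w v _ => ?_
    change S (permute x w) (Pi.single i v) = S x (Pi.single i (ρ' i w v))
    rw [hS2]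
    congr 1
    funext i'
    rcases eq_or_ne i' i with rfl | h
    · rw [Pi.single_eq_same, Pi.single_eq_same]
    · rw [Pi.single_eq_of_ne h, Pi.single_eq_of_ne h, map_zero]
  choose s hs using key
  refine ⟨DirectSum.toAddMonoid s, fun x u hx => ?_⟩
  rw [← hS, sumTens_apply, map_sum]
  simp only [DirectSum.toAddMonoid_of]
  rw [Finset.sum_congr rfl fun i _ => hs i x hx (u i), ← map_sum, Finset.univ_sum_single]

/-- The quotient of the restricted module in which the last vertex is joined to another left-hand
vertex. -/
theorem exists_arc_split (M' : ∀ i, DeltaModel δ δ' n (ρ' i) (D' i)) (e : Option A ≃ B)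
    (up : V →ₗ[𝕜] ∀ i, W i)
    (hup : ∀ σ v i, up (ρ σ v) i = ρ' i (YoungDiagram.extendPerm e σ) (up v i))
    (U : (B → V) ≃ₗ[𝕜] ∀ i, W i)
    (hU : ∀ b v i, U (Pi.single b v) i = ρ' i (Equiv.swap b (e none)) (up v i)) :
    ∃ (g : Restrict δ δ' n D →ₗ[PartialBrauer δ δ' n] ⨁ i, D' i)
      (s : (⨁ i, D' i) →+ Restrict δ δ' n D), Function.Surjective g ∧
      (∀ y v, (∀ j, y.partner (Sum.inl (Fin.last n)) ≠ Sum.inl (Fin.castSucc j)) →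
        g (M.rtens y v) = 0) ∧
      ∀ y v j, Propagating y → y.partner (Sum.inl (Fin.last n)) = Sum.inl (Fin.castSucc j) →
        s (g (M.rtens y v)) = M.rtens y v := by
  obtain ⟨g, hg, hg'⟩ := exists_arc_hom M M' e up hup
  obtain ⟨s, hs⟩ := exists_arc_section M M' e up hup U hU
  refine ⟨g, s, fun z => ⟨s z, ?_⟩, hg', fun y v j hy hj => ?_⟩
  · have h1 : g.toAddMonoidHom.comp s = AddMonoidHom.id _ := by
      refine hom_ext_sum M' fun i x v hx => ?_
      change g (s _) = DirectSum.of D' i ((M' i).tens x v)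
      rw [← sumTens_single, hs _ _ hx, map_sum]
      simp only [hg, sumTens_permute]
      rw [← map_sum]
      congr 1
      rw [← U.apply_symm_apply (Pi.single i v), ← Finset.univ_sum_single (U.symm (Pi.single i v)),
        map_sum]
      simp only [map_sum, U.symm_apply_apply]
      refine Finset.sum_congr rfl fun b _ => funext fun i' => ?_
      rw [hU, Finset.sum_apply, Finset.sum_pi_single]
      simp
    exact DFunLike.congr_fun h1 z
  · obtain ⟨x, rfl⟩ : ∃ x, y = mapEquiv (bendEquiv n e) x :=
      ⟨_, (mapEquiv_mapEquiv_symm _ y).symm⟩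
    have hx := (propagating_iff_bend e).2 ⟨hy, j, hj⟩
    -- The identity coset: the representative belonging to `e none` is the trivial transposition.
    have h1 : up v = U (Pi.single (e none) v) := by
      funext i
      rw [hU, Equiv.swap_self, ← Equiv.Perm.one_def, map_one]
      rfl
    rw [hg, hs _ _ hx, h1, U.symm_apply_apply, Finset.sum_eq_single_of_mem _ (Finset.mem_univ (e none)),
      Pi.single_eq_same, Equiv.swap_self, ← Equiv.Perm.one_def, permute_one]
    intro b _ hb
    rw [Pi.single_eq_of_ne hb, map_zero]

end DeltaModel

end Arc

/-! ### Assembling the short exact sequence. -/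

section Theorem

open Matching Diagram YoungDiagram

variable {𝕜 : Type u} [CommRing 𝕜] {δ δ' : 𝕜} {n : ℕ}

/-- Three maps out of generators of the three kinds combine to a short exact sequence. -/
theorem DeltaModel.exact_of_split {K : Type} [DecidableEq K] {V : Type u} [AddCommGroup V]
    [Module 𝕜 V] {ρ : Representation 𝕜 (Equiv.Perm K) V} {D D₁ D₂ D₃ : Type u} [AddCommGroup D]
    [Module (PartialBrauer δ δ' (n + 1)) D] (M : DeltaModel δ δ' (n + 1) ρ D)
    [AddCommGroup D₁] [Module (PartialBrauer δ δ' n) D₁] (M₁ : DeltaModel δ δ' n ρ D₁)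
    [AddCommGroup D₂] [Module (PartialBrauer δ δ' n) D₂]
    [AddCommGroup D₃] [Module (PartialBrauer δ δ' n) D₃]
    (h₂ : ∃ (f : D₂ →ₗ[PartialBrauer δ δ' n] Restrict δ δ' n D)
      (r : Restrict δ δ' n D →+ D₂), (∀ z, r (f z) = z) ∧
      (∀ y v b, y.partner (Sum.inl (Fin.last n)) = Sum.inr b →
        f (r (M.rtens y v)) = M.rtens y v) ∧
      (∀ y v, (∀ b, y.partner (Sum.inl (Fin.last n)) ≠ Sum.inr b) → r (M.rtens y v) = 0) ∧
      ∀ (N : Type u) [AddCommGroup N] (h : Restrict δ δ' n D →+ N),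
        (∀ y v b, y.partner (Sum.inl (Fin.last n)) = Sum.inr b → h (M.rtens y v) = 0) →
          ∀ z, h (f z) = 0)
    (h₃ : ∃ (g : Restrict δ δ' n D →ₗ[PartialBrauer δ δ' n] D₃)
      (s : D₃ →+ Restrict δ δ' n D), Function.Surjective g ∧
      (∀ y v, (∀ j, y.partner (Sum.inl (Fin.last n)) ≠ Sum.inl (Fin.castSucc j)) →
        g (M.rtens y v) = 0) ∧
      ∀ y v j, Propagating y → y.partner (Sum.inl (Fin.last n)) = Sum.inl (Fin.castSucc j) →
        s (g (M.rtens y v)) = M.rtens y v) :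
    ∃ (f : (D₁ × D₂) →ₗ[PartialBrauer δ δ' n] Restrict δ δ' n D)
      (g : Restrict δ δ' n D →ₗ[PartialBrauer δ δ' n] D₃),
      Function.Injective f ∧ Function.Exact f g ∧ Function.Surjective g := by
  obtain ⟨f₂, r₂, hrf₂, hfr₂, hr₂, hh₂⟩ := h₂
  obtain ⟨g, s, hsurj, hg, hsg⟩ := h₃
  obtain ⟨f₁, hf₁⟩ := exists_point_hom M M₁
  obtain ⟨r₁, hr₁, hr₁'⟩ := exists_point_retraction M M₁
  have hrf₁ : ∀ z, r₁ (f₁ z) = z := by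
    have h : r₁.comp f₁.toAddMonoidHom = AddMonoidHom.id _ := by
      refine M₁.hom_ext fun x v _ => ?_
      change r₁ (f₁ _) = _
      rw [hf₁, hr₁]
      rfl
    exact DFunLike.congr_fun h
  have hr₂f₁ : ∀ z, r₂ (f₁ z) = 0 := by
    have h : r₂.comp f₁.toAddMonoidHom = 0 := by
      refine M₁.hom_ext fun x v _ => ?_
      change r₂ (f₁ _) = 0
      rw [hf₁, hr₂]
      intro b
      rw [addPoint_last]
      exact Sum.inl_ne_inr
    exact DFunLike.congr_fun h
  have hgf₁ : ∀ z, g (f₁ z) = 0 := by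
    have h : g.toAddMonoidHom.comp f₁.toAddMonoidHom = 0 := by
      refine M₁.hom_ext fun x v _ => ?_
      change g (f₁ _) = 0
      rw [hf₁, hg]
      intro j
      rw [addPoint_last]
      exact fun h => (Fin.castSucc_lt_last j).ne (Sum.inl.inj h).symm
    exact DFunLike.congr_fun h
  have hr₁f₂ : ∀ z, r₁ (f₂ z) = 0 := hh₂ _ r₁ fun y v b hy => hr₁' y v (by
    rw [hy]
    exact Sum.inr_ne_inl)
  have hgf₂ : ∀ z, g (f₂ z) = 0 := hh₂ _ g.toAddMonoidHom fun y v b hy => hg y v (by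
    rw [hy]
    exact fun j => Sum.inr_ne_inl)
  -- On each generator exactly one summand reproduces it and the other two vanish. The identity
  -- shows that the kernel of `g` lies in the image of `f₁` and `f₂`.
  have hid : ∀ z, f₁ (r₁ z) + f₂ (r₂ z) + s (g z) = z := by
    have h : f₁.toAddMonoidHom.comp r₁ + f₂.toAddMonoidHom.comp r₂ + s.comp g.toAddMonoidHom =
        AddMonoidHom.id _ := by
      refine M.hom_ext_rtens fun y v hy => ?_
      change f₁ (r₁ (M.rtens y v)) + f₂ (r₂ (M.rtens y v)) + s (g (M.rtens y v)) = M.rtens y v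
      rcases hl : y.partner (Sum.inl (Fin.last n)) with i | b
      · have h2 : r₂ (M.rtens y v) = 0 := hr₂ y v fun b => by
          rw [hl]
          exact Sum.inl_ne_inr
        rw [h2, map_zero, add_zero]
        induction i using Fin.lastCases with
        | last =>
          have h3 : g (M.rtens y v) = 0 := hg y v fun j => by
            rw [hl]
            exact fun h => (Fin.castSucc_lt_last j).ne (Sum.inl.inj h).symm
          obtain ⟨x, rfl⟩ := exists_addPoint hl
          rw [h3, map_zero, add_zero, hr₁, hf₁]
        | cast j =>
          have h1 : r₁ (M.rtens y v) = 0 := hr₁' y v (by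
            rw [hl]
            exact fun h => (Fin.castSucc_lt_last j).ne (Sum.inl.inj h))
          rw [h1, map_zero, zero_add, hsg y v j hy hl]
      · have h1 : r₁ (M.rtens y v) = 0 := hr₁' y v (by
          rw [hl]
          exact Sum.inr_ne_inl)
        have h3 : g (M.rtens y v) = 0 := hg y v fun j => by
          rw [hl]
          exact Sum.inr_ne_inl
        rw [h1, h3, map_zero, map_zero, zero_add, add_zero, hfr₂ y v b hl]
    exact DFunLike.congr_fun h
  refine ⟨f₁.coprod f₂, g, ?_, ?_, hsurj⟩
  · rw [injective_iff_map_eq_zero]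
    rintro ⟨z₁, z₂⟩ h
    rw [LinearMap.coprod_apply] at h
    have h1 := congrArg r₁ h
    have h2 := congrArg r₂ h
    rw [map_add, hrf₁, hr₁f₂, map_zero, add_zero] at h1
    rw [map_add, hr₂f₁, hrf₂, map_zero, zero_add] at h2
    exact Prod.ext h1 h2
  · intro z
    constructor
    · intro hz
      refine ⟨(r₁ z, r₂ z), ?_⟩
      have h := hid z
      rw [hz, map_zero, add_zero] at h
      rw [LinearMap.coprod_apply, h]
    · rintro ⟨⟨z₁, z₂⟩, rfl⟩
      rw [LinearMap.coprod_apply, map_add, hgf₁, hgf₂, add_zero]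

theorem DeltaModel.subsingleton_of_lt {k : ℕ} (hk : n < k) {V : Type u} [AddCommGroup V]
    [Module 𝕜 V] {ρ : Representation 𝕜 (Equiv.Perm (Fin k)) V} {D : Type u} [AddCommGroup D]
    [Module (PartialBrauer δ δ' n) D] (M : DeltaModel δ δ' n ρ D) : Subsingleton D := by
  refine subsingleton_of_forall_eq 0 fun z => ?_
  refine M.induction (P := fun z => z = 0) z rfl (fun x y hx hy => by rw [hx, hy, add_zero])
    (fun x hx => by rw [hx, neg_zero]) fun x v hx => ?_
  exact absurd (card_le_of_propagating hx) (not_le.2 hk)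

end Theorem

end

noncomputable section

set_option linter.unusedSectionVars false

open scoped TensorProduct DirectSum

universe u

section Theorem

open Matching Diagram YoungDiagram

variable {𝕜 : Type u} [CommRing 𝕜] {δ δ' : 𝕜} {n : ℕ}

theorem isUnit_factorial_of_le (hn : IsUnit (n.factorial : 𝕜)) {k : ℕ} (hk : k ≤ n) :
    IsUnit (k.factorial : 𝕜) :=
  isUnit_of_dvd_unit (Nat.cast_dvd_cast (Nat.factorial_dvd_factorial hk)) hn

/-- The Specht modules of the diagrams with one node less, inside the restricted Specht module. -/
theorem exists_down_split (hn : IsUnit (n.factorial : 𝕜)) {lam : YoungDiagram}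
    (hlam : lam.card ≤ n + 1) {D : Type u} [AddCommGroup D] [Module (PartialBrauer δ δ' (n + 1)) D]
    (M : DeltaModel δ δ' (n + 1) (lam.actBase 𝕜 (Fin lam.card)) D)
    (e : ℕ → Diagram n) (he : ∀ k ≤ n, (e k).propNumber = k) :
    ∃ (f : (DirectSum {μ : YoungDiagram // μ.Arrow lam} fun μ => Delta δ δ' (e μ.1.card) μ.1)
        →ₗ[PartialBrauer δ δ' n] Restrict δ δ' n D)
      (r : Restrict δ δ' n D →+
        DirectSum {μ : YoungDiagram // μ.Arrow lam} fun μ => Delta δ δ' (e μ.1.card) μ.1),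
      (∀ z, r (f z) = z) ∧
      (∀ y v b, y.partner (Sum.inl (Fin.last n)) = Sum.inr b →
        f (r (M.rtens y v)) = M.rtens y v) ∧
      (∀ y v, (∀ b, y.partner (Sum.inl (Fin.last n)) ≠ Sum.inr b) → r (M.rtens y v) = 0) ∧
      ∀ (N : Type u) [AddCommGroup N] (h : Restrict δ δ' n D →+ N),
        (∀ y v b, y.partner (Sum.inl (Fin.last n)) = Sum.inr b → h (M.rtens y v) = 0) →
          ∀ z, h (f z) = 0 := by
  classical
  generalize hk : lam.card = k at M hlam
  rcases k with _ | k
  -- For the empty diagram there is nothing to remove, and no right-hand vertex to which the last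
  -- vertex could be joined.
  · have hE : IsEmpty {μ : YoungDiagram // μ.Arrow lam} := ⟨fun μ => by
      have := μ.2.card_eq
      omega⟩
    exact ⟨0, 0, fun z => Subsingleton.elim _ _, fun y v b => b.elim0, fun y v _ => rfl,
      fun N _ h _ z => map_zero h⟩
  · have hM : ∀ μ : {μ : YoungDiagram // μ.Arrow lam}, Nonempty
        (DeltaModel δ δ' n (μ.1.actBase 𝕜 (Fin k)) (Delta δ δ' (e μ.1.card) μ.1)) := by
      intro μ
      have hμ : μ.1.card = k := by
        have := μ.2.card_eq
        omega
      exact nonempty_deltaModel δ δ' _ _ hμ fun h => by rw [hμ, he k h]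
    let ε : Option (Fin k) ≃ Fin (k + 1) := finSuccEquivLast.symm
    exact DeltaModel.exists_line_split M (fun μ => (hM μ).some) ε
      (LinearEquiv.ofBijective _ (lam.resBase_bijective 𝕜 hk ε
        (isUnit_factorial_of_le hn (by omega)))) fun σ v μ => lam.resBase_act 𝕜 ε σ v μ

/-- The Specht modules of the diagrams with one node more, as a quotient of the restricted Specht
module. -/
theorem exists_up_split (hn : IsUnit (n.factorial : 𝕜)) {lam : YoungDiagram}
    {D : Type u} [AddCommGroup D] [Module (PartialBrauer δ δ' (n + 1)) D]
    (M : DeltaModel δ δ' (n + 1) (lam.actBase 𝕜 (Fin lam.card)) D)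
    (e : ℕ → Diagram n) (he : ∀ k ≤ n, (e k).propNumber = k) :
    ∃ (g : Restrict δ δ' n D →ₗ[PartialBrauer δ δ' n]
        DirectSum {μ : YoungDiagram // lam.Arrow μ} fun μ => Delta δ δ' (e μ.1.card) μ.1)
      (s : (DirectSum {μ : YoungDiagram // lam.Arrow μ} fun μ => Delta δ δ' (e μ.1.card) μ.1) →+
        Restrict δ δ' n D), Function.Surjective g ∧
      (∀ y v, (∀ j, y.partner (Sum.inl (Fin.last n)) ≠ Sum.inl (Fin.castSucc j)) →
        g (M.rtens y v) = 0) ∧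
      ∀ y v j, Propagating y → y.partner (Sum.inl (Fin.last n)) = Sum.inl (Fin.castSucc j) →
        s (g (M.rtens y v)) = M.rtens y v := by
  classical
  have hM : ∀ μ : {μ : YoungDiagram // lam.Arrow μ}, Nonempty
      (DeltaModel δ δ' n (μ.1.actBase 𝕜 (Fin (lam.card + 1))) (Delta δ δ' (e μ.1.card) μ.1)) := by
    intro μ
    have hμ : μ.1.card = lam.card + 1 := μ.2.card_eq
    exact nonempty_deltaModel δ δ' _ _ hμ fun h => by rw [hμ, he _ h]
  let ε : Option (Fin lam.card) ≃ Fin (lam.card + 1) := finSuccEquivLast.symm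
  rcases le_or_gt (lam.card + 1) n with h | h
  · exact DeltaModel.exists_arc_split M (fun μ => (hM μ).some) ε (lam.upBase 𝕜 ε)
      (fun σ v μ => congrFun (lam.upBase_act 𝕜 ε σ v) μ)
      (LinearEquiv.ofBijective _ (lam.indBase_bijective 𝕜 rfl ε (isUnit_factorial_of_le hn h)))
      fun b v μ => congrFun (lam.indBase_single 𝕜 ε b v) μ
  -- Here lam.card + 1 exceeds n and the factorial may fail to be invertible, but the target
  -- vanishes. Arcs do not occur either: unbending one would give a propagating matching with more
  -- than n right-hand vertices.
  · have hD : ∀ μ : {μ : YoungDiagram // lam.Arrow μ},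
        Subsingleton (Delta δ δ' (e μ.1.card) μ.1) :=
      fun μ => DeltaModel.subsingleton_of_lt h (hM μ).some
    have hS : Subsingleton
        (DirectSum {μ : YoungDiagram // lam.Arrow μ} fun μ => Delta δ δ' (e μ.1.card) μ.1) :=
      ⟨fun z z' => DFinsupp.ext fun μ => Subsingleton.elim _ _⟩
    refine ⟨0, 0, fun z => ⟨0, Subsingleton.elim _ _⟩, fun y v _ => rfl, fun y v j hy hj => ?_⟩
    exfalso
    have hx : Propagating (mapEquiv (bendEquiv n ε).symm y) := by
      rw [propagating_iff_bend ε, mapEquiv_mapEquiv_symm]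
      exact ⟨hy, j, hj⟩
    exact absurd (card_le_of_propagating hx) (not_le.2 h)

end Theorem

end

/-- The index is shifted: `n` stands for n - 1 of the informal statement. The diagram `e k`
represents the chosen cell of propagating number k ≤ n; for larger k it is irrelevant, as the module
is zero. -/
theorem theorem24 {𝕜 : Type*} [CommRing 𝕜] (δ δ' : 𝕜) (n : ℕ)
    (hn : IsUnit (n.factorial : 𝕜))
    (lam : YoungDiagram) (hlam : lam.card ≤ n + 1)
    (c : Diagram (n + 1)) (hc : c.propNumber = lam.card)
    (e : ℕ → Diagram n) (he : ∀ k ≤ n, (e k).propNumber = k) :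
    ∃ (f : (Delta δ δ' (e lam.card) lam ×
          DirectSum {μ : YoungDiagram // μ.Arrow lam} fun μ => Delta δ δ' (e μ.1.card) μ.1)
        →ₗ[PartialBrauer δ δ' n] Restrict δ δ' n (Delta δ δ' c lam))
      (g : Restrict δ δ' n (Delta δ δ' c lam) →ₗ[PartialBrauer δ δ' n]
        DirectSum {μ : YoungDiagram // lam.Arrow μ} fun μ => Delta δ δ' (e μ.1.card) μ.1),
      Function.Injective f ∧ Function.Exact f g ∧ Function.Surjective g := by
  obtain ⟨M⟩ := nonempty_deltaModel δ δ' c lam rfl fun _ => hc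
  obtain ⟨M₁⟩ := nonempty_deltaModel δ δ' (e lam.card) lam rfl fun h => he _ h
  exact DeltaModel.exact_of_split
    (D₂ := DirectSum {μ : YoungDiagram // μ.Arrow lam} fun μ => Delta δ δ' (e μ.1.card) μ.1)
    (D₃ := DirectSum {μ : YoungDiagram // lam.Arrow μ} fun μ => Delta δ δ' (e μ.1.card) μ.1)
    M M₁ (exists_down_split hn hlam M e he)
    (exists_up_split hn M e he)
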